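/- Let $d\ge 1$ and let $\Omega\subset\mathbb{R}^d$ be a nonempty, open, bounded and convex set with smooth boundary and exterior unit normal $\nu$. Let $F=F(x,z,p)\in C^2(\overline\Omega\times[0,\infty)\times\mathbb{R}^d)$ satisfy: (i) $F(x,z,p)=\widetilde F(x,z,|p|)$ for some $\widetilde F$ with $\partial_r\widetilde F(x,z,r)\ge 0$; (ii) there is $\gamma>0$ with $\mathrm{D}^2_{(x,z,p)}F(x,z,p)[(\xi,\zeta,\pi),(\xi,\zeta,\pi)]\ge\gamma|\pi|^2$ for all $(\xi,\zeta,\pi)\in\mathbb{R}^d\times\mathbb{R}\times\mathbb{R}^d$ and all $(x,z,p)\in\overline\Omega\times[0,\infty)\times\mathbb{R}^d$; (iii) there are constants $C\ge c>0$ and $D>0$ with $c|p|^2\le F(x,z,p)\le C(|p|^2+1)$ and $|F_x|,\ \operatorname{tr}F_{xx},\ z|F_z|,\ |F_p|^2\le D(|p|^2+1)$ on $\overline\Omega\times[0,\infty)\times\mathbb{R}^d$. Let $\mathscr{P}(\Omega)$ be the set of Borel probability measures on $\Omega$, with the $L^2$-Wasserstein distance $\mathbf{W}_2$. An absolutely continuous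 measure is identified with its Lebesgue density. For $\mu\in\mathscr{P}(\Omega)$ let $\Phi(\mu)=\int_\Omega F(x,u,\nabla u)\,\mathrm{d}x$ if $\mu$ has a density $u\in H^1(\Omega)$, and $\Phi(\mu)=+\infty$ otherwise. Let $u_0\in\mathscr{P}(\Omega)\cap H^1(\Omega)$, let $\tau>0$, and let $(u_\tau^n)_{n\ge 0}$ satisfy $$u_\tau^0=u_0,\qquad u_\tau^n\in\operatorname*{argmin}_{u\in\mathscr{P}(\Omega)}\Big(\tfrac1{2\tau}\mathbf{W}_2^2(u,u_\tau^{n-1})+\Phi(u)\Big)\quad(n\ge 1).$$ Put $u_\tau(t,\cdot)=u_\tau^n$ for $n=\lceil t/\tau\rceil$, $t\ge 0$. For functions $\rho,\psi$ let $$\mathcal{N}(x,\rho,\psi)=F_x\cdot\nabla\psi+(F-\rho F_z)\Delta\psi-F_p\cdot(\nabla\rho\,\Delta\psi+\rho\,\nabla\Delta\psi+\nabla^2\psi\,\nabla\rho),$$ where $F$ and its derivatives are evaluated at $(x,\rho(x),\nabla\rho(x))$. Then for all $\phi\in C^\infty(\overline\Omega)$ with $\partial_\nu\phi=0$ on $\partial\Omega$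 and all $\eta\in C_c^\infty((0,\infty))$, writing $\eta_\tau(s)=\eta(\lceil s/\tau\rceil\tau)$ for $s\ge0$, the functions $u_\tau\,\phi\,\frac{\eta_\tau(\cdot+\tau)-\eta_\tau}{\tau}$ and $\mathcal{N}(x,u_\tau,\phi)\,\eta_\tau$ are integrable on $(0,\infty)\times\Omega$, and $$\left|\int_0^\infty\!\!\int_\Omega u_\tau\,\phi\,\frac{\eta_\tau(t+\tau)-\eta_\tau(t)}{\tau}\,\mathrm{d}x\,\mathrm{d}t+\eta(\tau)\int_\Omega u_0\,\phi\,\mathrm{d}x-\int_0^\infty\!\!\int_\Omega\mathcal{N}(x,u_\tau,\phi)\,\eta_\tau(t)\,\mathrm{d}x\,\mathrm{d}t\right|\le\tau\,\|\phi\|_{C^2}\,\|\eta\|_{C^0}\,\Phi(u_0).$$ Here $\|\phi\|_{C^2}$ is the maximum of the suprema over $\Omega$ of $|\phi|$, $|\nabla\phi|$ and the operator norm of $\nabla^2\phi$, and $\|\eta\|_{C^0}=\sup|\eta|$. The term with $\eta(\tau)$ vanishes if $\eta(\tau)=0$, in particular whenever $\operatorname{supp}\eta\subset(\tau,\infty)$.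 -/

import Mathlib

open MeasureTheory Set
open scoped ENNReal ContDiff Gradient

namespace JKO

/-- The Euclidean space `ℝ^d`. -/
abbrev Rd (d : ℕ) := EuclideanSpace ℝ (Fin d)

/-! ### Domains with smooth boundary -/

/-- `ρ` is a smooth local defining function of `Ω` on the open neighbourhood `U` of `x`, with
nonvanishing differential at `x`. -/
structure IsLocalDefiningFunction {d : ℕ} (Ω : Set (Rd d)) (x : Rd d) (U : Set (Rd d))
    (ρ : Rd d → ℝ) : Prop where
  isOpen : IsOpen U
  mem : x ∈ U
  smooth : ContDiffOn ℝ ∞ ρ U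
  grad_ne : ∇ ρ x ≠ 0
  inter_eq : Ω ∩ U = {y ∈ U | ρ y < 0}

/-- Nonempty bounded convex open subsets of `ℝ^d` with smooth boundary. -/
structure IsSmoothConvexDomain {d : ℕ} (Ω : Set (Rd d)) : Prop where
  isOpen : IsOpen Ω
  nonempty : Ω.Nonempty
  bounded : Bornology.IsBounded Ω
  convex : Convex ℝ Ω
  smooth_boundary : ∀ x ∈ frontier Ω, ∃ U ρ, IsLocalDefiningFunction Ω x U ρ

/-- `n` is the exterior unit normal vector of `Ω` at the boundary point `x`. -/
def IsOuterUnitNormal {d : ℕ} (Ω : Set (Rd d)) (x n : Rd d) : Prop :=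
  ∃ U ρ, IsLocalDefiningFunction Ω x U ρ ∧ n = ‖∇ ρ x‖⁻¹ • ∇ ρ x

/-- `φ ∈ C^∞(closure Ω)` with vanishing normal derivative on `∂Ω`. -/
structure IsNeumannTest {d : ℕ} (Ω : Set (Rd d)) (φ : Rd d → ℝ) : Prop where
  smooth : ContDiffOn ℝ ∞ φ (closure Ω)
  neumann : ∀ x ∈ frontier Ω, ∀ n, IsOuterUnitNormal Ω x n →
    fderivWithin ℝ φ (closure Ω) x n = 0

/-- `η ∈ C_c^∞((0,∞))`, extended by zero. -/
structure IsTimeTest (η : ℝ → ℝ) : Prop where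
  smooth : ContDiff ℝ ∞ η
  compact : HasCompactSupport η
  support : tsupport η ⊆ Ioi 0

/-- The supremum over `Ω` of the operator norm of the `k`-th derivative of `φ`. -/
noncomputable def supDeriv {d : ℕ} (Ω : Set (Rd d)) (φ : Rd d → ℝ) (k : ℕ) : ℝ :=
  ⨆ x : Ω, ‖iteratedFDeriv ℝ k φ x‖

/-- The norm of `C²(closure Ω)`: the largest of the suprema of `|φ|`, `|∇φ|` and `‖∇²φ‖`. -/
noncomputable def normC2 {d : ℕ} (Ω : Set (Rd d)) (φ : Rd d → ℝ) : ℝ :=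
  max (supDeriv Ω φ 0) (max (supDeriv Ω φ 1) (supDeriv Ω φ 2))

/-- The norm of `C⁰`. -/
noncomputable def normC0 (η : ℝ → ℝ) : ℝ := ⨆ t : ℝ, |η t|

/-! ### The Sobolev space `H¹(Ω)` -/

/-- `g` is the weak gradient of `u` on `Ω`. -/
structure IsWeakGrad {d : ℕ} (Ω : Set (Rd d)) (u : Rd d → ℝ) (g : Rd d → Rd d) : Prop where
  locInt : LocallyIntegrableOn g Ω
  weak : ∀ ψ : Rd d → ℝ, ContDiff ℝ ∞ ψ → HasCompactSupport ψ → tsupport ψ ⊆ Ω →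
    ∀ v : Rd d, ∫ x in Ω, u x * fderiv ℝ ψ x v = -∫ x in Ω, inner ℝ (g x) v * ψ x

open Classical in
/-- The weak gradient of `u` on `Ω` (unique up to null sets), and `0` if there is none. -/
noncomputable def weakGrad {d : ℕ} (Ω : Set (Rd d)) (u : Rd d → ℝ) : Rd d → Rd d :=
  if h : ∃ g, IsWeakGrad Ω u g then h.choose else 0

/-- `u ∈ H¹(Ω)`. -/
def MemH1 {d : ℕ} (Ω : Set (Rd d)) (u : Rd d → ℝ) : Prop :=
  MemLp u 2 (volume.restrict Ω) ∧ ∃ g, IsWeakGrad Ω u g ∧ MemLp g 2 (volume.restrict Ω)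

/-! ### Probability measures and the Wasserstein distance -/

/-- `μ` is a Borel probability measure on `Ω`. -/
structure IsProbOn {d : ℕ} (Ω : Set (Rd d)) (μ : Measure (Rd d)) : Prop where
  prob : IsProbabilityMeasure μ
  null : μ Ωᶜ = 0

/-- `u` is (a version of) a probability density on `Ω`. -/
structure IsProbDensity {d : ℕ} (Ω : Set (Rd d)) (u : Rd d → ℝ) : Prop where
  aemeasurable : AEMeasurable u (volume.restrict Ω)
  nonneg : ∀ᵐ x ∂(volume.restrict Ω), 0 ≤ u x
  mass : ∫⁻ x in Ω, ENNReal.ofReal (u x) = 1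

/-- The measure on `Ω` with Lebesgue density `u`. -/
noncomputable def densityMeasure {d : ℕ} (Ω : Set (Rd d)) (u : Rd d → ℝ) : Measure (Rd d) :=
  (volume.restrict Ω).withDensity fun x => ENNReal.ofReal (u x)

/-- The transport plans from `μ` to `ν`. -/
def transportPlans {d : ℕ} (μ ν : Measure (Rd d)) : Set (Measure (Rd d × Rd d)) :=
  {γ | γ.map Prod.fst = μ ∧ γ.map Prod.snd = ν}

/-- The `L²`-Wasserstein distance. -/
noncomputable def W2 {d : ℕ} (μ ν : Measure (Rd d)) : ℝ≥0∞ :=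
  (⨅ γ ∈ transportPlans μ ν, ∫⁻ q, edist q.1 q.2 ^ 2 ∂γ) ^ (1 / 2 : ℝ)

/-! ### The Lagrangian and its energy -/

/-- The set `closure Ω × [0,∞) × ℝ^d` of arguments `(x, z, p)` of the Lagrangian. -/
def phaseSet {d : ℕ} (Ω : Set (Rd d)) : Set (Rd d × ℝ × Rd d) :=
  closure Ω ×ˢ Ici (0 : ℝ) ×ˢ univ

/-- The differential of `F` in `(x, z, p)`, one-sided at the boundary of `phaseSet Ω`. -/
noncomputable def DF {d : ℕ} (Ω : Set (Rd d)) (F : Rd d × ℝ × Rd d → ℝ)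
    (y : Rd d × ℝ × Rd d) : Rd d × ℝ × Rd d →L[ℝ] ℝ :=
  fderivWithin ℝ F (phaseSet Ω) y

/-- The partial derivative `F_x`, as a linear form on `ℝ^d`. -/
noncomputable def Fx {d : ℕ} (Ω : Set (Rd d)) (F : Rd d × ℝ × Rd d → ℝ)
    (y : Rd d × ℝ × Rd d) : Rd d →L[ℝ] ℝ :=
  (DF Ω F y).comp (ContinuousLinearMap.inl ℝ (Rd d) (ℝ × Rd d))

/-- The partial derivative `F_z`. -/
noncomputable def Fz {d : ℕ} (Ω : Set (Rd d)) (F : Rd d × ℝ × Rd d → ℝ)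
    (y : Rd d × ℝ × Rd d) : ℝ :=
  DF Ω F y (0, 1, 0)

/-- The partial derivative `F_p`, as a linear form on `ℝ^d`. -/
noncomputable def Fp {d : ℕ} (Ω : Set (Rd d)) (F : Rd d × ℝ × Rd d → ℝ)
    (y : Rd d × ℝ × Rd d) : Rd d →L[ℝ] ℝ :=
  (DF Ω F y).comp
    ((ContinuousLinearMap.inr ℝ (Rd d) (ℝ × Rd d)).comp (ContinuousLinearMap.inr ℝ ℝ (Rd d)))

/-- The second differential of `F` in `(x, z, p)`, as a quadratic form. -/
noncomputable def D2F {d : ℕ} (Ω : Set (Rd d)) (F : Rd d × ℝ × Rd d → ℝ)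
    (y h : Rd d × ℝ × Rd d) : ℝ :=
  iteratedFDerivWithin ℝ 2 F (phaseSet Ω) y ![h, h]

/-- The trace of `F_xx`. -/
noncomputable def trFxx {d : ℕ} (Ω : Set (Rd d)) (F : Rd d × ℝ × Rd d → ℝ)
    (y : Rd d × ℝ × Rd d) : ℝ :=
  ∑ i : Fin d, D2F Ω F y (EuclideanSpace.single i (1 : ℝ), 0, 0)

/-- The conditions on the Lagrangian `F`. -/
structure LagrangianAssumption {d : ℕ} (Ω : Set (Rd d)) (F : Rd d × ℝ × Rd d → ℝ) : Prop where
  contDiff : ContDiffOn ℝ 2 F (phaseSet Ω)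
  radial : ∃ G : Rd d → ℝ → ℝ → ℝ, ∀ x ∈ closure Ω, ∀ z, 0 ≤ z →
    (∀ r, 0 ≤ r → 0 ≤ derivWithin (G x z) (Ici 0) r) ∧ ∀ p, F (x, z, p) = G x z ‖p‖
  convex : ∃ γ : ℝ, 0 < γ ∧ ∀ y ∈ phaseSet Ω, ∀ h : Rd d × ℝ × Rd d,
    γ * ‖h.2.2‖ ^ 2 ≤ D2F Ω F y h
  bounds : ∃ c C : ℝ, 0 < c ∧ c ≤ C ∧ ∀ x ∈ closure Ω, ∀ z, 0 ≤ z → ∀ p,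
    c * ‖p‖ ^ 2 ≤ F (x, z, p) ∧ F (x, z, p) ≤ C * (‖p‖ ^ 2 + 1)
  deriv_bounds : ∃ D : ℝ, 0 < D ∧ ∀ x ∈ closure Ω, ∀ z, 0 ≤ z → ∀ p,
    ‖Fx Ω F (x, z, p)‖ ≤ D * (‖p‖ ^ 2 + 1) ∧
    trFxx Ω F (x, z, p) ≤ D * (‖p‖ ^ 2 + 1) ∧
    z * |Fz Ω F (x, z, p)| ≤ D * (‖p‖ ^ 2 + 1) ∧
    ‖Fp Ω F (x, z, p)‖ ^ 2 ≤ D * (‖p‖ ^ 2 + 1)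

/-- The energy `Φ(μ) = ∫_Ω F(x, u, ∇u) dx` if `μ` has a density `u ∈ H¹(Ω)`, and `+∞` otherwise.
Any two such densities of `μ` agree almost everywhere and give the same integral, so the infimum is
over at most one value. The Lagrangian is nonnegative on `phaseSet Ω`. -/
noncomputable def energy {d : ℕ} (Ω : Set (Rd d)) (F : Rd d × ℝ × Rd d → ℝ)
    (μ : Measure (Rd d)) : ℝ≥0∞ :=
  ⨅ (u : Rd d → ℝ) (_ : IsProbDensity Ω u ∧ MemH1 Ω u ∧ μ = densityMeasure Ω u),
    ∫⁻ x in Ω, ENNReal.ofReal (F (x, u x, weakGrad Ω u x))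

/-! ### The minimizing movement scheme -/

/-- The Yosida penalization `Φ_τ(μ; ν) = W₂(μ, ν)² / (2τ) + Φ(μ)`. -/
noncomputable def yosida {d : ℕ} (Ω : Set (Rd d)) (F : Rd d × ℝ × Rd d → ℝ) (τ : ℝ)
    (μ ν : Measure (Rd d)) : ℝ≥0∞ :=
  ENNReal.ofReal (1 / (2 * τ)) * W2 μ ν ^ 2 + energy Ω F μ

/-- `u 0 = u₀`, and for each `n ≥ 1` the probability density `u n` minimizes `Φ_τ(·; u (n - 1))`
over all probability measures on `Ω`. -/
structure IsMinimizingMovement {d : ℕ} (Ω : Set (Rd d)) (F : Rd d × ℝ × Rd d → ℝ) (τ : ℝ)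
    (u₀ : Rd d → ℝ) (u : ℕ → Rd d → ℝ) : Prop where
  zero : u 0 = u₀
  prob : ∀ n, IsProbDensity Ω (u n)
  minimal : ∀ n, ∀ ν, IsProbOn Ω ν →
    yosida Ω F τ (densityMeasure Ω (u (n + 1))) (densityMeasure Ω (u n)) ≤
      yosida Ω F τ ν (densityMeasure Ω (u n))

/-- The piecewise constant interpolant `u_τ(t) = u n` for `n = ⌈t/τ⌉`, `t ≥ 0`. -/
noncomputable def discreteSolution {d : ℕ} (τ : ℝ) (u : ℕ → Rd d → ℝ) (t : ℝ) : Rd d → ℝ :=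
  u ⌈t / τ⌉₊

/-- `η_τ(s) = η(⌈s/τ⌉ τ)`, `s ≥ 0`. -/
noncomputable def stepTest (τ : ℝ) (η : ℝ → ℝ) (s : ℝ) : ℝ := η (⌈s / τ⌉₊ * τ)

/-- The nonlinearity of the weak formulation,
`F_x · ∇ψ + (F - ρ F_z) Δψ - F_p · (∇ρ Δψ + ρ ∇Δψ + ∇²ψ ∇ρ)`,
with `F` and its derivatives evaluated at `(x, ρ(x), ∇ρ(x))`. -/
noncomputable def weakN {d : ℕ} (Ω : Set (Rd d)) (F : Rd d × ℝ × Rd d → ℝ) (ρ ψ : Rd d → ℝ)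
    (x : Rd d) : ℝ :=
  Fx Ω F (x, ρ x, weakGrad Ω ρ x) (∇ ψ x)
    + (F (x, ρ x, weakGrad Ω ρ x) - ρ x * Fz Ω F (x, ρ x, weakGrad Ω ρ x)) *
      Laplacian.laplacian ψ x
    - Fp Ω F (x, ρ x, weakGrad Ω ρ x)
      (Laplacian.laplacian ψ x • weakGrad Ω ρ x + ρ x • ∇ (Laplacian.laplacian ψ) x
        + fderiv ℝ (∇ ψ) x (weakGrad Ω ρ x))

end JKO

namespace JKO

variable {d : ℕ}

/-! ### The derivative of the determinant -/

/-! The estimate comes from comparing each minimizer `u = u (n+1)` with a competitor obtained by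
moving its mass a short time `s` along `∇ φ`. Write `H` for the `C²` norm of `φ` and `w = u n`.
Moving `x` to `x + s ∇φ(x)` changes the transport cost `|x - y|²` by at most `2s (φ x - φ y) + s H
|x - y|² + O(s²)`. The energy changes by `s ∫ weakN + o(s)`. Minimality, division by `s` and `s → 0`
give a one-sided inequality. Applied to `φ` and `-φ` it becomes `weak_formulation_step`: `|∫ u φ - ∫
w φ + τ ∫ weakN| ≤ H/2 · W2²`. Testing minimality with `w` itself bounds `W2²` by `2τ` times the
energy drop (`W2_sq_step_le`). Summation by parts in time and telescoping of the energies then yield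
the bound `τ H ‖η‖ Φ(u₀)`.

The displacement must stay in `Ω`. No flow is used: the explicit map `S s` moves points by `-s V`,
with `V = ∇ φ`, and then contracts slightly towards an interior point. The Neumann condition makes
`V` tangential, so a straight step leaves the convex closure only by `O(s²)`
(`exists_dist_le_of_tangential`), and a contraction of strength `K s²` repairs this
(`variationMap_mem`). The competitor is the image of `u`, restricted to `S s '' Ω`, under the
inverse of `S s`, renormalized. The mass `m` outside `S s '' Ω` is `o(s)`, because that set has
volume `O(s²)` and `u` is in `L²` (`IsVariation.tendsto_missing_mass`). It is redistributed by a
product plan (`W2_sq_redistribute_le`).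

For the energy, the competitor has density `l u(S y) det DS(y)` with a weak gradient given by the
product and chain rules (`IsWeakGrad.pullback`). Substituting `x = S y` in its energy integral keeps
`u` and its gradient at the fixed point `x`, so that only smooth quantities depend on `s`. The
difference quotients then converge pointwise, without any further regularity of `u`. The growth
conditions on `F` dominate them (`IsVariation.exists_bound_pulledEnergy`,
`IsVariation.tendsto_integral_pulledEnergy`). -/

lemma contDiff_det : ContDiff ℝ ∞ (fun A : Rd d →L[ℝ] Rd d => A.det) := by
  let b := (EuclideanSpace.basisFun (Fin d) ℝ).toBasis
  have h : (fun A : Rd d →L[ℝ] Rd d => A.det) =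
      fun A => ∑ σ : Equiv.Perm (Fin d), (Equiv.Perm.sign σ : ℤ) *
        ∏ i, inner ℝ (EuclideanSpace.basisFun (Fin d) ℝ (σ i))
          (A (EuclideanSpace.basisFun (Fin d) ℝ i)) := by
    funext A
    rw [ContinuousLinearMap.det, ← LinearMap.det_toMatrix b, Matrix.det_apply']
    refine Finset.sum_congr rfl fun σ _ => ?_
    congr 1
    refine Finset.prod_congr rfl fun i _ => ?_
    rw [LinearMap.toMatrix_apply]
    simp [b, OrthonormalBasis.repr_apply_apply]
  rw [h]
  refine ContDiff.sum fun σ _ => contDiff_const.mul (contDiff_prod fun i _ => ?_)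
  exact contDiff_const.inner ℝ (contDiff_id.clm_apply contDiff_const)

/-- The trace, as a continuous linear form. -/
noncomputable def traceL : (Rd d →L[ℝ] Rd d) →L[ℝ] ℝ :=
  LinearMap.toContinuousLinearMap
    ((LinearMap.trace ℝ (Rd d)).comp (ContinuousLinearMap.coeLM ℝ))

lemma traceL_apply (A : Rd d →L[ℝ] Rd d) : traceL A = LinearMap.trace ℝ (Rd d) (A : Rd d →ₗ[ℝ] Rd d) :=
  rfl

lemma traceL_eq_sum (A : Rd d →L[ℝ] Rd d) :
    traceL A = ∑ i, inner ℝ (EuclideanSpace.basisFun (Fin d) ℝ i)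
      (A (EuclideanSpace.basisFun (Fin d) ℝ i)) := by
  rw [traceL_apply, LinearMap.trace_eq_sum_inner _ (EuclideanSpace.basisFun (Fin d) ℝ)]
  rfl

lemma traceL_smulRight (l : Rd d →L[ℝ] ℝ) (e : Rd d) : traceL (l.smulRight e) = l e := by
  rw [traceL_eq_sum]
  conv_rhs => rw [← (EuclideanSpace.basisFun (Fin d) ℝ).sum_repr e, map_sum]
  refine Finset.sum_congr rfl fun i _ => ?_
  simp [inner_smul_right, OrthonormalBasis.repr_apply_apply, mul_comm]

/-- In a basis, `det (1 + t B)` is a polynomial in `t` whose coefficients of order 0 and 1 are `1`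
and the trace; `q` collects the rest after the factor `t ^ 2`. -/
lemma det_one_add_smul_hasDerivAt (B : Rd d →L[ℝ] Rd d) :
    HasDerivAt (fun t : ℝ => ((1 : Rd d →L[ℝ] Rd d) + t • B).det) (traceL B) 0 := by
  let b := (EuclideanSpace.basisFun (Fin d) ℝ).toBasis
  set M := LinearMap.toMatrix b b (B : Rd d →ₗ[ℝ] Rd d) with hM
  set q := (Matrix.det (1 + (Polynomial.X : Polynomial ℝ) • M.map Polynomial.C)).divX.divX
  have h : (fun t : ℝ => ((1 : Rd d →L[ℝ] Rd d) + t • B).det) = fun t =>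
      1 + M.trace * t + q.eval t * t ^ 2 := by
    funext t
    rw [← Matrix.det_one_add_smul, ContinuousLinearMap.det, ← LinearMap.det_toMatrix b]
    congr 1
    have : (((1 : Rd d →L[ℝ] Rd d) + t • B : Rd d →L[ℝ] Rd d) : Rd d →ₗ[ℝ] Rd d) =
        LinearMap.id + t • (B : Rd d →ₗ[ℝ] Rd d) := by ext x; simp
    rw [this, map_add, map_smul, LinearMap.toMatrix_id]
  rw [h, traceL_apply, LinearMap.trace_eq_matrix_trace ℝ b, ← hM]
  have h1 := ((hasDerivAt_id (0 : ℝ)).const_mul M.trace).const_add 1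
  have h2 := (q.hasDerivAt 0).mul (hasDerivAt_pow 2 (0 : ℝ))
  convert! h1.add h2 using 1
  simp

lemma fderiv_det_eq_of_hasDerivAt {A B : Rd d →L[ℝ] Rd d} {a : ℝ}
    (h : HasDerivAt (fun t : ℝ => (A + t • B).det) a 0) :
    fderiv ℝ (fun A : Rd d →L[ℝ] Rd d => A.det) A B = a := by
  have h1 : HasFDerivAt (fun A : Rd d →L[ℝ] Rd d => A.det) _ A :=
    ((contDiff_det (d := d)).differentiable (by simp) _).hasFDerivAt
  have h2 : HasDerivAt (fun t : ℝ => A + t • B) B 0 := by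
    simpa using ((hasDerivAt_id (0 : ℝ)).smul_const B).const_add A
  have h0 : A = A + (0 : ℝ) • B := by ext x; simp
  exact (h1.comp_hasDerivAt_of_eq (0 : ℝ) h2 h0).unique h

lemma fderiv_det_one (B : Rd d →L[ℝ] Rd d) :
    fderiv ℝ (fun A : Rd d →L[ℝ] Rd d => A.det) 1 B = traceL B :=
  fderiv_det_eq_of_hasDerivAt (det_one_add_smul_hasDerivAt B)

/-- Jacobi's formula in a form that needs neither cofactors nor an inverse of `A`: `A + t C A = (1 +
t C) A`, and the determinant is multiplicative. This version and the next one serve for the two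
sides of the identity `DE ∘ DS = D(ψ DS e)` behind `det_mul_traceL_fderiv`. -/
lemma fderiv_det_comp_right (A C : Rd d →L[ℝ] Rd d) :
    fderiv ℝ (fun A : Rd d →L[ℝ] Rd d => A.det) A (C.comp A) = A.det * traceL C := by
  refine fderiv_det_eq_of_hasDerivAt ?_
  have h3 : (fun t : ℝ => (A + t • C.comp A).det) =
      fun t => ((1 : Rd d →L[ℝ] Rd d) + t • C).det * A.det := by
    funext t
    simp only [ContinuousLinearMap.det]
    rw [← LinearMap.det_comp]
    congr 1
  rw [h3, mul_comm]
  exact (det_one_add_smul_hasDerivAt C).mul_const A.det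

lemma fderiv_det_comp_left (A C : Rd d →L[ℝ] Rd d) :
    fderiv ℝ (fun A : Rd d →L[ℝ] Rd d => A.det) A (A.comp C) = A.det * traceL C := by
  refine fderiv_det_eq_of_hasDerivAt ?_
  have h3 : (fun t : ℝ => (A + t • A.comp C).det) =
      fun t => A.det * ((1 : Rd d →L[ℝ] Rd d) + t • C).det := by
    funext t
    simp only [ContinuousLinearMap.det]
    rw [← LinearMap.det_comp]
    congr 1
    ext x
    simp
  rw [h3]
  exact (det_one_add_smul_hasDerivAt C).const_mul A.det

end JKO

namespace JKO

variable {d : ℕ}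

/-! ### Weak gradients under a change of variables -/

/-- `S` is an orientation preserving smooth embedding of `Ω` into itself. -/
structure IsSmoothEmbedding (Ω : Set (Rd d)) (S : Rd d → Rd d) : Prop where
  isOpen : IsOpen Ω
  smooth : ContDiffOn ℝ ∞ S Ω
  mapsTo : MapsTo S Ω Ω
  injOn : InjOn S Ω
  det_pos : ∀ y ∈ Ω, 0 < (fderiv ℝ S y).det

namespace IsSmoothEmbedding

variable {Ω : Set (Rd d)} {S : Rd d → Rd d} (hS : IsSmoothEmbedding Ω S)
include hS

lemma contDiffAt {y : Rd d} (hy : y ∈ Ω) : ContDiffAt ℝ ∞ S y :=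
  hS.smooth.contDiffAt (hS.isOpen.mem_nhds hy)

lemma hasFDerivAt {y : Rd d} (hy : y ∈ Ω) : HasFDerivAt S (fderiv ℝ S y) y :=
  ((hS.contDiffAt hy).differentiableAt (by simp)).hasFDerivAt

lemma invFunOn_apply {y : Rd d} (hy : y ∈ Ω) : Function.invFunOn S Ω (S y) = y :=
  hS.injOn.leftInvOn_invFunOn hy

/-- The local inverse of the inverse function theorem takes values in `Ω` near `S y`, by continuity.
By injectivity of `S` on `Ω` it therefore coincides there with the global inverse. -/
lemma contDiffAt_invFunOn {y : Rd d} (hy : y ∈ Ω) :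
    ContDiffAt ℝ ∞ (Function.invFunOn S Ω) (S y) := by
  let e : Rd d ≃L[ℝ] Rd d := (fderiv ℝ S y).toContinuousLinearEquivOfDetNeZero (hS.det_pos y hy).ne'
  have he : HasFDerivAt S (e : Rd d →L[ℝ] Rd d) y :=
    hS.hasFDerivAt hy
  have hc := hS.contDiffAt hy
  have hl := hc.to_localInverse he (by simp)
  refine hl.congr_of_eventuallyEq ?_
  have h1 : ∀ᶠ x in nhds (S y), S (hc.localInverse he (by simp) x) = x :=
    (hc.hasStrictFDerivAt' he (by simp)).eventually_right_inverse
  have h2 : hc.localInverse he (by simp) (S y) = y := hc.localInverse_apply_image he (by simp)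
  have h3 : ∀ᶠ x in nhds (S y), hc.localInverse he (by simp) x ∈ Ω := by
    refine hl.continuousAt.eventually_mem ?_
    rw [h2]; exact hS.isOpen.mem_nhds hy
  filter_upwards [h1, h3] with x hx1 hx3
  conv_lhs => rw [← hx1]
  exact hS.invFunOn_apply hx3

lemma isOpen_image : IsOpen (S '' Ω) := by
  rw [isOpen_iff_mem_nhds]
  rintro _ ⟨y, hy, rfl⟩
  let e : Rd d ≃L[ℝ] Rd d :=
    (fderiv ℝ S y).toContinuousLinearEquivOfDetNeZero (hS.det_pos y hy).ne'
  have he : HasStrictFDerivAt S (e : Rd d →L[ℝ] Rd d) y :=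
    (hS.contDiffAt hy).hasStrictFDerivAt' (hS.hasFDerivAt hy) (by simp)
  rw [← he.map_nhds_eq_of_equiv]
  exact Filter.image_mem_map (hS.isOpen.mem_nhds hy)

lemma contDiff_det_fderiv : ContDiffOn ℝ ∞ (fun y => (fderiv ℝ S y).det) Ω :=
  contDiff_det.comp_contDiffOn (hS.smooth.fderiv_of_isOpen hS.isOpen (by simp))

/-- The push forward of a compactly supported vector field. -/
lemma contDiff_indicator_comp_invFunOn {B : Rd d → Rd d} (hB : ContDiffOn ℝ ∞ B Ω)
    {K : Set (Rd d)} (hK : IsCompact K) (hKΩ : K ⊆ Ω) (hBK : ∀ y, y ∉ K → B y = 0) :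
    ContDiff ℝ ∞ ((S '' Ω).indicator fun x => B (Function.invFunOn S Ω x)) := by
  rw [contDiff_iff_contDiffAt]
  intro x
  by_cases hx : x ∈ S '' Ω
  · obtain ⟨y, hy, rfl⟩ := hx
    have h1 : ContDiffAt ℝ ∞ (fun x => B (Function.invFunOn S Ω x)) (S y) := by
      refine ContDiffAt.comp (S y) ?_ (hS.contDiffAt_invFunOn hy)
      rw [hS.invFunOn_apply hy]
      exact hB.contDiffAt (hS.isOpen.mem_nhds hy)
    refine h1.congr_of_eventuallyEq ?_
    filter_upwards [hS.isOpen_image.mem_nhds (mem_image_of_mem S hy)] with z hz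
    simp [indicator_of_mem hz]
  -- Outside the image the extension by zero is smooth because the support lies in the compact,
  -- hence closed, set `S '' K`.
  · have hKc : IsClosed (S '' K) := (hK.image_of_continuousOn (hS.smooth.continuousOn.mono hKΩ)).isClosed
    refine (contDiffAt_const (c := (0 : Rd d))).congr_of_eventuallyEq ?_
    have : x ∈ (S '' K)ᶜ := fun h => hx (image_mono hKΩ h)
    filter_upwards [hKc.isOpen_compl.mem_nhds this] with z hz
    by_cases hz' : z ∈ S '' Ω
    · rw [indicator_of_mem hz']
      obtain ⟨y, hy, rfl⟩ := hz'
      rw [hS.invFunOn_apply hy]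
      exact hBK y fun h => hz (mem_image_of_mem S h)
    · rw [indicator_of_notMem hz']

end IsSmoothEmbedding

/-- Integration by parts against a compactly supported smooth vector field. -/
lemma IsWeakGrad.integral_mul_div {Ω : Set (Rd d)} {u : Rd d → ℝ} {g : Rd d → Rd d}
    (h : IsWeakGrad Ω u g) (hu : IntegrableOn u Ω) (hg : IntegrableOn g Ω)
    {E : Rd d → Rd d} (hE : ContDiff ℝ ∞ E) (hEc : HasCompactSupport E) (hEΩ : tsupport E ⊆ Ω) :
    ∫ x in Ω, u x * traceL (fderiv ℝ E x) = -∫ x in Ω, inner ℝ (g x) (E x) := by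
  let b := EuclideanSpace.basisFun (Fin d) ℝ
  have hEi : ∀ i, ContDiff ℝ ∞ fun x => inner ℝ (b i) (E x) := fun i => contDiff_const.inner ℝ hE
  have hsup : ∀ i, tsupport (fun x => inner ℝ (b i) (E x)) ⊆ tsupport E := fun i =>
    closure_mono fun x hx hx' => hx (by simp [hx'])
  have hci : ∀ i, HasCompactSupport fun x => inner ℝ (b i) (E x) := fun i =>
    hEc.mono' ((subset_tsupport _).trans (hsup i))
  have hw := fun i => h.weak _ (hEi i) (hci i) ((hsup i).trans hEΩ) (b i)
  have e1 : ∀ x, u x * traceL (fderiv ℝ E x) =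
      ∑ i, u x * fderiv ℝ (fun x => inner ℝ (b i) (E x)) x (b i) := by
    intro x
    rw [traceL_eq_sum, Finset.mul_sum]
    refine Finset.sum_congr rfl fun i _ => ?_
    have hd : DifferentiableAt ℝ E x := (hE.differentiable (by simp)) x
    rw [fderiv_inner_apply ℝ (differentiableAt_const _) hd]
    simp [b]
  have e2 : ∀ x, inner ℝ (g x) (E x) = ∑ i, inner ℝ (g x) (b i) * inner ℝ (b i) (E x) := by
    intro x
    exact (b.sum_inner_mul_inner (g x) (E x)).symm
  simp_rw [e1, e2]
  rw [integral_finsetSum, integral_finsetSum, Finset.sum_congr rfl fun i _ => hw i,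
    Finset.sum_neg_distrib]
  · intro i _
    have hb : Continuous fun x => inner ℝ (b i) (E x) := (hEi i).continuous
    obtain ⟨C, hC⟩ := (hci i).exists_bound_of_continuous hb
    refine Integrable.mul_bdd (c := C) ?_ hb.aestronglyMeasurable (.of_forall hC)
    exact hg.inner_const (b i)
  · intro i _
    have hb : Continuous fun x => fderiv ℝ (fun x => inner ℝ (b i) (E x)) x (b i) :=
      ((hEi i).continuous_fderiv (by simp)).clm_apply continuous_const
    have hc : HasCompactSupport fun x => fderiv ℝ (fun x => inner ℝ (b i) (E x)) x (b i) :=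
      (hci i).fderiv_apply ℝ (b i)
    obtain ⟨C, hC⟩ := hc.exists_bound_of_continuous hb
    exact Integrable.mul_bdd (c := C) hu hb.aestronglyMeasurable (.of_forall hC)

end JKO

namespace JKO

variable {d : ℕ}

lemma inner_gradient_eq_fderiv (f : Rd d → ℝ) (x v : Rd d) : inner ℝ (∇ f x) v = fderiv ℝ f x v := by
  rw [gradient, InnerProductSpace.toDual_symm_apply]

namespace IsSmoothEmbedding

variable {Ω : Set (Rd d)} {S : Rd d → Rd d} (hS : IsSmoothEmbedding Ω S)
include hS

lemma measurableSet_image : MeasurableSet (S '' Ω) := hS.isOpen_image.measurableSet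

lemma lintegral_image (f : Rd d → ℝ≥0∞) :
    ∫⁻ x in S '' Ω, f x = ∫⁻ y in Ω, ENNReal.ofReal (fderiv ℝ S y).det * f (S y) := by
  rw [lintegral_image_eq_lintegral_abs_det_fderiv_mul volume hS.isOpen.measurableSet
    (fun y hy => (hS.hasFDerivAt hy).hasFDerivWithinAt) hS.injOn]
  refine setLIntegral_congr_fun hS.isOpen.measurableSet fun y hy => ?_
  simp only [abs_of_pos (hS.det_pos y hy)]

lemma integral_image (f : Rd d → ℝ) :
    ∫ x in S '' Ω, f x = ∫ y in Ω, (fderiv ℝ S y).det * f (S y) := by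
  rw [integral_image_eq_integral_abs_det_fderiv_smul volume hS.isOpen.measurableSet
    (fun y hy => (hS.hasFDerivAt hy).hasFDerivWithinAt) hS.injOn]
  refine setIntegral_congr_fun hS.isOpen.measurableSet fun y hy => ?_
  simp only [abs_of_pos (hS.det_pos y hy), smul_eq_mul]

lemma integrableOn_image_iff {G : Type*} [NormedAddCommGroup G] [NormedSpace ℝ G] (f : Rd d → G) :
    IntegrableOn f (S '' Ω) ↔ IntegrableOn (fun y => (fderiv ℝ S y).det • f (S y)) Ω := by
  rw [integrableOn_image_iff_integrableOn_abs_det_fderiv_smul volume hS.isOpen.measurableSet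
    (fun y hy => (hS.hasFDerivAt hy).hasFDerivWithinAt) hS.injOn]
  refine integrableOn_congr_fun (fun y hy => ?_) hS.isOpen.measurableSet
  simp only [abs_of_pos (hS.det_pos y hy)]

/-- The divergence of a pushed forward vector field. -/
lemma det_mul_traceL_fderiv {ψ : Rd d → ℝ} (hψ : ContDiff ℝ ∞ ψ) (e : Rd d) {E : Rd d → Rd d}
    (hE : ContDiff ℝ ∞ E) (hES : ∀ y ∈ Ω, E (S y) = ψ y • fderiv ℝ S y e) {y : Rd d} (hy : y ∈ Ω) :
    (fderiv ℝ S y).det * traceL (fderiv ℝ E (S y)) =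
      (fderiv ℝ S y).det * fderiv ℝ ψ y e +
        ψ y * fderiv ℝ (fun y => (fderiv ℝ S y).det) y e := by
  have hdS : DifferentiableAt ℝ (fderiv ℝ S) y :=
    ((hS.smooth.fderiv_of_isOpen hS.isOpen (m := ∞) (by simp)).contDiffAt
      (hS.isOpen.mem_nhds hy)).differentiableAt (by simp)
  have hdψ : DifferentiableAt ℝ ψ y := hψ.differentiable (by simp) y
  have h1 : HasFDerivAt (fun y => E (S y)) ((fderiv ℝ E (S y)).comp (fderiv ℝ S y)) y :=
    ((hE.differentiable (by simp) _).hasFDerivAt).comp y (hS.hasFDerivAt hy)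
  have h2 : HasFDerivAt (fun y => ψ y • fderiv ℝ S y e)
      (ψ y • (fderiv ℝ (fderiv ℝ S) y).flip e + (fderiv ℝ ψ y).smulRight (fderiv ℝ S y e)) y := by
    have h3 : HasFDerivAt (fun y => fderiv ℝ S y e) ((fderiv ℝ (fderiv ℝ S) y).flip e) y := by
      have := hdS.hasFDerivAt.clm_apply (hasFDerivAt_const e y)
      simpa using this
    exact hdψ.hasFDerivAt.smul h3
  have h3 := h1.unique (h2.congr_of_eventuallyEq
    (Filter.eventuallyEq_of_mem (hS.isOpen.mem_nhds hy) hES))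
  have hsymm : (fderiv ℝ (fderiv ℝ S) y).flip e = fderiv ℝ (fderiv ℝ S) y e := by
    ext1 v
    exact (((hS.contDiffAt hy).isSymmSndFDerivAt
      (by rw [minSmoothness_of_isRCLikeNormedField]; exact WithTop.coe_le_coe.2 (le_top : (2 : ℕ∞) ≤ ⊤))) e v).symm
  have h4 : (fderiv ℝ ψ y).smulRight (fderiv ℝ S y e) =
      (fderiv ℝ S y).comp ((fderiv ℝ ψ y).smulRight e) := by
    ext1 v; simp
  have h5 : fderiv ℝ (fun y => (fderiv ℝ S y).det) y e =
      fderiv ℝ (fun A : Rd d →L[ℝ] Rd d => A.det) (fderiv ℝ S y) (fderiv ℝ (fderiv ℝ S) y e) := by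
    have := ((contDiff_det.differentiable (by simp) (fderiv ℝ S y)).hasFDerivAt).comp y
      hdS.hasFDerivAt
    exact congrArg (fun l => l e) this.fderiv
  -- The Piola identity. By symmetry of `D²S`, the term `ψ • D²S(·, e)` contributes `ψ` times the
  -- derivative of `det DS` along `e`; the rank-one term factors through `DS` and contributes `det
  -- DS` times `∂_e ψ`.
  rw [← fderiv_det_comp_right, h3, h4, hsymm, map_add, map_smul, fderiv_det_comp_left,
    traceL_smulRight, h5, smul_eq_mul, add_comm]

end IsSmoothEmbedding

/-- The weak gradient of `y ↦ u (S y) * det (DS y)`. -/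
lemma IsWeakGrad.pullback {Ω : Set (Rd d)} {S : Rd d → Rd d} (hS : IsSmoothEmbedding Ω S)
    {u : Rd d → ℝ} {g : Rd d → Rd d} (h : IsWeakGrad Ω u g) (hu : IntegrableOn u Ω)
    (hg : IntegrableOn g Ω) {ψ : Rd d → ℝ} (hψ : ContDiff ℝ ∞ ψ) (hψc : HasCompactSupport ψ)
    (hψΩ : tsupport ψ ⊆ Ω) (e : Rd d) :
    ∫ y in Ω, (u (S y) * (fderiv ℝ S y).det) * fderiv ℝ ψ y e =
      -∫ y in Ω, inner ℝ ((fderiv ℝ S y).det • (fderiv ℝ S y).adjoint (g (S y)) +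
        u (S y) • ∇ (fun y => (fderiv ℝ S y).det) y) e * ψ y := by
  set j : Rd d → ℝ := fun y => (fderiv ℝ S y).det with hj
  have hjpos : ∀ y ∈ Ω, 0 < j y := hS.det_pos
  have hjs : ContDiffOn ℝ ∞ j Ω := hS.contDiff_det_fderiv
  have hDS : ContDiffOn ℝ ∞ (fderiv ℝ S) Ω := hS.smooth.fderiv_of_isOpen hS.isOpen (by simp)
  set B : Rd d → Rd d := fun y => ψ y • fderiv ℝ S y e with hB
  have hBs : ContDiffOn ℝ ∞ B Ω := hψ.contDiffOn.smul (hDS.clm_apply contDiffOn_const)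
  have hBK : ∀ y, y ∉ tsupport ψ → B y = 0 := fun y hy => by
    simp [hB, image_eq_zero_of_notMem_tsupport hy]
  -- `E` is the push-forward of the field `ψ e` under `S`. Integrating by parts against `E` on the
  -- image and changing variables turns the weak gradient of `u` into that of `(u ∘ S) det DS`,
  -- tested with `ψ` in direction `e`.
  set E : Rd d → Rd d := (S '' Ω).indicator fun x => B (Function.invFunOn S Ω x) with hE
  have hEs : ContDiff ℝ ∞ E := hS.contDiff_indicator_comp_invFunOn hBs hψc hψΩ hBK
  have hES : ∀ y ∈ Ω, E (S y) = B y := fun y hy => by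
    rw [hE, indicator_of_mem (mem_image_of_mem S hy), hS.invFunOn_apply hy]
  have hcomp : IsCompact (S '' tsupport ψ) :=
    hψc.isCompact.image_of_continuousOn (hS.smooth.continuousOn.mono hψΩ)
  have hts : tsupport E ⊆ S '' tsupport ψ := by
    refine closure_minimal (fun x hx => ?_) hcomp.isClosed
    by_contra hx'
    refine hx ?_
    by_cases hxΩ : x ∈ S '' Ω
    · obtain ⟨y, hy, rfl⟩ := hxΩ
      rw [hES y hy]
      exact hBK y fun h => hx' (mem_image_of_mem S h)
    · rw [hE, indicator_of_notMem hxΩ]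
  have hEc : HasCompactSupport E := hcomp.of_isClosed_subset (isClosed_tsupport _) hts
  have hSΩ : S '' Ω ⊆ Ω := hS.mapsTo.image_subset
  have hout : ∀ x ∈ Ω \ S '' Ω, x ∉ tsupport E := fun x hx hx' =>
    hx.2 (image_mono hψΩ (hts hx'))
  have key := h.integral_mul_div hu hg hEs hEc (hts.trans ((image_mono hψΩ).trans hSΩ))
  have e1 : ∫ x in Ω, u x * traceL (fderiv ℝ E x) =
      ∫ y in Ω, u (S y) * (j y * fderiv ℝ ψ y e + ψ y * fderiv ℝ j y e) := by
    rw [setIntegral_eq_of_subset_of_forall_sdiff_eq_zero hS.isOpen.measurableSet hSΩ,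
      hS.integral_image]
    · refine setIntegral_congr_fun hS.isOpen.measurableSet fun y hy => ?_
      rw [← hS.det_mul_traceL_fderiv hψ e hEs hES hy]
      ring
    · intro x hx
      have : fderiv ℝ E x = 0 := by
        by_contra h0
        exact hout x hx (support_fderiv_subset ℝ h0)
      rw [this, map_zero, mul_zero]
  have e2 : ∫ x in Ω, inner ℝ (g x) (E x) =
      ∫ y in Ω, (inner ℝ (j y • (fderiv ℝ S y).adjoint (g (S y))) e) * ψ y := by
    rw [setIntegral_eq_of_subset_of_forall_sdiff_eq_zero hS.isOpen.measurableSet hSΩ,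
      hS.integral_image]
    · refine setIntegral_congr_fun hS.isOpen.measurableSet fun y hy => ?_
      rw [hES y hy, hB, real_inner_smul_left, ContinuousLinearMap.adjoint_inner_left,
        real_inner_smul_right]
      ring
    · intro x hx
      rw [image_eq_zero_of_notMem_tsupport (hout x hx), inner_zero_right]
  have hju : IntegrableOn (fun y => j y * u (S y)) Ω :=
    (hS.integrableOn_image_iff u).1 (hu.mono_set hSΩ)
  have hjg : IntegrableOn (fun y => j y • g (S y)) Ω :=
    (hS.integrableOn_image_iff g).1 (hg.mono_set hSΩ)
  have bdd : ∀ {G : Type} [NormedAddCommGroup G] [NormedSpace ℝ G] (q : Rd d → G), ContinuousOn q Ω →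
      (∀ y, y ∉ tsupport ψ → q y = 0) → ∃ C, ∀ y, ‖q y‖ ≤ C := by
    intro G _ _ q hq hq0
    obtain ⟨C, hC⟩ := hψc.isCompact.exists_bound_of_continuousOn (hq.mono hψΩ)
    refine ⟨max C 0, fun y => ?_⟩
    by_cases hy : y ∈ tsupport ψ
    · exact (hC y hy).trans (le_max_left _ _)
    · simp [hq0 y hy]
  have hdj : ContinuousOn (fun y => fderiv ℝ j y e) Ω :=
    (hjs.continuousOn_fderiv_of_isOpen hS.isOpen (by simp)).clm_apply continuousOn_const
  have hdψ : ContinuousOn (fun y => fderiv ℝ ψ y e) Ω :=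
    ((hψ.continuous_fderiv (by simp)).clm_apply continuous_const).continuousOn
  have i1 : IntegrableOn (fun y => (u (S y) * j y) * fderiv ℝ ψ y e) Ω := by
    obtain ⟨C, hC⟩ := bdd (fun y => fderiv ℝ ψ y e) hdψ fun y hy => by
      rw [image_eq_zero_of_notMem_tsupport (fun h' => hy (tsupport_fderiv_subset ℝ h'))]; rfl
    simp_rw [mul_comm (u _) (j _)]
    exact Integrable.mul_bdd (c := C) hju (hdψ.aestronglyMeasurable hS.isOpen.measurableSet)
      (.of_forall hC)
  have i2 : IntegrableOn (fun y => u (S y) * (ψ y * fderiv ℝ j y e)) Ω := by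
    -- The change of variables gives integrability of `j · (u ∘ S)`, not of `u ∘ S`. Hence the
    -- bounded factor is divided by `j`, which is harmless on the compact support of `ψ`.
    have hq : ContinuousOn (fun y => ψ y * fderiv ℝ j y e / j y) Ω :=
      (hψ.continuous.continuousOn.mul hdj).div hjs.continuousOn fun y hy => (hjpos y hy).ne'
    obtain ⟨C, hC⟩ := bdd _ hq fun y hy => by simp [image_eq_zero_of_notMem_tsupport hy]
    refine (Integrable.mul_bdd (c := C) hju (hq.aestronglyMeasurable hS.isOpen.measurableSet)
      (.of_forall hC)).congr ?_
    filter_upwards [ae_restrict_mem hS.isOpen.measurableSet] with y hy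
    have := (hjpos y hy).ne'
    field_simp
  have i3 : IntegrableOn (fun y => inner ℝ (j y • (fderiv ℝ S y).adjoint (g (S y))) e * ψ y) Ω := by
    have hq : ContinuousOn (fun y => ψ y • fderiv ℝ S y e) Ω := hBs.continuousOn
    obtain ⟨C, hC⟩ := bdd _ hq hBK
    have hm := hq.aestronglyMeasurable (μ := volume) hS.isOpen.measurableSet
    have : IntegrableOn (fun y => inner ℝ (j y • g (S y)) (ψ y • fderiv ℝ S y e)) Ω := by
      refine Integrable.mono' (hjg.norm.mul_const C) (hjg.aestronglyMeasurable.inner hm)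
        (.of_forall fun y => (norm_inner_le_norm _ _).trans ?_)
      exact mul_le_mul_of_nonneg_left (hC y) (norm_nonneg _)
    refine this.congr (.of_forall fun y => ?_)
    simp only [real_inner_smul_left, ContinuousLinearMap.adjoint_inner_left, real_inner_smul_right]
    ring
  have e3 : ∀ y, inner ℝ (j y • (fderiv ℝ S y).adjoint (g (S y)) + u (S y) • ∇ j y) e * ψ y =
      inner ℝ (j y • (fderiv ℝ S y).adjoint (g (S y))) e * ψ y
        + u (S y) * (ψ y * fderiv ℝ j y e) := by
    intro y
    rw [inner_add_left, real_inner_smul_left (∇ j y), inner_gradient_eq_fderiv]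
    ring
  change (∫ y in Ω, (u (S y) * j y) * fderiv ℝ ψ y e) = -∫ y in Ω,
    inner ℝ (j y • (fderiv ℝ S y).adjoint (g (S y)) + u (S y) • ∇ j y) e * ψ y
  simp_rw [e3]
  rw [integral_add i3 i2, ← e2]
  have e4 : ∫ y in Ω, u (S y) * (j y * fderiv ℝ ψ y e + ψ y * fderiv ℝ j y e) =
      (∫ y in Ω, (u (S y) * j y) * fderiv ℝ ψ y e) +
        ∫ y in Ω, u (S y) * (ψ y * fderiv ℝ j y e) := by
    rw [← integral_add i1 i2]
    exact integral_congr_ae (.of_forall fun y => by ring)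
  rw [e1, e4] at key
  linarith

end JKO

namespace JKO

variable {d : ℕ}

/-! ### Transport plans -/

lemma W2_sq (μ ν : Measure (Rd d)) :
    W2 μ ν ^ 2 = ⨅ γ ∈ transportPlans μ ν, ∫⁻ q, edist q.1 q.2 ^ 2 ∂γ := by
  rw [W2, ← ENNReal.rpow_natCast, ← ENNReal.rpow_mul]
  norm_num

lemma W2_sq_le {μ ν : Measure (Rd d)} {γ : Measure (Rd d × Rd d)} (h : γ ∈ transportPlans μ ν) :
    W2 μ ν ^ 2 ≤ ∫⁻ q, edist q.1 q.2 ^ 2 ∂γ := by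
  rw [W2_sq]
  exact iInf₂_le γ h

lemma W2_self (μ : Measure (Rd d)) : W2 μ μ ^ 2 = 0 := by
  have hm : Measurable fun x : Rd d => (x, x) := measurable_id.prodMk measurable_id
  have h : μ.map (fun x => (x, x)) ∈ transportPlans μ μ := by
    constructor
    · rw [Measure.map_map measurable_fst hm]; exact Measure.map_id
    · rw [Measure.map_map measurable_snd hm]; exact Measure.map_id
  refine le_antisymm ((W2_sq_le h).trans ?_) zero_le
  rw [lintegral_map (by fun_prop) hm]
  simp

/-- A plan with a prescribed first marginal, when only the part `B` of the mass is moved along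
`X` and the rest is redistributed. -/
lemma mem_transportPlans_redistribute {μ ν μ' : Measure (Rd d)} [IsProbabilityMeasure μ']
    [IsFiniteMeasure μ]
    {γ : Measure (Rd d × Rd d)} (hγ : γ ∈ transportPlans μ ν) {B : Set (Rd d)}
    (hB : MeasurableSet B) {X : Rd d → Rd d} (hX : Measurable X)
    (hμ' : (μ.restrict B).map X + μ Bᶜ • μ' = μ') :
    (γ.restrict (Prod.fst ⁻¹' B)).map (Prod.map X id) +
      μ'.prod ((γ.restrict (Prod.fst ⁻¹' Bᶜ)).map Prod.snd) ∈ transportPlans μ' ν := by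
  have hmass : γ (Prod.fst ⁻¹' Bᶜ) = μ Bᶜ := by
    rw [← hγ.1, Measure.map_apply measurable_fst hB.compl]
  have hfin : IsFiniteMeasure γ := by
    constructor
    rw [← preimage_univ (f := Prod.fst), ← Measure.map_apply measurable_fst .univ, hγ.1]
    exact measure_lt_top μ univ
  have hmap : Measurable (Prod.map X (id : Rd d → Rd d)) := hX.prodMap measurable_id
  constructor
  -- `hμ'` expresses without a division that `μ'` is the image of `μ` restricted to `B` under `X`,
  -- renormalized. The lost mass is paired with `μ'` itself, so the first marginal reproduces the
  -- left side of `hμ'`.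
  · rw [Measure.map_add _ _ measurable_fst, Measure.map_map measurable_fst hmap,
      Measure.map_fst_prod, Measure.map_apply measurable_snd .univ, preimage_univ,
      Measure.restrict_apply_univ, hmass]
    convert hμ' using 2
    rw [← hγ.1, Measure.restrict_map measurable_fst hB, Measure.map_map hX measurable_fst]
    rfl
  · rw [Measure.map_add _ _ measurable_snd, Measure.map_map measurable_snd hmap,
      Measure.map_snd_prod, measure_univ, one_smul]
    have : Prod.snd ∘ Prod.map X (id : Rd d → Rd d) = Prod.snd := rfl
    rw [this, ← Measure.map_add _ _ measurable_snd, ← hγ.2]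
    congr 1
    exact Measure.restrict_add_restrict_compl (hB.preimage measurable_fst)

lemma transportPlans_ae_mem {μ ν : Measure (Rd d)} {γ : Measure (Rd d × Rd d)}
    (hγ : γ ∈ transportPlans μ ν) {Ω : Set (Rd d)} (hΩ : MeasurableSet Ω) (hμ : μ Ωᶜ = 0)
    (hν : ν Ωᶜ = 0) : ∀ᵐ q ∂γ, q.1 ∈ Ω ∧ q.2 ∈ Ω := by
  rw [← hγ.1, Measure.map_apply measurable_fst hΩ.compl] at hμ
  rw [← hγ.2, Measure.map_apply measurable_snd hΩ.compl] at hν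
  filter_upwards [compl_mem_ae_iff.2 hμ, compl_mem_ae_iff.2 hν] with q h1 h2
  exact ⟨by simpa using h1, by simpa using h2⟩

lemma transportPlans_isProbabilityMeasure {μ ν : Measure (Rd d)} [IsProbabilityMeasure μ]
    {γ : Measure (Rd d × Rd d)} (hγ : γ ∈ transportPlans μ ν) : IsProbabilityMeasure γ := by
  constructor
  rw [← preimage_univ (f := Prod.fst), ← Measure.map_apply measurable_fst .univ, hγ.1]
  exact measure_univ

lemma edist_sq_eq_ofReal (x y : Rd d) : edist x y ^ 2 = ENNReal.ofReal (‖x - y‖ ^ 2) := by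
  rw [edist_dist, dist_eq_norm, ENNReal.ofReal_pow (norm_nonneg _)]

/-- The product plan costs at most `R ^ 2`. -/
lemma W2_sq_ne_top {Ω : Set (Rd d)} (hΩ : MeasurableSet Ω) {R : ℝ}
    (hR : ∀ x ∈ Ω, ∀ y ∈ Ω, ‖x - y‖ ≤ R) {μ ν : Measure (Rd d)} (hμ : IsProbOn Ω μ)
    (hν : IsProbOn Ω ν) : W2 μ ν ^ 2 ≠ ⊤ := by
  have := hμ.prob
  have := hν.prob
  have hp : μ.prod ν ∈ transportPlans μ ν := by
    constructor <;> simp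
  refine ((W2_sq_le hp).trans_lt ?_).ne
  calc ∫⁻ q, edist q.1 q.2 ^ 2 ∂(μ.prod ν) ≤ ∫⁻ q, ENNReal.ofReal (R ^ 2) ∂(μ.prod ν) := by
        refine lintegral_mono_ae ?_
        filter_upwards [transportPlans_ae_mem hp hΩ hμ.null hν.null] with q hq
        rw [edist_sq_eq_ofReal]
        exact ENNReal.ofReal_le_ofReal (pow_le_pow_left₀ (norm_nonneg _) (hR _ hq.1 _ hq.2) 2)
    _ < ⊤ := by simp

lemma integral_sub_eq_of_mem_transportPlans {μ ν : Measure (Rd d)} {γ : Measure (Rd d × Rd d)}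
    (hγ : γ ∈ transportPlans μ ν) {φ : Rd d → ℝ} (hμ : Integrable φ μ) (hν : Integrable φ ν) :
    Integrable (fun q => φ q.1 - φ q.2) γ ∧
      ∫ q, (φ q.1 - φ q.2) ∂γ = (∫ x, φ x ∂μ) - ∫ x, φ x ∂ν := by
  rw [← hγ.1] at hμ
  rw [← hγ.2] at hν
  have h1 : Integrable (fun q => φ q.1) γ := hμ.comp_measurable measurable_fst
  have h2 : Integrable (fun q => φ q.2) γ := hν.comp_measurable measurable_snd
  refine ⟨h1.sub h2, ?_⟩
  rw [integral_sub h1 h2]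
  congr 1
  · conv_rhs => rw [← hγ.1]
    rw [integral_map measurable_fst.aemeasurable hμ.aestronglyMeasurable]
  · conv_rhs => rw [← hγ.2]
    rw [integral_map measurable_snd.aemeasurable hν.aestronglyMeasurable]

/-- The effect of a small displacement on the Wasserstein distance. -/
lemma W2_sq_redistribute_le {Ω : Set (Rd d)} (hΩ : MeasurableSet Ω) {R : ℝ}
    (hR : ∀ x ∈ Ω, ∀ y ∈ Ω, ‖x - y‖ ≤ R) {μ ν μ' : Measure (Rd d)} (hμ : IsProbOn Ω μ)
    (hν : IsProbOn Ω ν) (hμΩ : IsProbOn Ω μ') {B : Set (Rd d)} (hB : MeasurableSet B)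
    {X : Rd d → Rd d} (hX : Measurable X)
    (hμ' : (μ.restrict B).map X + μ Bᶜ • μ' = μ')
    {φ : Rd d → ℝ} {M : ℝ} (hφM : ∀ x ∈ Ω, |φ x| ≤ M) (hφμ : Integrable φ μ)
    (hφν : Integrable φ ν) {s H a : ℝ} (hs : 0 ≤ s) (hH : 0 ≤ H) (ha : 0 ≤ a)
    (hpt : ∀ x ∈ B, x ∈ Ω → ∀ y ∈ Ω, ‖X x - y‖ ^ 2 ≤
      (1 + s * H) * ‖x - y‖ ^ 2 + 2 * s * (φ x - φ y) + a) :
    (W2 μ' ν ^ 2).toReal ≤ (1 + s * H) * (W2 μ ν ^ 2).toReal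
      + 2 * s * ((∫ x, φ x ∂μ) - ∫ x, φ x ∂ν) + a + (R ^ 2 + 4 * s * M) * (μ Bᶜ).toReal := by
  have := hμ.prob
  have := hν.prob
  have := hμΩ.prob
  have hM : 0 ≤ M := by
    have : μ Ω ≠ 0 := by
      intro h0
      have := measure_univ (μ := μ)
      rw [← union_compl_self Ω] at this
      have h1 := measure_union_le (μ := μ) Ω Ωᶜ
      rw [this, h0, hμ.null] at h1
      simp at h1
    obtain ⟨x, hx⟩ := nonempty_of_measure_ne_zero this
    exact (abs_nonneg _).trans (hφM x hx)
  have hWtop := W2_sq_ne_top hΩ hR hμ hν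
  have plan : ∀ γ ∈ transportPlans μ ν, ∫⁻ q, edist q.1 q.2 ^ 2 ∂γ ≠ ⊤ →
      (W2 μ' ν ^ 2).toReal ≤ (1 + s * H) * (∫⁻ q, edist q.1 q.2 ^ 2 ∂γ).toReal
      + 2 * s * ((∫ x, φ x ∂μ) - ∫ x, φ x ∂ν) + a + (R ^ 2 + 4 * s * M) * (μ Bᶜ).toReal := by
    intro γ hγ hfin
    have := transportPlans_isProbabilityMeasure hγ
    have hmem := transportPlans_ae_mem hγ hΩ hμ.null hν.null
    have hBp : MeasurableSet (Prod.fst ⁻¹' B : Set (Rd d × Rd d)) := hB.preimage measurable_fst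
    have hmass : γ (Prod.fst ⁻¹' Bᶜ) = μ Bᶜ := by
      rw [← hγ.1, Measure.map_apply measurable_fst hB.compl]
    have hplan := W2_sq_le (mem_transportPlans_redistribute hγ hB hX hμ')
    rw [lintegral_add_measure, lintegral_map (by fun_prop) (hX.prodMap measurable_id)] at hplan
    -- the redistributed part
    have h2 : ∫⁻ q, edist q.1 q.2 ^ 2 ∂(μ'.prod ((γ.restrict (Prod.fst ⁻¹' Bᶜ)).map Prod.snd)) ≤
        ENNReal.ofReal (R ^ 2) * μ Bᶜ := by
      calc _ ≤ ∫⁻ q, ENNReal.ofReal (R ^ 2)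
            ∂(μ'.prod ((γ.restrict (Prod.fst ⁻¹' Bᶜ)).map Prod.snd)) := by
            refine lintegral_mono_ae ?_
            have hp : μ'.prod ((γ.restrict (Prod.fst ⁻¹' Bᶜ)).map Prod.snd) ∈
                transportPlans ((μ Bᶜ) • μ') ((γ.restrict (Prod.fst ⁻¹' Bᶜ)).map Prod.snd) := by
              constructor
              · rw [Measure.map_fst_prod, Measure.map_apply measurable_snd .univ, preimage_univ,
                  Measure.restrict_apply_univ, hmass]
              · rw [Measure.map_snd_prod, measure_univ, one_smul]
            have hn : ((γ.restrict (Prod.fst ⁻¹' Bᶜ)).map Prod.snd) Ωᶜ = 0 := by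
              rw [Measure.map_apply measurable_snd hΩ.compl]
              refine le_antisymm ((Measure.restrict_apply_le _ _).trans ?_) zero_le
              rw [← Measure.map_apply measurable_snd hΩ.compl, hγ.2, hν.null]
            filter_upwards [transportPlans_ae_mem hp hΩ (by simp [hμΩ.null]) hn] with q hq
            rw [edist_sq_eq_ofReal]
            exact ENNReal.ofReal_le_ofReal (pow_le_pow_left₀ (norm_nonneg _) (hR _ hq.1 _ hq.2) 2)
        _ = ENNReal.ofReal (R ^ 2) * μ Bᶜ := by
            rw [lintegral_const, ← univ_prod_univ, Measure.prod_prod, measure_univ, one_mul,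
              Measure.map_apply measurable_snd .univ, preimage_univ, Measure.restrict_apply_univ,
              hmass]
    -- the displaced part
    obtain ⟨hφi, hφe⟩ := integral_sub_eq_of_mem_transportPlans hγ hφμ hφν
    have hci : Integrable (fun q : Rd d × Rd d => ‖q.1 - q.2‖ ^ 2) γ := by
      refine Integrable.mono' (integrable_const (R ^ 2)) (by fun_prop) ?_
      filter_upwards [hmem] with q hq
      rw [Real.norm_of_nonneg (by positivity)]
      exact pow_le_pow_left₀ (norm_nonneg _) (hR _ hq.1 _ hq.2) 2
    have hce : ∫ q, ‖q.1 - q.2‖ ^ 2 ∂γ = (∫⁻ q, edist q.1 q.2 ^ 2 ∂γ).toReal := by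
      rw [integral_eq_lintegral_of_nonneg_ae (.of_forall fun q => by positivity)
        hci.aestronglyMeasurable]
      simp_rw [edist_sq_eq_ofReal]
    -- `hpt` is available only on `B`. Off `B` the term `4 * s * M` compensates `2 s (φ x - φ y) ≥
    -- -4 s M`, so that `G ≥ 0` everywhere and the integral over `B` may be enlarged to the whole
    -- space.
    set G : Rd d × Rd d → ℝ := fun q => (1 + s * H) * ‖q.1 - q.2‖ ^ 2 + 2 * s * (φ q.1 - φ q.2)
      + a + (Prod.fst ⁻¹' Bᶜ : Set (Rd d × Rd d)).indicator (fun _ => 4 * s * M) q with hG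
    have hind : Integrable ((Prod.fst ⁻¹' Bᶜ : Set (Rd d × Rd d)).indicator
        (fun _ => 4 * s * M)) γ :=
      (integrable_const _).indicator hBp.compl
    have i1 : Integrable (fun q : Rd d × Rd d => (1 + s * H) * ‖q.1 - q.2‖ ^ 2) γ := hci.const_mul _
    have i2 : Integrable (fun q : Rd d × Rd d => 2 * s * (φ q.1 - φ q.2)) γ := hφi.const_mul _
    have i3 : Integrable (fun q : Rd d × Rd d => (1 + s * H) * ‖q.1 - q.2‖ ^ 2
        + 2 * s * (φ q.1 - φ q.2)) γ := i1.add i2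
    have i4 : Integrable (fun q : Rd d × Rd d => (1 + s * H) * ‖q.1 - q.2‖ ^ 2
        + 2 * s * (φ q.1 - φ q.2) + a) γ := i3.add (integrable_const a)
    have hGi : Integrable G γ := i4.add hind
    have hGe : ∫ q, G q ∂γ = (1 + s * H) * (∫⁻ q, edist q.1 q.2 ^ 2 ∂γ).toReal
        + 2 * s * ((∫ x, φ x ∂μ) - ∫ x, φ x ∂ν) + a + 4 * s * M * (μ Bᶜ).toReal := by
      rw [hG, integral_add i4 hind, integral_add i3 (integrable_const a), integral_add i1 i2,
        integral_const_mul, integral_const_mul, hφe, hce, integral_indicator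
          (hB.compl.preimage measurable_fst),
        setIntegral_const, measureReal_def, hmass]
      simp [mul_comm]
    have hG0 : 0 ≤ᵐ[γ] G := by
      filter_upwards [hmem] with q hq
      simp only [Pi.zero_apply, hG]
      by_cases hqB : q.1 ∈ B
      · have := hpt q.1 hqB hq.1 q.2 hq.2
        rw [indicator_of_notMem (by simpa using hqB)]
        nlinarith [sq_nonneg ‖X q.1 - q.2‖]
      · rw [indicator_of_mem (by simpa using hqB)]
        have h1 := abs_le.1 (hφM _ hq.1)
        have h2 := abs_le.1 (hφM _ hq.2)
        have h3 : 0 ≤ (1 + s * H) * ‖q.1 - q.2‖ ^ 2 := by positivity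
        nlinarith
    have h1 : ∫⁻ q in Prod.fst ⁻¹' B, edist (Prod.map X id q).1 (Prod.map X id q).2 ^ 2 ∂γ ≤
        ENNReal.ofReal (∫ q, G q ∂γ) := by
      rw [ofReal_integral_eq_lintegral_ofReal hGi hG0]
      refine le_trans ?_ (setLIntegral_le_lintegral (Prod.fst ⁻¹' B) _)
      refine lintegral_mono_ae ?_
      filter_upwards [ae_restrict_mem hBp, ae_restrict_of_ae hmem] with q hqB hq
      simp only [Prod.map_fst, Prod.map_snd, id]
      rw [edist_sq_eq_ofReal]
      refine ENNReal.ofReal_le_ofReal ((hpt q.1 hqB hq.1 q.2 hq.2).trans ?_)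
      simp only [hG]
      rw [indicator_of_notMem (by simpa using hqB), add_zero]
    have h3 := hplan.trans (add_le_add h1 h2)
    have h4 := ENNReal.toReal_mono (by finiteness) h3
    rw [ENNReal.toReal_add (by finiteness) (by finiteness), ENNReal.toReal_mul,
      ENNReal.toReal_ofReal (integral_nonneg_of_ae hG0), ENNReal.toReal_ofReal (by positivity),
      hGe] at h4
    linarith
  refine le_of_forall_pos_le_add fun ε hε => ?_
  -- An almost optimal plan suffices; its excess is multiplied by `1 + s * H` in `plan`, which
  -- leaves `ε`.
  have hδ : 0 < ε / (1 + s * H) := by positivity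
  have hlt : W2 μ ν ^ 2 < W2 μ ν ^ 2 + ENNReal.ofReal (ε / (1 + s * H)) :=
    ENNReal.lt_add_right hWtop (by simpa using hδ)
  conv_lhs at hlt => rw [W2_sq]
  simp only [iInf_lt_iff] at hlt
  obtain ⟨γ, hγ, hlt⟩ := hlt
  have h1 := plan γ hγ (hlt.trans_le le_top).ne
  have h2 := ENNReal.toReal_mono (ENNReal.add_ne_top.2 ⟨hWtop, ENNReal.ofReal_ne_top⟩) hlt.le
  rw [ENNReal.toReal_add hWtop (by finiteness), ENNReal.toReal_ofReal hδ.le] at h2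
  have h3 := mul_le_mul_of_nonneg_left h2 (by positivity : 0 ≤ 1 + s * H)
  rw [mul_add, mul_div_cancel₀ _ (by positivity)] at h3
  linarith

end JKO

namespace JKO

variable {d : ℕ}

/-! ### Tangential vector fields on convex sets -/

/-- An explicit Euler scheme shows that moving along a tangential Lipschitz vector field leaves a
compact convex set only to second order. -/
lemma exists_dist_le_of_tangential {C : Set (Rd d)} (hC : IsCompact C) (hconv : Convex ℝ C)
    {V : Rd d → Rd d} {M L : ℝ} (hM : ∀ b ∈ C, ‖V b‖ ≤ M)
    (hL : ∀ a ∈ C, ∀ b ∈ C, ‖V a - V b‖ ≤ L * ‖a - b‖) (hL0 : 0 ≤ L)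
    (htan : ∀ x, ∀ b ∈ C, (∀ z ∈ C, inner ℝ (x - b) (z - b) ≤ 0) → inner ℝ (x - b) (V b) = 0)
    {y : Rd d} (hy : y ∈ C) (t : ℝ) :
    ∃ z ∈ C, ‖y + t • V y - z‖ ≤ 2 * L * M * t ^ 2 := by
  have hM0 : 0 ≤ M := (norm_nonneg _).trans (hM y hy)
  have hne : C.Nonempty := ⟨y, hy⟩
  choose P hPC hPinf using fun x => exists_norm_eq_iInf_of_complete_convex hne hC.isComplete hconv x
  have hPvar : ∀ x, ∀ z ∈ C, inner ℝ (x - P x) (z - P x) ≤ 0 := fun x =>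
    (norm_eq_iInf_iff_real_inner_le_zero hconv (hPC x)).1 (hPinf x)
  have hPmin : ∀ x, ∀ z ∈ C, ‖x - P x‖ ≤ ‖x - z‖ := fun x z hz => by
    rw [hPinf x]
    exact ciInf_le ⟨0, by rintro _ ⟨w, rfl⟩; exact norm_nonneg _⟩ (⟨z, hz⟩ : C)
  have hP0 : ∀ x, inner ℝ (x - P x) (V (P x)) = 0 := fun x => htan x _ (hPC x) (hPvar x)
  have approx : ∀ N : ℕ, 0 < N → ∃ z ∈ C, ‖y + t • V y - z‖ ≤
      2 * L * M * t ^ 2 + |t| * M / Real.sqrt N := by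
    intro N hN
    have hN' : (0 : ℝ) < N := by exact_mod_cast hN
    set h : ℝ := t / N with hh
    -- The field is evaluated at the projection of the current point: there it is orthogonal to the
    -- normal vector `Y k - P (Y k)`, and the iterates may leave the set where `V` is controlled.
    let Y : ℕ → Rd d := fun k => Nat.rec y (fun _ x => x + h • V (P x)) k
    have hY : ∀ k, Y (k + 1) = Y k + h • V (P (Y k)) := fun k => rfl
    have hY0 : Y 0 = y := rfl
    have h1 : ∀ k, ‖Y k - y‖ ≤ k * (|h| * M) := by
      intro k
      induction k with
      | zero => simp [hY0]
      | succ k ih =>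
        rw [hY, add_sub_right_comm]
        refine (norm_add_le _ _).trans ?_
        rw [norm_smul, Real.norm_eq_abs]
        push_cast
        have := mul_le_mul_of_nonneg_left (hM _ (hPC (Y k))) (abs_nonneg h)
        linarith
    -- By orthogonality (`hP0`) the cross term vanishes, so each step adds at most `h ^ 2 * M ^ 2`
    -- to the squared distance. After `N` steps with `h = t / N` this is `t ^ 2 * M ^ 2 / N`, which
    -- tends to zero.
    have h2 : ∀ k, ‖Y k - P (Y k)‖ ^ 2 ≤ k * (h ^ 2 * M ^ 2) := by
      intro k
      induction k with
      | zero =>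
        have := hPmin y y hy
        rw [sub_self, norm_zero] at this
        have h0 : ‖y - P y‖ = 0 := le_antisymm this (norm_nonneg _)
        simp [hY0, h0]
      | succ k ih =>
        have e1 : ‖Y (k + 1) - P (Y (k + 1))‖ ^ 2 ≤ ‖Y (k + 1) - P (Y k)‖ ^ 2 :=
          pow_le_pow_left₀ (norm_nonneg _) (hPmin _ _ (hPC _)) 2
        refine e1.trans ?_
        rw [hY, add_sub_right_comm, norm_add_sq_real, real_inner_smul_right, hP0]
        rw [norm_smul, mul_pow, Real.norm_eq_abs, sq_abs]
        have := mul_le_mul_of_nonneg_left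
          (pow_le_pow_left₀ (norm_nonneg _) (hM _ (hPC (Y k))) 2) (sq_nonneg h)
        push_cast
        linarith
    -- The scheme deviates from the straight step through the Lipschitz constant only. The factor 2
    -- arises because the projection at most doubles the distance to `y ∈ C`.
    have h3 : ∀ k, k ≤ N → ‖Y k - (y + (k * h) • V y)‖ ≤ k * (|h| * (2 * L * (|t| * M))) := by
      intro k
      induction k with
      | zero => intro _; simp [hY0]
      | succ k ih =>
        intro hk
        have hkN : k ≤ N := by omega
        have e1 : Y (k + 1) - (y + ((k + 1 : ℕ) * h) • V y) =
            (Y k - (y + (k * h) • V y)) + h • (V (P (Y k)) - V y) := by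
          rw [hY, smul_sub]; push_cast; rw [add_mul, add_smul, one_mul]; abel
        have e2 : ‖Y k - y‖ ≤ |t| * M := by
          refine (h1 k).trans ?_
          rw [← mul_assoc]
          refine mul_le_mul_of_nonneg_right ?_ hM0
          rw [hh, abs_div, abs_of_pos hN']
          have : (k : ℝ) ≤ N := by exact_mod_cast hkN
          calc (k : ℝ) * (|t| / N) ≤ N * (|t| / N) := by gcongr
            _ = |t| := by field_simp
        have e3 : ‖V (P (Y k)) - V y‖ ≤ 2 * L * (|t| * M) := by
          refine (hL _ (hPC _) _ hy).trans ?_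
          have e4 : ‖P (Y k) - y‖ ≤ 2 * ‖Y k - y‖ := by
            calc ‖P (Y k) - y‖ = ‖(Y k - y) - (Y k - P (Y k))‖ := by congr 1; abel
              _ ≤ ‖Y k - y‖ + ‖Y k - P (Y k)‖ := norm_sub_le _ _
              _ ≤ 2 * ‖Y k - y‖ := by linarith [hPmin (Y k) y hy]
          calc L * ‖P (Y k) - y‖ ≤ L * (2 * (|t| * M)) := by gcongr; linarith
            _ = _ := by ring
        rw [e1]
        refine (norm_add_le _ _).trans ?_
        rw [norm_smul, Real.norm_eq_abs]
        have := mul_le_mul_of_nonneg_left e3 (abs_nonneg h)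
        push_cast
        linarith [ih hkN]
    refine ⟨P (Y N), hPC _, ?_⟩
    have hNh : (N : ℝ) * h = t := by rw [hh]; field_simp
    have hNh' : (N : ℝ) * |h| = |t| := by
      rw [← hNh, abs_mul, abs_of_pos hN']
    have e1 := h3 N le_rfl
    rw [hNh, ← mul_assoc, hNh'] at e1
    have e2 : ‖Y N - P (Y N)‖ ≤ |t| * M / Real.sqrt N := by
      refine le_of_sq_le_sq ?_ (by positivity)
      refine (h2 N).trans (le_of_eq ?_)
      rw [div_pow (|t| * M), Real.sq_sqrt hN'.le, mul_pow, sq_abs, hh]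
      field_simp
    calc ‖y + t • V y - P (Y N)‖ = ‖(Y N - P (Y N)) - (Y N - (y + t • V y))‖ := by congr 1; abel
      _ ≤ ‖Y N - P (Y N)‖ + ‖Y N - (y + t • V y)‖ := norm_sub_le _ _
      _ ≤ |t| * M / Real.sqrt N + |t| * (2 * L * (|t| * M)) := add_le_add e2 e1
      _ = _ := by rw [← sq_abs t]; ring
  -- The nearest point does at least as well as the approximants for every `N`, so one witness
  -- allows `N → ∞`.
  refine ⟨P (y + t • V y), hPC _, ?_⟩
  have hlim : Filter.Tendsto (fun N : ℕ => 2 * L * M * t ^ 2 + |t| * M / Real.sqrt N) Filter.atTop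
      (nhds (2 * L * M * t ^ 2 + 0)) := by
    refine tendsto_const_nhds.add (tendsto_const_nhds.div_atTop ?_)
    exact Real.tendsto_sqrt_atTop.comp tendsto_natCast_atTop_atTop
  rw [add_zero] at hlim
  refine ge_of_tendsto hlim ?_
  filter_upwards [Filter.eventually_gt_atTop 0] with N hN
  obtain ⟨z, hz, hzN⟩ := approx N hN
  exact (hPmin _ z hz).trans hzN

/-- The normal cone at a smooth boundary point is spanned by the gradient of a defining function. -/
lemma IsLocalDefiningFunction.exists_eq_smul {Ω U : Set (Rd d)} {b : Rd d} {ρ : Rd d → ℝ}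
    (h : IsLocalDefiningFunction Ω b U ρ) (hb : b ∈ frontier Ω) {w : Rd d}
    (hw : ∀ z ∈ Ω, inner ℝ w (z - b) ≤ 0) : ∃ c : ℝ, w = c • ∇ ρ b := by
  have hdiff : HasFDerivAt ρ (fderiv ℝ ρ b) b :=
    ((h.smooth.contDiffAt (h.isOpen.mem_nhds h.mem)).differentiableAt (by simp)).hasFDerivAt
  have hρ0 : ρ b ≤ 0 := by
    have hcl : b ∈ closure (Ω ∩ U) := by
      rw [mem_closure_iff_nhds]
      intro t ht
      obtain ⟨z, hz⟩ := mem_closure_iff_nhds.1 (frontier_subset_closure hb) (t ∩ U)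
        (Filter.inter_mem ht (h.isOpen.mem_nhds h.mem))
      exact ⟨z, hz.1.1, hz.2, hz.1.2⟩
    have hc : ContinuousWithinAt ρ (Ω ∩ U) b := hdiff.continuousAt.continuousWithinAt
    have := hc.mem_closure hcl (t := Iic 0) fun z hz => by
      rw [h.inter_eq] at hz; exact hz.2.le
    simpa using this
  -- A strict descent direction of `ρ` enters `Ω` for small times because `ρ b ≤ 0`, so `w` cannot
  -- have a positive component along it.
  have key : ∀ v, inner ℝ (∇ ρ b) v < 0 → inner ℝ w v ≤ 0 := by
    intro v hv
    rw [inner_gradient_eq_fderiv] at hv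
    have hline : HasDerivAt (fun t : ℝ => b + t • v) v 0 := by
      simpa using ((hasDerivAt_id (0 : ℝ)).smul_const v).const_add b
    have hd : HasDerivAt (fun t : ℝ => ρ (b + t • v)) (fderiv ℝ ρ b v) 0 :=
      hdiff.comp_hasDerivAt_of_eq (0 : ℝ) hline (by simp)
    have hsub : Ioi (0 : ℝ) ⊆ {0}ᶜ := fun t ht => ne_of_gt (mem_Ioi.1 ht)
    have hs := (hasDerivAt_iff_tendsto_slope_zero.1 hd).mono_left (nhdsWithin_mono (0 : ℝ) hsub)
    have h1 := hs.eventually (gt_mem_nhds hv)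
    have h2 : ∀ᶠ t : ℝ in nhdsWithin 0 (Ioi 0), b + t • v ∈ U := by
      refine nhdsWithin_le_nhds (hline.continuousAt.eventually_mem (h.isOpen.mem_nhds ?_))
      simpa using h.mem
    obtain ⟨t, ht1, ht2, ht0⟩ := (h1.and (h2.and self_mem_nhdsWithin)).exists
    have ht0' : (0 : ℝ) < t := ht0
    simp only [zero_add, zero_smul, add_zero, smul_eq_mul] at ht1
    have h3 : ρ (b + t • v) < 0 := by
      have : ρ (b + t • v) - ρ b < 0 := by
        by_contra hcon
        push Not at hcon
        exact absurd ht1 (not_lt.2 (mul_nonneg (inv_nonneg.2 ht0'.le) hcon))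
      linarith
    have h4 : b + t • v ∈ Ω := by
      have : b + t • v ∈ Ω ∩ U := by rw [h.inter_eq]; exact ⟨ht2, h3⟩
      exact this.1
    have h5 := hw _ h4
    rw [add_sub_cancel_left, real_inner_smul_right] at h5
    exact nonpos_of_mul_nonpos_right h5 ht0'
  set n := ∇ ρ b with hn
  have hn0 : 0 < ‖n‖ ^ 2 := by have := norm_pos_iff.2 h.grad_ne; positivity
  refine ⟨inner ℝ w n / ‖n‖ ^ 2, ?_⟩
  set c := inner ℝ w n / ‖n‖ ^ 2 with hc
  have hcn : inner ℝ n w = c * ‖n‖ ^ 2 := by rw [hc, real_inner_comm, div_mul_cancel₀ _ hn0.ne']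
  have hwn : inner ℝ w n = c * ‖n‖ ^ 2 := by rw [real_inner_comm, hcn]
  have hperp : inner ℝ n (w - c • n) = 0 := by
    rw [inner_sub_right, real_inner_smul_right, hcn, real_inner_self_eq_norm_sq]; ring
  have hsq : inner ℝ w (w - c • n) = ‖w - c • n‖ ^ 2 := by
    rw [← real_inner_self_eq_norm_sq, inner_sub_left (x := w), real_inner_smul_left, hperp]; ring
  -- The component of `w` orthogonal to `n` is only a limit of strict descent directions;
  -- subtracting `ε • n` makes it one.
  have hle : ∀ ε > 0, ‖w - c • n‖ ^ 2 ≤ ε * inner ℝ w n := by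
    intro ε hε
    have := key (w - c • n - ε • n) (by
      rw [inner_sub_right, hperp, real_inner_smul_right, real_inner_self_eq_norm_sq]
      nlinarith)
    rw [inner_sub_right, hsq, real_inner_smul_right] at this
    linarith
  have hz : ‖w - c • n‖ ^ 2 ≤ 0 := by
    have hlim : Filter.Tendsto (fun ε : ℝ => ε * inner ℝ w n) (nhdsWithin 0 (Ioi 0)) (nhds 0) := by
      have : Filter.Tendsto (fun ε : ℝ => ε * inner ℝ w n) (nhds 0) (nhds (0 * inner ℝ w n)) :=
        (continuous_id.mul continuous_const).tendsto 0
      rw [zero_mul] at this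
      exact this.mono_left nhdsWithin_le_nhds
    exact ge_of_tendsto hlim (by filter_upwards [self_mem_nhdsWithin] with ε hε using hle ε hε)
  have : ‖w - c • n‖ = 0 := by
    have := sq_nonneg ‖w - c • n‖
    exact pow_eq_zero_iff two_ne_zero |>.1 (le_antisymm hz this)
  exact sub_eq_zero.1 (norm_eq_zero.1 this)

end JKO

/-! ### Gradients of Neumann test functions as tangential fields, and Taylor bounds -/

namespace JKO

variable {d : ℕ}

/-- The Riesz isomorphism from linear forms to vectors. -/
noncomputable def dualIso : (Rd d →L[ℝ] ℝ) ≃L[ℝ] Rd d where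
  toFun l := (InnerProductSpace.toDual ℝ (Rd d)).symm l
  invFun v := InnerProductSpace.toDual ℝ (Rd d) v
  map_add' := by simp
  map_smul' := by simp
  left_inv l := by simp
  right_inv v := by simp
  continuous_toFun := (InnerProductSpace.toDual ℝ (Rd d)).symm.continuous
  continuous_invFun := (InnerProductSpace.toDual ℝ (Rd d)).continuous

lemma gradient_eq_dualIso (f : Rd d → ℝ) (x : Rd d) : ∇ f x = dualIso (fderiv ℝ f x) := rfl

lemma inner_dualIso (l : Rd d →L[ℝ] ℝ) (v : Rd d) : inner ℝ (dualIso l) v = l v :=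
  InnerProductSpace.toDual_symm_apply

lemma norm_dualIso (l : Rd d →L[ℝ] ℝ) : ‖dualIso l‖ = ‖l‖ :=
  (InnerProductSpace.toDual ℝ (Rd d)).symm.norm_map l

/-- Vector fields that are smooth with bounded derivatives on `Ω` and tangential on its boundary. -/
structure IsTestField (Ω : Set (Rd d)) (V : Rd d → Rd d) (M : ℝ) : Prop where
  smooth : ContDiffOn ℝ ∞ V Ω
  bound : ∀ y ∈ Ω, ‖V y‖ ≤ M
  bound_fderiv : ∀ y ∈ Ω, ‖fderiv ℝ V y‖ ≤ M
  bound_fderiv_fderiv : ∀ y ∈ Ω, ‖fderiv ℝ (fderiv ℝ V) y‖ ≤ M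
  tangential : ∀ y ∈ Ω, ∀ t : ℝ, ∃ z ∈ closure Ω, ‖y + t • V y - z‖ ≤ M * t ^ 2

lemma IsSmoothConvexDomain.uniqueDiffOn_closure {Ω : Set (Rd d)} (hΩ : IsSmoothConvexDomain Ω) :
    UniqueDiffOn ℝ (closure Ω) :=
  uniqueDiffOn_convex hΩ.convex.closure
    (hΩ.nonempty.mono (hΩ.isOpen.subset_interior_iff.2 subset_closure))

lemma IsSmoothConvexDomain.isCompact_closure {Ω : Set (Rd d)} (hΩ : IsSmoothConvexDomain Ω) :
    IsCompact (closure Ω) :=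
  Metric.isCompact_of_isClosed_isBounded isClosed_closure hΩ.bounded.closure

lemma fderivWithin_closure_eq {Ω : Set (Rd d)} (hΩ : IsOpen Ω) {G : Type*} [NormedAddCommGroup G]
    [NormedSpace ℝ G] (f : Rd d → G) {x : Rd d} (hx : x ∈ Ω) :
    fderivWithin ℝ f (closure Ω) x = fderiv ℝ f x :=
  fderivWithin_of_mem_nhds (Filter.mem_of_superset (hΩ.mem_nhds hx) subset_closure)

lemma fderiv_congr_of_eqOn {Ω : Set (Rd d)} (hΩ : IsOpen Ω) {G : Type*} [NormedAddCommGroup G]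
    [NormedSpace ℝ G] {f g : Rd d → G} (h : EqOn f g Ω) : EqOn (fderiv ℝ f) (fderiv ℝ g) Ω :=
  fun _ hx => (Filter.eventuallyEq_of_mem (hΩ.mem_nhds hx) h).fderiv_eq

lemma exists_bound_fderivWithin {E G : Type*} [NormedAddCommGroup E] [NormedSpace ℝ E]
    [NormedAddCommGroup G] [NormedSpace ℝ G] {C : Set E} (hC : IsCompact C)
    (hu : UniqueDiffOn ℝ C) {f : E → G} (hf : ContDiffOn ℝ ∞ f C) :
    ∃ M, ∀ x ∈ C, ‖fderivWithin ℝ f C x‖ ≤ M :=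
  hC.exists_bound_of_continuousOn (hf.continuousOn_fderivWithin hu (by simp))

/-- The bounds hold by compactness of the closure. Since `φ` is controlled only there, derivatives
are first taken within the closure and then identified with ordinary ones on the open set `Ω`.
Tangentiality follows from `exists_dist_le_of_tangential`: interior points have a trivial normal
cone, and on the boundary the cone is spanned by `∇ ρ b`, to which the Neumann condition makes the
field orthogonal. -/
lemma IsNeumannTest.exists_isTestField {Ω : Set (Rd d)} (hΩ : IsSmoothConvexDomain Ω)
    {φ : Rd d → ℝ} (hφ : IsNeumannTest Ω φ) : ∃ M, IsTestField Ω (∇ φ) M := by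
  set C := closure Ω with hC
  have hu : UniqueDiffOn ℝ C := hΩ.uniqueDiffOn_closure
  have hcomp : IsCompact C := hΩ.isCompact_closure
  set V : Rd d → Rd d := fun x => dualIso (fderivWithin ℝ φ C x) with hV
  have hVs : ContDiffOn ℝ ∞ V C :=
    dualIso.contDiff.comp_contDiffOn (hφ.smooth.fderivWithin hu (by simp))
  have hV1 : ContDiffOn ℝ ∞ (fderivWithin ℝ V C) C := hVs.fderivWithin hu (by simp)
  obtain ⟨M0, hM0⟩ := hcomp.exists_bound_of_continuousOn hVs.continuousOn
  obtain ⟨M1, hM1⟩ := exists_bound_fderivWithin hcomp hu hVs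
  obtain ⟨M2, hM2⟩ := exists_bound_fderivWithin hcomp hu hV1
  have hsub : Ω ⊆ C := subset_closure
  have e0 : EqOn (∇ φ) V Ω := fun x hx => by
    rw [gradient_eq_dualIso, hV]
    simp only
    rw [fderivWithin_closure_eq hΩ.isOpen φ hx]
  have e1 : EqOn (fderiv ℝ (∇ φ)) (fderivWithin ℝ V C) Ω := fun x hx => by
    rw [fderivWithin_closure_eq hΩ.isOpen V hx, fderiv_congr_of_eqOn hΩ.isOpen e0 hx]
  have e2 : EqOn (fderiv ℝ (fderiv ℝ (∇ φ))) (fderivWithin ℝ (fderivWithin ℝ V C) C) Ω :=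
    fun x hx => by
      rw [fderivWithin_closure_eq hΩ.isOpen _ hx, fderiv_congr_of_eqOn hΩ.isOpen e1 hx]
  have hL : ∀ a ∈ C, ∀ b ∈ C, ‖V a - V b‖ ≤ max M1 0 * ‖a - b‖ := fun a ha b hb =>
    (hΩ.convex.closure).norm_image_sub_le_of_norm_fderivWithin_le
      (hVs.differentiableOn (by simp)) (fun x hx => (hM1 x hx).trans (le_max_left _ _)) hb ha
  have htan : ∀ x, ∀ b ∈ C, (∀ z ∈ C, inner ℝ (x - b) (z - b) ≤ 0) →
      inner ℝ (x - b) (V b) = 0 := by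
    intro x b hb hvar
    by_cases hbΩ : b ∈ Ω
    · -- interior points have trivial normal cone
      have : x - b = 0 := by
        obtain ⟨ε, hε, hball⟩ := Metric.isOpen_iff.1 hΩ.isOpen b hbΩ
        by_contra hne
        have hpos : 0 < ‖x - b‖ := norm_pos_iff.2 hne
        have hmem : b + (ε / 2 / ‖x - b‖) • (x - b) ∈ Ω := by
          apply hball
          rw [Metric.mem_ball, dist_eq_norm, add_sub_cancel_left, norm_smul, Real.norm_eq_abs,
            abs_of_pos (by positivity), div_mul_cancel₀ _ hpos.ne']
          linarith
        have := hvar _ (hsub hmem)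
        rw [add_sub_cancel_left, real_inner_smul_right, real_inner_self_eq_norm_sq] at this
        have h2 : 0 < ε / 2 / ‖x - b‖ * ‖x - b‖ ^ 2 := by positivity
        linarith
      rw [this, inner_zero_left]
    · have hbf : b ∈ frontier Ω := ⟨hb, fun h => hbΩ (interior_subset h)⟩
      obtain ⟨U, ρ, hρ⟩ := hΩ.smooth_boundary b hbf
      obtain ⟨c, hc⟩ := hρ.exists_eq_smul hbf (w := x - b) fun z hz => hvar z (hsub hz)
      have hn := hφ.neumann b hbf _ ⟨U, ρ, hρ, rfl⟩
      rw [map_smul, smul_eq_mul, mul_eq_zero, or_iff_right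
        (inv_ne_zero (norm_ne_zero_iff.2 hρ.grad_ne))] at hn
      rw [hc, real_inner_smul_left, real_inner_comm, hV]
      simp only
      rw [inner_dualIso, hn, mul_zero]
  obtain ⟨x₀, hx₀⟩ := hΩ.nonempty
  have hM00 : 0 ≤ M0 := (norm_nonneg _).trans (hM0 x₀ (hsub hx₀))
  refine ⟨max (max M0 M1) (max M2 (2 * max M1 0 * M0)), ?_, ?_, ?_, ?_, ?_⟩
  · exact (hVs.mono hsub).congr e0
  · intro y hy
    rw [e0 hy]
    exact (hM0 y (hsub hy)).trans ((le_max_left _ _).trans (le_max_left _ _))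
  · intro y hy
    rw [e1 hy]
    exact (hM1 y (hsub hy)).trans ((le_max_right _ _).trans (le_max_left _ _))
  · intro y hy
    rw [e2 hy]
    exact (hM2 y (hsub hy)).trans ((le_max_left _ _).trans (le_max_right _ _))
  · intro y hy t
    obtain ⟨z, hz, hzt⟩ := exists_dist_le_of_tangential hcomp hΩ.convex.closure hM0 hL
      (le_max_right _ _) htan (hsub hy) t
    refine ⟨z, hz, ?_⟩
    rw [e0 hy]
    exact hzt.trans (mul_le_mul_of_nonneg_right ((le_max_right _ _).trans (le_max_right _ _))
      (sq_nonneg t))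

lemma exists_bound_fderiv {E G : Type*} [NormedAddCommGroup E] [NormedSpace ℝ E]
    [NormedAddCommGroup G] [NormedSpace ℝ G] {C : Set E} (hC : IsCompact C)
    {f : E → G} (hf : ContDiff ℝ ∞ f) : ∃ M, ∀ x ∈ C, ‖fderiv ℝ f x‖ ≤ M :=
  hC.exists_bound_of_continuousOn (hf.continuous_fderiv (by simp)).continuousOn

/-- One constant serves both estimates: it bounds the second derivative on the unit ball, and the
mean value inequality is applied once to the derivative and once to `f` minus its linear part. -/
lemma exists_taylor_bound {E : Type*} [NormedAddCommGroup E] [NormedSpace ℝ E] [ProperSpace E]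
    {f : E → ℝ} (hf : ContDiff ℝ ∞ f) (a : E) : ∃ c : ℝ, 0 ≤ c ∧ ∀ x, ‖x - a‖ ≤ 1 →
      |f x - f a - fderiv ℝ f a (x - a)| ≤ c * ‖x - a‖ ^ 2 ∧
      ‖fderiv ℝ f x - fderiv ℝ f a‖ ≤ c * ‖x - a‖ := by
  have hf1 : ContDiff ℝ ∞ (fderiv ℝ f) := hf.fderiv_right (by simp)
  obtain ⟨c, hc⟩ := exists_bound_fderiv (isCompact_closedBall a 1) hf1
  have h1 : ∀ x, ‖x - a‖ ≤ 1 → ‖fderiv ℝ f x - fderiv ℝ f a‖ ≤ max c 0 * ‖x - a‖ := by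
    intro x hx
    refine (convex_closedBall a 1).norm_image_sub_le_of_norm_fderiv_le
      (fun z _ => hf1.differentiable (by simp) z) (fun z hz => (hc z hz).trans (le_max_left _ _))
      (Metric.mem_closedBall_self zero_le_one) ?_
    rwa [mem_closedBall_iff_norm]
  refine ⟨max c 0, le_max_right _ _, fun x hx => ⟨?_, h1 x hx⟩⟩
  have h2 := (convex_closedBall a ‖x - a‖).norm_image_sub_le_of_norm_fderiv_le'
    (f := f) (φ := fderiv ℝ f a) (C := max c 0 * ‖x - a‖) (x := a) (y := x)
    (fun z _ => hf.differentiable (by simp) z) (fun z hz => ?_)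
    (Metric.mem_closedBall_self (norm_nonneg _)) (by rw [mem_closedBall_iff_norm])
  · rw [← Real.norm_eq_abs, sq, ← mul_assoc]
    exact h2
  · rw [mem_closedBall_iff_norm] at hz
    exact (h1 z (hz.trans hx)).trans (mul_le_mul_of_nonneg_left hz (le_max_right _ _))

/-- The second order expansion of the determinant at the identity. -/
lemma exists_det_expansion (d : ℕ) : ∃ c : ℝ, 0 ≤ c ∧ ∀ A : Rd d →L[ℝ] Rd d, ‖A - 1‖ ≤ 1 →
    |A.det - 1 - traceL (A - 1)| ≤ c * ‖A - 1‖ ^ 2 ∧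
    ‖fderiv ℝ (fun A : Rd d →L[ℝ] Rd d => A.det) A - traceL‖ ≤ c * ‖A - 1‖ := by
  have : ProperSpace (Rd d →L[ℝ] Rd d) := FiniteDimensional.proper ℝ _
  obtain ⟨c, hc0, hc⟩ := exists_taylor_bound (contDiff_det (d := d)) 1
  have htr : fderiv ℝ (fun A : Rd d →L[ℝ] Rd d => A.det) 1 = traceL := by
    ext1 B; exact fderiv_det_one B
  have h1 : (1 : Rd d →L[ℝ] Rd d).det = 1 := LinearMap.det_id
  rw [htr, h1] at hc
  exact ⟨c, hc0, hc⟩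

end JKO

/-! ### Construction of maps of the domain into itself that follow a tangential field -/

namespace JKO

variable {d : ℕ}

/-- A family of embeddings of `Ω` into itself that moves points with velocity `-V`, to second
order. -/
structure IsVariation (Ω : Set (Rd d)) (V : Rd d → Rd d) (S : ℝ → Rd d → Rd d) (s₀ C : ℝ) :
    Prop where
  le_one : s₀ ≤ 1
  emb : ∀ s, s ≠ 0 → |s| ≤ s₀ → IsSmoothEmbedding Ω (S s)
  disp : ∀ s, s ≠ 0 → |s| ≤ s₀ → ∀ y ∈ Ω, ‖y - S s y - s • V y‖ ≤ C * s ^ 2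
  disp_fderiv : ∀ s, s ≠ 0 → |s| ≤ s₀ → ∀ y ∈ Ω,
    ‖fderiv ℝ (S s) y - 1 + s • fderiv ℝ V y‖ ≤ C * s ^ 2
  disp_det : ∀ s, s ≠ 0 → |s| ≤ s₀ → ∀ y ∈ Ω,
    |(fderiv ℝ (S s) y).det - 1 + s * traceL (fderiv ℝ V y)| ≤ C * s ^ 2
  disp_fderiv_det : ∀ s, s ≠ 0 → |s| ≤ s₀ → ∀ y ∈ Ω,
    ‖fderiv ℝ (fun y => (fderiv ℝ (S s) y).det) y
      + s • traceL.comp (fderiv ℝ (fderiv ℝ V) y)‖ ≤ C * s ^ 2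
  half_le_det : ∀ s, s ≠ 0 → |s| ≤ s₀ → ∀ y ∈ Ω, 1 / 2 ≤ (fderiv ℝ (S s) y).det

/-- Move along `-s • V`, then contract towards `x₀` by the factor `1 - K * s ^ 2`. -/
noncomputable def variationMap (V : Rd d → Rd d) (x₀ : Rd d) (K s : ℝ) (y : Rd d) : Rd d :=
  x₀ + (1 - K * s ^ 2) • (y - s • V y - x₀)

lemma hasFDerivAt_variationMap {V : Rd d → Rd d} {V' : Rd d →L[ℝ] Rd d} {y : Rd d}
    (h : HasFDerivAt V V' y) (x₀ : Rd d) (K s : ℝ) :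
    HasFDerivAt (variationMap V x₀ K s) ((1 - K * s ^ 2) • ((1 : Rd d →L[ℝ] Rd d) - s • V')) y :=
  ((((hasFDerivAt_id y).sub (h.const_smul s)).sub_const x₀).const_smul (1 - K * s ^ 2)).const_add x₀

section

variable {E G : Type*} [NormedAddCommGroup E] [NormedSpace ℝ E] [NormedAddCommGroup G]
  [NormedSpace ℝ G] {κ s M T : ℝ}

/-- In this and the next two bounds `κ` stands for the contraction `K * s ^ 2`; here `e` and `A`
stand for the identity and `DV`. The contraction is thus visible only at second order. -/
lemma norm_one_sub_smul_le {e A : G} (he : ‖e‖ ≤ 1) (hA : ‖A‖ ≤ M) (hκ : 0 ≤ κ) (hs : |s| ≤ 1) :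
    ‖(1 - κ) • (e - s • A) - e + s • A‖ ≤ κ * (1 + M) := by
  have h1 : (1 - κ) • (e - s • A) - e + s • A = -(κ • (e - s • A)) := by module
  have h2 : ‖s • A‖ ≤ M := by
    rw [norm_smul, Real.norm_eq_abs]
    exact (mul_le_of_le_one_left (norm_nonneg _) hs).trans hA
  rw [h1, norm_neg, norm_smul, Real.norm_of_nonneg hκ]
  exact mul_le_mul_of_nonneg_left ((norm_sub_le _ _).trans (add_le_add he h2)) hκ

lemma abs_sub_one_add_le (t : G →L[ℝ] ℝ) {e A B : G} {δ c₁ c₂ : ℝ} (ht : ‖t‖ ≤ T)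
    (h₁ : |δ - 1 - t (B - e)| ≤ c₁) (h₂ : ‖B - e + s • A‖ ≤ c₂) :
    |δ - 1 + s * t A| ≤ c₁ + T * c₂ := by
  have h3 : δ - 1 + s * t A = (δ - 1 - t (B - e)) + t (B - e + s • A) := by
    rw [map_add, map_smul, smul_eq_mul]; ring
  have h4 : |t (B - e + s • A)| ≤ T * c₂ := (t.le_opNorm _).trans
    (mul_le_mul ht h₂ (norm_nonneg _) ((norm_nonneg _).trans ht))
  rw [h3]
  exact (abs_add_le _ _).trans (add_le_add h₁ h4)

/-- Here `D` is the derivative of the determinant at `DS`, `t` its value at the identity (the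
trace), and `A` the second derivative of `V`. -/
lemma norm_comp_add_comp_le (D t : G →L[ℝ] ℝ) (A : E →L[ℝ] G) {b : ℝ} (hD : ‖D - t‖ ≤ b)
    (ht : ‖t‖ ≤ T) (hA : ‖A‖ ≤ M) (hκ : 0 ≤ κ) (hs : |s| ≤ 1) :
    ‖D.comp ((1 - κ) • -(s • A)) + s • t.comp A‖ ≤ |s| * (b * M) + κ * ((T + b) * M) := by
  have hb : 0 ≤ b := (norm_nonneg _).trans hD
  have hT : 0 ≤ T := (norm_nonneg _).trans ht
  have h1 : D.comp ((1 - κ) • -(s • A)) + s • t.comp A =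
      -(s • (D - t).comp A) + (κ * s) • D.comp A := by
    ext v
    simp only [ContinuousLinearMap.comp_apply, add_apply, smul_apply, neg_apply, sub_apply,
      map_smul, map_neg, smul_eq_mul]
    ring
  have h2 : ‖D‖ ≤ T + b := by
    have : D = t + (D - t) := by abel
    rw [this]
    exact (norm_add_le _ _).trans (add_le_add ht hD)
  have h3 : ‖(D - t).comp A‖ ≤ b * M := (ContinuousLinearMap.opNorm_comp_le _ _).trans
    (mul_le_mul hD hA (norm_nonneg _) hb)
  have h4 : ‖D.comp A‖ ≤ (T + b) * M := (ContinuousLinearMap.opNorm_comp_le _ _).trans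
    (mul_le_mul h2 hA (norm_nonneg _) (by positivity))
  rw [h1]
  refine (norm_add_le _ _).trans ?_
  rw [norm_neg, norm_smul, norm_smul, Real.norm_eq_abs, Real.norm_eq_abs, abs_mul,
    abs_of_nonneg hκ]
  refine add_le_add (mul_le_mul_of_nonneg_left h3 (abs_nonneg s)) ?_
  exact mul_le_mul (mul_le_of_le_one_right hκ hs) h4 (norm_nonneg _) hκ

end

lemma norm_sub_variationMap_le {Ω : Set (Rd d)} {V : Rd d → Rd d} {M : ℝ} (hV : IsTestField Ω V M)
    {x₀ : Rd d} {K s R : ℝ} (hR : ∀ y ∈ Ω, ‖y - x₀‖ ≤ R)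
    (hK : 0 ≤ K) (hs : |s| ≤ 1) {y : Rd d} (hy : y ∈ Ω) :
    ‖y - variationMap V x₀ K s y - s • V y‖ ≤ K * (R + M) * s ^ 2 := by
  have hκ0 : 0 ≤ K * s ^ 2 := by positivity
  have h1 : y - variationMap V x₀ K s y - s • V y = (K * s ^ 2) • ((y - x₀) - s • V y) := by
    rw [variationMap]; module
  have h2 : ‖s • V y‖ ≤ M := by
    rw [norm_smul, Real.norm_eq_abs]
    exact (mul_le_of_le_one_left (norm_nonneg _) hs).trans (hV.bound y hy)
  rw [h1, norm_smul, Real.norm_of_nonneg hκ0]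
  calc K * s ^ 2 * _ ≤ K * s ^ 2 * (R + M) :=
        mul_le_mul_of_nonneg_left ((norm_sub_le _ _).trans (add_le_add (hR y hy) h2)) hκ0
    _ = _ := by ring

lemma contDiffOn_variationMap {Ω : Set (Rd d)} {V : Rd d → Rd d} {M : ℝ} (hV : IsTestField Ω V M)
    (x₀ : Rd d) (K s : ℝ) : ContDiffOn ℝ ∞ (variationMap V x₀ K s) Ω := by
  have h1 : ContDiffOn ℝ ∞ (fun y => s • V y) Ω := hV.smooth.const_smul s
  have h2 : ContDiffOn ℝ ∞ (fun y => y - s • V y - x₀) Ω :=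
    (contDiffOn_id.sub h1).sub contDiffOn_const
  have h3 : ContDiffOn ℝ ∞ (fun y => (1 - K * s ^ 2) • (y - s • V y - x₀)) Ω := h2.const_smul _
  exact contDiffOn_const.add h3

section

variable {Ω : Set (Rd d)} (hΩ : IsSmoothConvexDomain Ω) {V : Rd d → Rd d} {M : ℝ}
  (hV : IsTestField Ω V M)
include hΩ hV

lemma IsTestField.nonneg : 0 ≤ M := by
  obtain ⟨x, hx⟩ := hΩ.nonempty
  exact (norm_nonneg _).trans (hV.bound x hx)

lemma IsTestField.lipschitz {x y : Rd d} (hx : x ∈ Ω) (hy : y ∈ Ω) :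
    ‖V x - V y‖ ≤ M * ‖x - y‖ :=
  hΩ.convex.norm_image_sub_le_of_norm_fderiv_le
    (fun z hz => ((hV.smooth.contDiffAt (hΩ.isOpen.mem_nhds hz)).differentiableAt (by simp)))
    hV.bound_fderiv hy hx

lemma IsTestField.hasFDerivAt {y : Rd d} (hy : y ∈ Ω) : HasFDerivAt V (fderiv ℝ V y) y :=
  ((hV.smooth.contDiffAt (hΩ.isOpen.mem_nhds hy)).differentiableAt (by simp)).hasFDerivAt

lemma IsTestField.hasFDerivAt_fderiv {y : Rd d} (hy : y ∈ Ω) :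
    HasFDerivAt (fderiv ℝ V) (fderiv ℝ (fderiv ℝ V) y) y :=
  (((hV.smooth.fderiv_of_isOpen hΩ.isOpen (m := ∞) (by simp)).contDiffAt
    (hΩ.isOpen.mem_nhds hy)).differentiableAt (by simp)).hasFDerivAt

/-- Write `y - s V y = w + e` with `w` in the closure and `‖e‖ ≤ M s²`. With `κ = K s²`, the image
is the convex combination `(1 - κ) w + κ (x₀ + ((1 - κ)/κ) e)`. The second point lies in the ball
around `x₀`, because `M s² / κ = M / K < r`; hence the combination is interior. -/
lemma variationMap_mem {x₀ : Rd d} {r K s : ℝ} (hr : 0 < r) (hball : Metric.ball x₀ r ⊆ Ω)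
    (hK : M < K * r) (hs : s ≠ 0) (hKs : K * s ^ 2 ≤ 1 / 2) {y : Rd d} (hy : y ∈ Ω) :
    variationMap V x₀ K s y ∈ Ω := by
  have hM := hV.nonneg hΩ
  have hs2 : 0 < s ^ 2 := by positivity
  have hK0 : 0 < K := by
    by_contra h
    push Not at h
    nlinarith
  obtain ⟨w, hw, hzw⟩ := hV.tangential y hy (-s)
  set κ := K * s ^ 2 with hκ
  have hκ0 : 0 < κ := by positivity
  set e := y + (-s) • V y - w with he
  have h1 : x₀ + ((1 - κ) / κ) • e ∈ Ω := by
    apply hball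
    rw [Metric.mem_ball, dist_eq_norm, add_sub_cancel_left, norm_smul, Real.norm_eq_abs,
      abs_of_nonneg (div_nonneg (by linarith) hκ0.le), div_mul_eq_mul_div, div_lt_iff₀ hκ0]
    rw [neg_sq] at hzw
    calc (1 - κ) * ‖e‖ ≤ 1 * ‖e‖ := mul_le_mul_of_nonneg_right (by linarith) (norm_nonneg _)
      _ ≤ M * s ^ 2 := by rw [one_mul]; exact hzw
      _ < r * κ := by rw [hκ]; nlinarith
  have h2 := hΩ.convex.combo_closure_interior_mem_interior hw
    (by rwa [hΩ.isOpen.interior_eq] : x₀ + ((1 - κ) / κ) • e ∈ interior Ω)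
    (by linarith : 0 ≤ 1 - κ) hκ0 (by ring)
  rw [hΩ.isOpen.interior_eq] at h2
  convert h2 using 1
  rw [smul_add, smul_smul, mul_div_cancel₀ _ hκ0.ne', variationMap, ← hκ, he]
  module

/-- The identity minus the strict contraction `s V` is injective, and the subsequent scaling has a
nonzero factor. -/
lemma variationMap_injOn {x₀ : Rd d} {K s : ℝ} (hKs : K * s ^ 2 ≤ 1 / 2) (hsM : |s| * M < 1) :
    InjOn (variationMap V x₀ K s) Ω := by
  intro x hx y hy hxy
  simp only [variationMap, add_right_inj] at hxy
  have h1 := smul_right_injective (Rd d) (by linarith : (1 - K * s ^ 2 : ℝ) ≠ 0) hxy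
  have h2 : x - y = s • (V x - V y) := by
    calc x - y = (x - s • V x - x₀) - (y - s • V y - x₀) + s • (V x - V y) := by module
      _ = s • (V x - V y) := by rw [show x - s • V x - x₀ = y - s • V y - x₀ from h1]; simp
  have h3 : ‖x - y‖ ≤ |s| * M * ‖x - y‖ := by
    conv_lhs => rw [h2, norm_smul, Real.norm_eq_abs]
    rw [mul_assoc]
    exact mul_le_mul_of_nonneg_left (hV.lipschitz hΩ hx hy) (abs_nonneg s)
  have h4 : ‖x - y‖ = 0 := by
    have := norm_nonneg (x - y)
    nlinarith
  exact sub_eq_zero.1 (norm_eq_zero.1 h4)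

lemma hasFDerivAt_fderiv_variationMap (x₀ : Rd d) (K s : ℝ) {y : Rd d} (hy : y ∈ Ω) :
    HasFDerivAt (fderiv ℝ (variationMap V x₀ K s))
      ((1 - K * s ^ 2) • -(s • fderiv ℝ (fderiv ℝ V) y)) y := by
  have h1 : HasFDerivAt (fun y => s • fderiv ℝ V y) (s • fderiv ℝ (fderiv ℝ V) y) y :=
    (hV.hasFDerivAt_fderiv hΩ hy).const_smul s
  have h2 : HasFDerivAt (fun y => (1 : Rd d →L[ℝ] Rd d) - s • fderiv ℝ V y)
      (-(s • fderiv ℝ (fderiv ℝ V) y)) y := h1.const_sub 1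
  have h3 : HasFDerivAt (fun y => (1 - K * s ^ 2) • ((1 : Rd d →L[ℝ] Rd d) - s • fderiv ℝ V y))
      ((1 - K * s ^ 2) • -(s • fderiv ℝ (fderiv ℝ V) y)) y := h2.const_smul (1 - K * s ^ 2)
  refine h3.congr_of_eventuallyEq ?_
  filter_upwards [hΩ.isOpen.mem_nhds hy] with z hz
  exact (hasFDerivAt_variationMap (hV.hasFDerivAt hΩ hz) x₀ K s).fderiv

/-- The estimates on the derivatives of `variationMap`, with constants. -/
lemma variationMap_estimates {x₀ : Rd d} {K s c T a : ℝ} (hK : 0 ≤ K) (hc0 : 0 ≤ c)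
    (hc : ∀ A : Rd d →L[ℝ] Rd d, ‖A - 1‖ ≤ 1 →
      |A.det - 1 - traceL (A - 1)| ≤ c * ‖A - 1‖ ^ 2 ∧
      ‖fderiv ℝ (fun A : Rd d →L[ℝ] Rd d => A.det) A - traceL‖ ≤ c * ‖A - 1‖)
    (hT : ‖(traceL : (Rd d →L[ℝ] Rd d) →L[ℝ] ℝ)‖ ≤ T)
    (ha : a = M + K * (1 + M)) (hs : |s| ≤ 1) (hsa : a * |s| ≤ 1) {y : Rd d} (hy : y ∈ Ω) :
    ‖fderiv ℝ (variationMap V x₀ K s) y - 1 + s • fderiv ℝ V y‖ ≤ K * (1 + M) * s ^ 2 ∧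
    |(fderiv ℝ (variationMap V x₀ K s) y).det - 1 + s * traceL (fderiv ℝ V y)| ≤
      (c * a ^ 2 + T * (K * (1 + M))) * s ^ 2 ∧
    ‖fderiv ℝ (fun y => (fderiv ℝ (variationMap V x₀ K s) y).det) y
      + s • traceL.comp (fderiv ℝ (fderiv ℝ V) y)‖ ≤
      (c * a * M + K * (T + c) * M) * s ^ 2 := by
  have hM := hV.nonneg hΩ
  have ha0 : 0 ≤ a := by rw [ha]; positivity
  have hsq : s ^ 2 = |s| * |s| := by rw [← sq_abs]; ring
  have hs0 := abs_nonneg s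
  have hκ0 : 0 ≤ K * s ^ 2 := by positivity
  have hone : ‖(1 : Rd d →L[ℝ] Rd d)‖ ≤ 1 := ContinuousLinearMap.norm_id_le
  have hder := (hasFDerivAt_variationMap (hV.hasFDerivAt hΩ hy) x₀ K s).fderiv
  have e1 : ‖fderiv ℝ (variationMap V x₀ K s) y - 1 + s • fderiv ℝ V y‖ ≤
      K * (1 + M) * s ^ 2 := by
    rw [hder]
    refine (norm_one_sub_smul_le hone (hV.bound_fderiv y hy) hκ0 hs).trans (le_of_eq ?_)
    ring
  -- A first-order bound suffices here: it enters the expansion of the determinant quadratically,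
  -- and it enters that of its derivative multiplied by a further factor `s`.
  have hB1 : ‖fderiv ℝ (variationMap V x₀ K s) y - 1‖ ≤ a * |s| := by
    have h1 : fderiv ℝ (variationMap V x₀ K s) y - 1 =
        (fderiv ℝ (variationMap V x₀ K s) y - 1 + s • fderiv ℝ V y) - s • fderiv ℝ V y := by abel
    have h2 : ‖s • fderiv ℝ V y‖ ≤ |s| * M := by
      rw [norm_smul, Real.norm_eq_abs]
      exact mul_le_mul_of_nonneg_left (hV.bound_fderiv y hy) hs0
    have h3 : K * (1 + M) * s ^ 2 ≤ K * (1 + M) * |s| := by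
      rw [hsq]; exact mul_le_mul_of_nonneg_left (mul_le_of_le_one_left hs0 hs) (by positivity)
    rw [h1]
    refine (norm_sub_le _ _).trans ((add_le_add (e1.trans h3) h2).trans (le_of_eq ?_))
    rw [ha]; ring
  obtain ⟨hd1, hd2⟩ := hc _ (hB1.trans hsa)
  refine ⟨e1, ?_, ?_⟩
  · have h1 : c * ‖fderiv ℝ (variationMap V x₀ K s) y - 1‖ ^ 2 ≤ c * (a * |s|) ^ 2 :=
      mul_le_mul_of_nonneg_left (pow_le_pow_left₀ (norm_nonneg _) hB1 2) hc0
    refine (abs_sub_one_add_le traceL hT (hd1.trans h1) e1).trans (le_of_eq ?_)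
    rw [mul_pow, sq_abs]; ring
  · have hj := (((contDiff_det (d := d)).differentiable (by simp)
      (fderiv ℝ (variationMap V x₀ K s) y)).hasFDerivAt).comp y
        (hasFDerivAt_fderiv_variationMap hΩ hV x₀ K s hy)
    have hj' := hj.fderiv
    rw [Function.comp_def] at hj'
    rw [hj']
    have hb : c * (a * |s|) ≤ c := mul_le_of_le_one_right hc0 hsa
    refine (norm_comp_add_comp_le _ _ _ (hd2.trans (mul_le_mul_of_nonneg_left hB1 hc0)) hT
      (hV.bound_fderiv_fderiv y hy) hκ0 hs).trans ?_
    have h2 : K * s ^ 2 * ((T + c * (a * |s|)) * M) ≤ K * s ^ 2 * ((T + c) * M) := by gcongr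
    calc _ ≤ |s| * (c * (a * |s|) * M) + K * s ^ 2 * ((T + c) * M) := add_le_add le_rfl h2
      _ = _ := by rw [hsq]; ring

/-- The maps are `variationMap V x₀ K`, around the centre `x₀` of a ball of radius `r` in `Ω`. The
factor `K` is so large that the contraction beats the `M s²` by which the straight step may leave
the closure. -/
lemma IsTestField.exists_isVariation : ∃ (S : ℝ → Rd d → Rd d) (s₀ C : ℝ), 0 < s₀ ∧ 0 ≤ C ∧
    IsVariation Ω V S s₀ C := by
  have hM := hV.nonneg hΩ
  obtain ⟨x₀, hx₀⟩ := hΩ.nonempty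
  obtain ⟨r, hr, hball⟩ := Metric.isOpen_iff.1 hΩ.isOpen x₀ hx₀
  obtain ⟨R, hR⟩ := hΩ.bounded.subset_closedBall x₀
  have hR' : ∀ y ∈ Ω, ‖y - x₀‖ ≤ R := fun y hy => by simpa [dist_eq_norm] using hR hy
  have hR0 : 0 ≤ R := (norm_nonneg _).trans (hR' x₀ hx₀)
  obtain ⟨c, hc0, hc⟩ := exists_det_expansion d
  obtain ⟨T, hT0, hT⟩ : ∃ T : ℝ, 0 ≤ T ∧ ‖(traceL : (Rd d →L[ℝ] Rd d) →L[ℝ] ℝ)‖ ≤ T :=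
    ⟨_, by positivity, le_rfl⟩
  obtain ⟨K, hK0, hKr⟩ : ∃ K : ℝ, 0 < K ∧ M < K * r :=
    ⟨(M + 1) / r, by positivity, by rw [div_mul_cancel₀ _ hr.ne']; linarith⟩
  obtain ⟨a, ha⟩ : ∃ a, a = M + K * (1 + M) := ⟨_, rfl⟩
  have ha0 : 0 ≤ a := by rw [ha]; positivity
  obtain ⟨C₂, hC₂⟩ : ∃ C₂, C₂ = c * a ^ 2 + T * (K * (1 + M)) := ⟨_, rfl⟩
  have hC2 : 0 ≤ C₂ := by rw [hC₂]; positivity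
  have hTM : 0 ≤ T * M := by positivity
  have hden : 0 < 2 * (1 + K + a + M + T * M + C₂) := by positivity
  -- The threshold is the reciprocal of twice the sum of all constants, so that each of their
  -- products with `|s|` is at most `1 / 2`.
  have small : ∀ s, |s| ≤ 1 / (2 * (1 + K + a + M + T * M + C₂)) →
      |s| ≤ 1 / 2 ∧ K * |s| ≤ 1 / 2 ∧ a * |s| ≤ 1 / 2 ∧ |s| * M ≤ 1 / 2 ∧
        |s| * (T * M) + C₂ * |s| ≤ 1 / 2 := by
    intro s hs
    rw [le_div_iff₀ hden] at hs
    have hsa := abs_nonneg s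
    have := mul_nonneg hsa hK0.le
    have := mul_nonneg hsa ha0
    have := mul_nonneg hsa hM
    have := mul_nonneg hsa hTM
    have := mul_nonneg hsa hC2
    refine ⟨?_, ?_, ?_, ?_, ?_⟩ <;> linarith
  have sq_le : ∀ s : ℝ, |s| ≤ 1 / 2 → s ^ 2 ≤ |s| := fun s hs => by
    rw [← sq_abs, sq]; exact mul_le_of_le_one_left (abs_nonneg s) (by linarith)
  have est := fun s (hs : |s| ≤ 1 / (2 * (1 + K + a + M + T * M + C₂))) (y : Rd d) (hy : y ∈ Ω) =>
    variationMap_estimates hΩ hV (x₀ := x₀) hK0.le hc0 hc hT ha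
      ((small s hs).1.trans (by norm_num)) ((small s hs).2.2.1.trans (by norm_num)) hy
  rw [← hC₂] at est
  have hdet : ∀ s, |s| ≤ 1 / (2 * (1 + K + a + M + T * M + C₂)) → ∀ y ∈ Ω,
      1 / 2 ≤ (fderiv ℝ (variationMap V x₀ K s) y).det := by
    intro s hs y hy
    have h3 := abs_le.1 (est s hs y hy).2.1
    have h4 : |traceL (fderiv ℝ V y)| ≤ T * M := (traceL.le_opNorm _).trans
      (mul_le_mul hT (hV.bound_fderiv y hy) (norm_nonneg _) hT0)
    have h5 : |s * traceL (fderiv ℝ V y)| ≤ |s| * (T * M) := by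
      rw [abs_mul]; exact mul_le_mul_of_nonneg_left h4 (abs_nonneg s)
    have h6 := abs_le.1 h5
    have h7 : C₂ * s ^ 2 ≤ C₂ * |s| := mul_le_mul_of_nonneg_left (sq_le s (small s hs).1) hC2
    have h8 := (small s hs).2.2.2.2
    linarith
  obtain ⟨C₃, hC₃⟩ : ∃ C₃, C₃ = c * a * M + K * (T + c) * M := ⟨_, rfl⟩
  rw [← hC₃] at est
  have hC3 : 0 ≤ C₃ := by rw [hC₃]; positivity
  have hC0 : 0 ≤ K * (R + M) := by positivity
  have hC1 : 0 ≤ K * (1 + M) := by positivity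
  have mono : ∀ {c' s : ℝ}, c' ≤ K * (R + M) + K * (1 + M) + C₂ + C₃ →
      c' * s ^ 2 ≤ (K * (R + M) + K * (1 + M) + C₂ + C₃) * s ^ 2 := fun h =>
    mul_le_mul_of_nonneg_right h (sq_nonneg _)
  refine ⟨variationMap V x₀ K, 1 / (2 * (1 + K + a + M + T * M + C₂)),
    K * (R + M) + K * (1 + M) + C₂ + C₃, by positivity, by positivity,
    by rw [div_le_one hden]; linarith, ?_, ?_, ?_, ?_, ?_, ?_⟩
  · intro s hs0 hs
    have h1 := small s hs
    have hκ : K * s ^ 2 ≤ 1 / 2 :=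
      (mul_le_mul_of_nonneg_left (sq_le s h1.1) hK0.le).trans h1.2.1
    refine ⟨hΩ.isOpen, contDiffOn_variationMap hV x₀ K s,
      fun y hy => variationMap_mem hΩ hV hr hball hKr hs0 hκ hy,
      variationMap_injOn hΩ hV hκ (by linarith [h1.2.2.2.1]), fun y hy => ?_⟩
    linarith [hdet s hs y hy]
  · intro s hs0 hs y hy
    exact (norm_sub_variationMap_le hV hR' hK0.le ((small s hs).1.trans (by norm_num)) hy).trans
      (mono (by linarith))
  · intro s hs0 hs y hy
    exact (est s hs y hy).1.trans (mono (by linarith))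
  · intro s hs0 hs y hy
    exact (est s hs y hy).2.1.trans (mono (by linarith))
  · intro s hs0 hs y hy
    exact (est s hs y hy).2.2.trans (mono (by linarith))
  · intro s _ hs y hy
    exact hdet s hs y hy

end

end JKO

/-! ### Volume and mass missed by a variation -/

namespace JKO

open Filter Topology

variable {d : ℕ} {Ω : Set (Rd d)} {V : Rd d → Rd d} {M : ℝ} {S : ℝ → Rd d → Rd d} {s₀ C : ℝ}

lemma IsSmoothConvexDomain.volume_lt_top (hΩ : IsSmoothConvexDomain Ω) : volume Ω < ⊤ :=
  hΩ.bounded.measure_lt_top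

lemma IsTestField.integrableOn_div (hΩ : IsSmoothConvexDomain Ω) (hV : IsTestField Ω V M) :
    IntegrableOn (fun y => traceL (fderiv ℝ V y)) Ω := by
  have hc : ContinuousOn (fun y => traceL (fderiv ℝ V y)) Ω :=
    traceL.continuous.comp_continuousOn (hV.smooth.continuousOn_fderiv_of_isOpen hΩ.isOpen (by simp))
  refine IntegrableOn.of_bound hΩ.volume_lt_top
    (hc.aestronglyMeasurable hΩ.isOpen.measurableSet)
    (‖(traceL : (Rd d →L[ℝ] Rd d) →L[ℝ] ℝ)‖ * M) ?_
  filter_upwards [ae_restrict_mem hΩ.isOpen.measurableSet] with y hy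
  exact (traceL.le_opNorm _).trans
    (mul_le_mul_of_nonneg_left (hV.bound_fderiv y hy) (by positivity))

section

variable (hΩ : IsSmoothConvexDomain Ω) (hV : IsTestField Ω V M) (hS : IsVariation Ω V S s₀ C)
include hΩ hV hS

/-- The volume of the image is the integral of the determinant, which is `1 - s div V + O(s²)`
uniformly. -/
lemma IsVariation.abs_volume_image_sub_le {s : ℝ} (hs0 : s ≠ 0) (hs : |s| ≤ s₀) :
    |volume.real (S s '' Ω) - volume.real Ω + s * ∫ y in Ω, traceL (fderiv ℝ V y)| ≤
      C * s ^ 2 * volume.real Ω := by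
  have hemb := hS.emb s hs0 hs
  have hvol := hΩ.volume_lt_top
  have hθ := hV.integrableOn_div hΩ
  have hj : IntegrableOn (fun y => (fderiv ℝ (S s) y).det * (1 : ℝ)) Ω := by
    have := (hemb.integrableOn_image_iff (fun _ => (1 : ℝ))).1
      (integrableOn_const (measure_mono hemb.mapsTo.image_subset |>.trans_lt hvol).ne)
    exact this
  have h1 : volume.real (S s '' Ω) = ∫ y in Ω, (fderiv ℝ (S s) y).det * (1 : ℝ) := by
    rw [← hemb.integral_image fun _ => (1 : ℝ)]
    simp
  have hone : IntegrableOn (fun _ : Rd d => (1 : ℝ)) Ω := integrableOn_const hvol.ne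
  have h2 : volume.real Ω = ∫ y in Ω, (1 : ℝ) := by simp
  have h3 : volume.real (S s '' Ω) - volume.real Ω + s * ∫ y in Ω, traceL (fderiv ℝ V y) =
      ∫ y in Ω, ((fderiv ℝ (S s) y).det * 1 - 1 + s * traceL (fderiv ℝ V y)) := by
    have hjone : IntegrableOn (fun y => (fderiv ℝ (S s) y).det * (1 : ℝ) - 1) Ω := hj.sub hone
    rw [integral_add hjone (hθ.const_mul s), integral_sub hj hone, integral_const_mul,
      h1, ← h2]
  rw [h3, ← Real.norm_eq_abs]
  refine norm_setIntegral_le_of_norm_le_const hvol fun y hy => ?_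
  rw [mul_one]
  exact hS.disp_det s hs0 hs y hy

/-- The divergence theorem for tangential fields: embeddings do not increase the volume. -/
lemma IsVariation.integral_div_eq_zero (hs₀ : 0 < s₀) : ∫ y in Ω, traceL (fderiv ℝ V y) = 0 := by
  set I := ∫ y in Ω, traceL (fderiv ℝ V y) with hI
  have key : ∀ s, s ≠ 0 → |s| ≤ s₀ → s * I ≤ C * s ^ 2 * volume.real Ω + (volume.real Ω -
      volume.real (S s '' Ω)) ∧ -(s * I) ≤ C * s ^ 2 * volume.real Ω := by
    intro s hs0 hs
    have h1 := abs_le.1 (hS.abs_volume_image_sub_le hΩ hV hs0 hs)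
    have h2 : volume.real (S s '' Ω) ≤ volume.real Ω :=
      measureReal_mono (hS.emb s hs0 hs).mapsTo.image_subset hΩ.volume_lt_top.ne
    constructor <;> linarith
  -- Both `s` and `-s` are used: each sign bounds `I` from one side. This is why variations are
  -- defined for negative parameters too.
  have hle : ∀ s, 0 < s → s ≤ s₀ → |I| ≤ C * volume.real Ω * s := by
    intro s hs hs'
    have h1 := (key s hs.ne' (by rwa [abs_of_pos hs])).2
    have h2 := (key (-s) (by simpa using hs.ne') (by rwa [abs_neg, abs_of_pos hs])).2
    rw [abs_le]
    constructor <;> nlinarith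
  have hlim : Tendsto (fun s : ℝ => C * volume.real Ω * s) (𝓝[>] 0) (𝓝 (C * volume.real Ω * 0)) :=
    ((continuous_const.mul continuous_id).tendsto 0).mono_left nhdsWithin_le_nhds
  rw [mul_zero] at hlim
  have h0 : |I| ≤ 0 := by
    refine ge_of_tendsto hlim ?_
    filter_upwards [Ioc_mem_nhdsGT hs₀] with s hs using hle s hs.1 hs.2
  exact abs_eq_zero.1 (le_antisymm h0 (abs_nonneg _))

/-- The first-order term of the volume is the integral of the divergence, which vanishes, so the
defect is quadratic. -/
lemma IsVariation.volume_sdiff_le (hs₀ : 0 < s₀) {s : ℝ} (hs0 : s ≠ 0) (hs : |s| ≤ s₀) :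
    volume.real (Ω \ S s '' Ω) ≤ C * volume.real Ω * s ^ 2 := by
  have hemb := hS.emb s hs0 hs
  have h1 := abs_le.1 (hS.abs_volume_image_sub_le hΩ hV hs0 hs)
  rw [hS.integral_div_eq_zero hΩ hV hs₀, mul_zero, add_zero] at h1
  rw [measureReal_sdiff hemb.mapsTo.image_subset hemb.measurableSet_image
    hΩ.volume_lt_top.ne]
  linarith

/-- The inverse of the variation moves points with velocity `V`. -/
lemma IsVariation.norm_invFunOn_sub_le (hC : 0 ≤ C) {s : ℝ} (hs0 : s ≠ 0) (hs : |s| ≤ s₀)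
    {y : Rd d} (hy : y ∈ Ω) :
    ‖y - S s y‖ ≤ (C + M) * |s| ∧ ‖y - S s y - s • V (S s y)‖ ≤ (C + M * (C + M)) * s ^ 2 := by
  have hM := hV.nonneg hΩ
  have hsa := abs_nonneg s
  have hsq : s ^ 2 = |s| * |s| := by rw [← sq_abs]; ring
  have h1 := hS.disp s hs0 hs y hy
  have hs1 : |s| ≤ 1 := hs.trans hS.le_one
  have h2 : ‖y - S s y‖ ≤ (C + M) * |s| := by
    have e : y - S s y = (y - S s y - s • V y) + s • V y := by abel
    rw [e]
    refine (norm_add_le _ _).trans ?_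
    rw [norm_smul, Real.norm_eq_abs]
    have h3 := mul_le_mul_of_nonneg_left (hV.bound y hy) hsa
    have h4 : C * s ^ 2 ≤ C * |s| := by
      rw [hsq]; exact mul_le_mul_of_nonneg_left (mul_le_of_le_one_left hsa hs1) hC
    linarith
  refine ⟨h2, ?_⟩
  have e : y - S s y - s • V (S s y) = (y - S s y - s • V y) + s • (V y - V (S s y)) := by
    rw [smul_sub]; abel
  rw [e]
  refine (norm_add_le _ _).trans ?_
  rw [norm_smul, Real.norm_eq_abs]
  have h3 := (hV.lipschitz hΩ hy ((hS.emb s hs0 hs).mapsTo hy)).trans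
    (mul_le_mul_of_nonneg_left h2 hM)
  have h4 := mul_le_mul_of_nonneg_left h3 hsa
  calc _ ≤ C * s ^ 2 + |s| * (M * ((C + M) * |s|)) := add_le_add h1 h4
    _ = _ := by rw [hsq]; ring

/-- Every point of `Ω` is in the range of the variation for small parameters. -/
lemma IsVariation.eventually_mem_image (hs₀ : 0 < s₀) (hC : 0 ≤ C) {x : Rd d} (hx : x ∈ Ω) :
    ∀ᶠ s in 𝓝[>] (0 : ℝ), x ∈ S s '' Ω := by
  have hM := hV.nonneg hΩ
  obtain ⟨ε, hε, hball⟩ := Metric.nhds_basis_closedBall.mem_iff.1 (hΩ.isOpen.mem_nhds hx)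
  have hlim : Tendsto (fun s : ℝ => (C + M) * s) (𝓝[>] 0) (𝓝 ((C + M) * 0)) :=
    ((continuous_const.mul continuous_id).tendsto 0).mono_left nhdsWithin_le_nhds
  rw [mul_zero] at hlim
  filter_upwards [Ioc_mem_nhdsGT hs₀, hlim.eventually (gt_mem_nhds (by norm_num : (0 : ℝ) < 1 / 2)),
    hlim.eventually (gt_mem_nhds (by positivity : 0 < ε / 2))] with s hs h1 h2
  have hs0 : s ≠ 0 := hs.1.ne'
  have habs : |s| = s := abs_of_pos hs.1
  have hs' : |s| ≤ s₀ := by rw [habs]; exact hs.2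
  have hemb := hS.emb s hs0 hs'
  -- For small `s` the map differs from the identity by a map of Lipschitz constant `1 / 2`. It
  -- therefore sends the `ε`-ball at `x` onto a set containing the `ε / 2`-ball at `S s x`, and `x`
  -- itself is that close to `S s x`.
  have happ : ApproximatesLinearOn (S s) (ContinuousLinearMap.id ℝ (Rd d)) Ω (1 / 2) := by
    intro a ha b hb
    refine hΩ.convex.norm_image_sub_le_of_norm_fderiv_le' (𝕜 := ℝ) (f := S s)
      (φ := ContinuousLinearMap.id ℝ (Rd d))
      (fun z hz => (hemb.hasFDerivAt hz).differentiableAt) (fun z hz => ?_) hb ha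
    have e : fderiv ℝ (S s) z - ContinuousLinearMap.id ℝ (Rd d) =
      (fderiv ℝ (S s) z - 1 + s • fderiv ℝ V z) - s • fderiv ℝ V z := by
      rw [add_sub_cancel_right]; rfl
    rw [e]
    refine (norm_sub_le _ _).trans ?_
    rw [norm_smul, Real.norm_eq_abs, habs]
    have h3 := hS.disp_fderiv s hs0 hs' z hz
    have h4 := mul_le_mul_of_nonneg_left (hV.bound_fderiv z hz) hs.1.le
    have h5 : C * s ^ 2 ≤ C * s := by
      rw [sq]
      exact mul_le_mul_of_nonneg_left (mul_le_of_le_one_left hs.1.le (hs.2.trans hS.le_one)) hC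
    have h6 : ((1 / 2 : NNReal) : ℝ) = 1 / 2 := by norm_num
    rw [h6]
    linarith
  let N : (ContinuousLinearMap.id ℝ (Rd d)).NonlinearRightInverse :=
    { toFun := id, nnnorm := 1, bound' := fun y => by simp, right_inv' := fun y => rfl }
  have hsurj := happ.surjOn_closedBall_of_nonlinearRightInverse N hε.le hball
  have hmem : x ∈ Metric.closedBall (S s x) ((((N.nnnorm : ℝ))⁻¹ - (1 / 2 : NNReal)) * ε) := by
    have h3 := (hS.norm_invFunOn_sub_le hΩ hV hC hs0 hs' hx).1
    rw [mem_closedBall_iff_norm]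
    refine h3.trans ?_
    rw [habs]
    have : (((N.nnnorm : ℝ))⁻¹ - (1 / 2 : NNReal)) * ε = ε / 2 := by
      simp only [N]; norm_num; ring
    rw [this]; exact h2.le
  obtain ⟨y, hy, hyx⟩ := hsurj hmem
  exact ⟨y, hball hy, hyx⟩

/-- The mass that a variation misses is of lower order. -/
lemma IsVariation.tendsto_missing_mass (hs₀ : 0 < s₀) (hC : 0 ≤ C) {u : Rd d → ℝ}
    (hu : IntegrableOn u Ω) (hu2 : IntegrableOn (fun x => u x ^ 2) Ω)
    (hu0 : ∀ᵐ x ∂(volume.restrict Ω), 0 ≤ u x) :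
    Tendsto (fun s => (∫ x in Ω \ S s '' Ω, u x) / s) (𝓝[>] (0 : ℝ)) (𝓝 0) := by
  set D := C * volume.real Ω with hD
  have hD0 : 0 ≤ D := by positivity
  have hvol : Tendsto (fun s => (volume.restrict Ω) (Ω \ S s '' Ω)) (𝓝[>] (0 : ℝ)) (𝓝 0) := by
    have h1 : Tendsto (fun s : ℝ => ENNReal.ofReal (D * s ^ 2)) (𝓝[>] 0) (𝓝 0) := by
      have : Tendsto (fun s : ℝ => ENNReal.ofReal (D * s ^ 2)) (𝓝 0)
          (𝓝 (ENNReal.ofReal (D * 0 ^ 2))) :=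
        (ENNReal.continuous_ofReal.comp (continuous_const.mul (continuous_id.pow 2))).tendsto 0
      simp only [ne_eq, OfNat.ofNat_ne_zero, not_false_eq_true, zero_pow, mul_zero,
        ENNReal.ofReal_zero] at this
      exact this.mono_left nhdsWithin_le_nhds
    refine tendsto_of_tendsto_of_tendsto_of_le_of_le' tendsto_const_nhds h1
      (Eventually.of_forall fun _ => zero_le) ?_
    filter_upwards [Ioc_mem_nhdsGT hs₀] with s hs
    have h2 := hS.volume_sdiff_le hΩ hV hs₀ hs.1.ne' (by rw [abs_of_pos hs.1]; exact hs.2)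
    have hfin : volume (Ω \ S s '' Ω) ≠ ⊤ :=
      ((measure_mono sdiff_subset).trans_lt hΩ.volume_lt_top).ne
    refine (Measure.restrict_apply_le _ _).trans ?_
    rw [← ENNReal.ofReal_toReal hfin]
    exact ENNReal.ofReal_le_ofReal h2
  have hsq : Tendsto (fun s => ∫ x in Ω \ S s '' Ω, u x ^ 2 ∂(volume.restrict Ω)) (𝓝[>] (0 : ℝ))
      (𝓝 0) := hu2.tendsto_setIntegral_nhds_zero hvol
  rw [Metric.tendsto_nhds]
  intro ε hε
  -- The Young weight: with `u ≤ s/(2a) u² + a/(2s)` and missing volume at most `D s²`, the constant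
  -- part contributes at most `s a D / 2 < s ε / 4`. The quadratic part is at most `s ε / 2` once
  -- the integral of `u²` over the missing set is below `a ε`.
  set a := ε / (2 * (D + 1)) with ha
  have ha0 : 0 < a := by positivity
  have haD : a * D < ε / 2 := by
    rw [ha, div_mul_eq_mul_div, div_lt_div_iff₀ (by positivity) (by norm_num)]
    nlinarith
  filter_upwards [Ioc_mem_nhdsGT hs₀, hsq.eventually (gt_mem_nhds (by positivity : 0 < a * ε))]
    with s hs hsmall
  have hs0 : 0 < s := hs.1
  have hs' : |s| ≤ s₀ := by rw [abs_of_pos hs0]; exact hs.2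
  have hemb := hS.emb s hs0.ne' hs'
  have hmeas : MeasurableSet (Ω \ S s '' Ω) :=
    hΩ.isOpen.measurableSet.diff hemb.measurableSet_image
  rw [Measure.restrict_restrict hmeas, inter_eq_left.2 sdiff_subset] at hsmall
  have hv := hS.volume_sdiff_le hΩ hV hs₀ hs0.ne' hs'
  rw [← hD] at hv
  have hsub : Ω \ S s '' Ω ⊆ Ω := sdiff_subset
  have hu0' : ∀ᵐ x ∂(volume.restrict (Ω \ S s '' Ω)), 0 ≤ u x :=
    ae_mono (Measure.restrict_mono hsub le_rfl) hu0
  have hnn : 0 ≤ ∫ x in Ω \ S s '' Ω, u x := integral_nonneg_of_ae hu0'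
  have hfin : volume (Ω \ S s '' Ω) ≠ ⊤ :=
    ((measure_mono hsub).trans_lt hΩ.volume_lt_top).ne
  have hle : ∫ x in Ω \ S s '' Ω, u x ≤
      ∫ x in Ω \ S s '' Ω, (s / (2 * a) * u x ^ 2 + a / (2 * s)) := by
    refine integral_mono (hu.mono_set hsub)
      (((hu2.mono_set hsub).const_mul _).add (integrableOn_const hfin)) fun x => ?_
    have h3 : 0 ≤ (s * u x - a) ^ 2 / (2 * a * s) := by positivity
    have h4 : (s * u x - a) ^ 2 / (2 * a * s) = s / (2 * a) * u x ^ 2 + a / (2 * s) - u x := by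
      field_simp; ring
    simp only
    linarith
  rw [integral_add ((hu2.mono_set hsub).const_mul _) (integrableOn_const hfin),
    integral_const_mul, setIntegral_const, smul_eq_mul] at hle
  rw [dist_zero_right, Real.norm_of_nonneg (div_nonneg hnn hs0.le), div_lt_iff₀ hs0]
  have h5 : s / (2 * a) * ∫ x in Ω \ S s '' Ω, u x ^ 2 ≤ s / (2 * a) * (a * ε) :=
    mul_le_mul_of_nonneg_left hsmall.le (by positivity)
  have h6 : volume.real (Ω \ S s '' Ω) * (a / (2 * s)) ≤ D * s ^ 2 * (a / (2 * s)) :=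
    mul_le_mul_of_nonneg_right hv (by positivity)
  have h7 : s / (2 * a) * (a * ε) = s * ε / 2 := by field_simp
  have h8 : D * s ^ 2 * (a / (2 * s)) = s * (a * D) / 2 := by field_simp
  nlinarith

end

end JKO

namespace JKO

open Filter Topology

variable {d : ℕ} {Ω : Set (Rd d)}

/-! ### Weak gradients and the energy -/

/-- The fundamental lemma of the calculus of variations, applied to the difference; the
vector-valued integral is tested against each direction `v`. -/
lemma IsWeakGrad.ae_eq {u : Rd d → ℝ} {g g' : Rd d → Rd d} (hΩ : IsOpen Ω) (h : IsWeakGrad Ω u g)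
    (h' : IsWeakGrad Ω u g') : g =ᵐ[volume.restrict Ω] g' := by
  have key : ∀ᵐ x ∂volume, x ∈ Ω → g x - g' x = 0 := by
    refine hΩ.ae_eq_zero_of_integral_contDiff_smul_eq_zero (h.locInt.sub h'.locInt) ?_
    intro ψ hψ hψc hψΩ
    have h_int : ∀ {f : Rd d → Rd d}, LocallyIntegrableOn f Ω →
        IntegrableOn (fun x => ψ x • f x) Ω := by
      intro f hf
      have hK : IntegrableOn f (tsupport ψ) := hf.integrableOn_compact_subset hψΩ hψc
      have h1 : IntegrableOn (fun x => ψ x • f x) (tsupport ψ) :=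
        hK.continuousOn_smul hψ.continuous.continuousOn hψc
      refine IntegrableOn.of_forall_sdiff_eq_zero h1 hΩ.measurableSet fun x hx => ?_
      rw [image_eq_zero_of_notMem_tsupport hx.2, zero_smul]
    have h1 := h_int h.locInt
    have h2 := h_int h'.locInt
    have hΩint : ∫ x, ψ x • (g x - g' x) = ∫ x in Ω, ψ x • (g x - g' x) := by
      rw [setIntegral_eq_integral_of_forall_compl_eq_zero]
      intro x hx
      rw [image_eq_zero_of_notMem_tsupport fun h => hx (hψΩ h), zero_smul]
    rw [hΩint]
    simp_rw [smul_sub]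
    rw [integral_sub h1 h2, sub_eq_zero]
    refine ext_inner_left ℝ fun v => ?_
    rw [← integral_inner h1, ← integral_inner h2]
    have e1 := h.weak ψ hψ hψc hψΩ v
    have e2 := h'.weak ψ hψ hψc hψΩ v
    rw [e1, neg_inj] at e2
    simp_rw [real_inner_smul_right, real_inner_comm _ v, mul_comm (ψ _)]
    exact e2
  rw [EventuallyEq, ae_restrict_iff' hΩ.measurableSet]
  filter_upwards [key] with x hx hxΩ using sub_eq_zero.1 (hx hxΩ)

lemma IsWeakGrad.congr {u u' : Rd d → ℝ} {g : Rd d → Rd d} (h : IsWeakGrad Ω u g)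
    (hu : u =ᵐ[volume.restrict Ω] u') : IsWeakGrad Ω u' g := by
  refine ⟨h.locInt, fun ψ hψ hψc hψΩ v => ?_⟩
  rw [← h.weak ψ hψ hψc hψΩ v]
  refine integral_congr_ae ?_
  filter_upwards [hu] with x hx
  rw [hx]

lemma MemH1.isWeakGrad {u : Rd d → ℝ} (h : MemH1 Ω u) : IsWeakGrad Ω u (weakGrad Ω u) := by
  obtain ⟨_, g, hg, _⟩ := h
  have hex : ∃ g, IsWeakGrad Ω u g := ⟨g, hg⟩
  rw [weakGrad, dif_pos hex]
  exact hex.choose_spec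

lemma MemH1.memLp_weakGrad {u : Rd d → ℝ} (hΩ : IsOpen Ω) (h : MemH1 Ω u) :
    MemLp (weakGrad Ω u) 2 (volume.restrict Ω) := by
  obtain ⟨_, g, hg, hg2⟩ := id h
  exact hg2.ae_eq (hg.ae_eq hΩ h.isWeakGrad)

lemma MemH1.congr {u u' : Rd d → ℝ} (h : MemH1 Ω u) (hu : u =ᵐ[volume.restrict Ω] u') :
    MemH1 Ω u' := by
  obtain ⟨h2, g, hg, hg2⟩ := h
  exact ⟨h2.ae_eq hu, g, hg.congr hu, hg2⟩

lemma IsProbDensity.ae_eq_of_densityMeasure_eq {u u' : Rd d → ℝ} (hu : IsProbDensity Ω u)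
    (hu' : IsProbDensity Ω u') (h : densityMeasure Ω u = densityMeasure Ω u') :
    u =ᵐ[volume.restrict Ω] u' := by
  have h1 := (withDensity_eq_iff hu.aemeasurable.ennreal_ofReal hu'.aemeasurable.ennreal_ofReal
    (by rw [hu.mass]; exact ENNReal.one_ne_top)).1 h
  filter_upwards [h1, hu.nonneg, hu'.nonneg] with x hx h2 h3
  exact (ENNReal.ofReal_eq_ofReal_iff h2 h3).1 hx

lemma energy_densityMeasure (hΩ : IsOpen Ω) (F : Rd d × ℝ × Rd d → ℝ) {u : Rd d → ℝ}
    (hu : IsProbDensity Ω u) (hH : MemH1 Ω u) :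
    energy Ω F (densityMeasure Ω u) =
      ∫⁻ x in Ω, ENNReal.ofReal (F (x, u x, weakGrad Ω u x)) := by
  refine le_antisymm (iInf₂_le u ⟨hu, hH, rfl⟩) (le_iInf₂ fun w hw => ?_)
  obtain ⟨hw1, hw2, hw3⟩ := hw
  have he := hu.ae_eq_of_densityMeasure_eq hw1 hw3
  have hg := (hH.isWeakGrad.congr he).ae_eq hΩ hw2.isWeakGrad
  refine (lintegral_congr_ae ?_).le
  filter_upwards [he, hg] with x h1 h2
  rw [h1, h2]

/-- An infimum over no densities is `⊤`, so finite energy supplies an `H¹` density of the same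
measure, which agrees with `u` almost everywhere. -/
lemma memH1_of_energy_ne_top {F : Rd d × ℝ × Rd d → ℝ} {u : Rd d → ℝ} (hu : IsProbDensity Ω u)
    (h : energy Ω F (densityMeasure Ω u) ≠ ⊤) : MemH1 Ω u := by
  have h1 := lt_top_iff_ne_top.2 h
  simp only [energy, iInf_lt_iff] at h1
  obtain ⟨w, ⟨hw1, hw2, hw3⟩, _⟩ := h1
  exact hw2.congr (hu.ae_eq_of_densityMeasure_eq hw1 hw3).symm

lemma IsProbDensity.isProbOn (hΩ : MeasurableSet Ω) {u : Rd d → ℝ} (hu : IsProbDensity Ω u) :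
    IsProbOn Ω (densityMeasure Ω u) := by
  refine ⟨⟨?_⟩, ?_⟩
  · rw [densityMeasure, withDensity_apply _ .univ, Measure.restrict_univ, hu.mass]
  · rw [densityMeasure, withDensity_apply _ hΩ.compl, Measure.restrict_restrict hΩ.compl]
    simp

lemma IsProbDensity.integrableOn {u : Rd d → ℝ} (hu : IsProbDensity Ω u) : IntegrableOn u Ω := by
  refine ⟨hu.aemeasurable.aestronglyMeasurable, ?_⟩
  rw [hasFiniteIntegral_iff_ofReal hu.nonneg, hu.mass]
  exact ENNReal.one_lt_top

lemma IsProbDensity.integral_densityMeasure {u : Rd d → ℝ} (hu : IsProbDensity Ω u)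
    (f : Rd d → ℝ) : ∫ x, f x ∂(densityMeasure Ω u) = ∫ x in Ω, u x * f x := by
  rw [densityMeasure, integral_withDensity_eq_integral_toReal_smul₀ hu.aemeasurable.ennreal_ofReal
    (.of_forall fun _ => ENNReal.ofReal_lt_top)]
  refine integral_congr_ae ?_
  filter_upwards [hu.nonneg] with x hx
  rw [ENNReal.toReal_ofReal hx, smul_eq_mul]

/-! ### The Lagrangian -/

lemma convex_phaseSet (hΩ : Convex ℝ Ω) : Convex ℝ (phaseSet Ω) :=
  hΩ.closure.prod ((convex_Ici 0).prod convex_univ)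

lemma measurableSet_phaseSet : MeasurableSet (phaseSet Ω) :=
  isClosed_closure.measurableSet.prod (measurableSet_Ici.prod .univ)

lemma DF_apply (F : Rd d × ℝ × Rd d → ℝ) (y : Rd d × ℝ × Rd d) (ξ : Rd d) (ζ : ℝ) (π : Rd d) :
    DF Ω F y (ξ, ζ, π) = Fx Ω F y ξ + ζ * Fz Ω F y + Fp Ω F y π := by
  have : (ξ, ζ, π) = ContinuousLinearMap.inl ℝ (Rd d) (ℝ × Rd d) ξ + ζ • ((0 : Rd d), (1 : ℝ), (0 : Rd d)) +
      ContinuousLinearMap.inr ℝ (Rd d) (ℝ × Rd d) (ContinuousLinearMap.inr ℝ ℝ (Rd d) π) := by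
    simp
  rw [this, map_add, map_add, map_smul]
  rfl

lemma LagrangianAssumption.hasFDerivWithinAt {F : Rd d × ℝ × Rd d → ℝ}
    (hF : LagrangianAssumption Ω F) {y : Rd d × ℝ × Rd d} (hy : y ∈ phaseSet Ω) :
    HasFDerivWithinAt F (DF Ω F y) (phaseSet Ω) y :=
  (hF.contDiff.differentiableOn (by simp) y hy).hasFDerivWithinAt

/-- The variation of the Lagrangian under small relative changes of its arguments. -/
lemma LagrangianAssumption.exists_abs_sub_le (hΩ : Convex ℝ Ω) {F : Rd d × ℝ × Rd d → ℝ}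
    (hF : LagrangianAssumption Ω F) {k : ℝ} (hk : 0 ≤ k) :
    ∃ c : ℝ, 0 ≤ c ∧ ∀ s, 0 ≤ s → k * s ≤ 1 / 2 → ∀ x ∈ closure Ω, ∀ x' ∈ closure Ω,
      ∀ z z' : ℝ, 0 ≤ z → 0 ≤ z' → ∀ p p' : Rd d, ‖x' - x‖ ≤ k * s → |z' - z| ≤ k * s * z →
      ‖p' - p‖ ≤ k * s * (‖p‖ + z) →
      |F (x', z', p') - F (x, z, p)| ≤ c * s * (1 + ‖p‖ ^ 2 + z ^ 2) := by
  obtain ⟨D, hD, hb⟩ := hF.deriv_bounds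
  -- With `Q` the growth bound at the intermediate point, the derivatives in `x`, `z`, `p`
  -- contribute `Q`, `2 Q` and `Q + 2 q`; and `Q ≤ 8 D q`.
  refine ⟨k * (32 * D + 2), by positivity, ?_⟩
  intro s hs hks x hx x' hx' z z' hz hz' p p' hxx hzz hpp
  obtain ⟨Y, hY, hmvt⟩ := domain_mvt (f := F) (f' := DF Ω F) (s := phaseSet Ω)
    (fun y hy => hF.hasFDerivWithinAt hy) (convex_phaseSet hΩ) (x := (x, z, p)) (y := (x', z', p'))
    ⟨hx, hz, trivial⟩ ⟨hx', hz', trivial⟩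
  have hks0 : 0 ≤ k * s := by positivity
  have hYmem : Y ∈ phaseSet Ω := (convex_phaseSet hΩ).segment_subset (x := (x, z, p))
    (y := (x', z', p')) ⟨hx, hz, trivial⟩ ⟨hx', hz', trivial⟩ hY
  obtain ⟨ξ, ζ, π⟩ := Y
  obtain ⟨a, b, ha, hb', hab, hYe⟩ := hY
  simp only [Prod.smul_mk, Prod.mk_add_mk, Prod.mk.injEq, smul_eq_mul] at hYe
  obtain ⟨_, hζ, hπ⟩ := hYe
  have hb1 : b ≤ 1 := by linarith
  have ha' : a = 1 - b := by linarith
  -- Only `z |F_z|` is bounded, not `F_z`. The relative smallness of `z' - z` keeps the intermediate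
  -- `ζ` above `z / 2`, so that `z |F_z| ≤ 2 ζ |F_z|`.
  have hζ2 : z ≤ 2 * ζ := by
    have h1 := (abs_le.1 hzz).1
    have h2 : ζ = z + b * (z' - z) := by rw [← hζ, ha']; ring
    have h3 : k * s * z ≤ 1 / 2 * z := mul_le_mul_of_nonneg_right hks hz
    have h4 : -(1 / 2 * z) ≤ z' - z := by linarith
    have h5 : b * (-(1 / 2 * z)) ≤ b * (z' - z) := mul_le_mul_of_nonneg_left h4 hb'
    have h6 : b * (1 / 2 * z) ≤ 1 * (1 / 2 * z) :=
      mul_le_mul_of_nonneg_right hb1 (by positivity)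
    linarith
  have hπ2 : ‖π‖ ≤ 2 * (‖p‖ + z) := by
    have h2 : π = p + b • (p' - p) := by rw [← hπ, ha']; module
    have h3 : ‖b • (p' - p)‖ ≤ 1 * (1 / 2 * (‖p‖ + z)) := by
      rw [norm_smul, Real.norm_of_nonneg hb']
      refine mul_le_mul hb1 (hpp.trans ?_) (norm_nonneg _) zero_le_one
      exact mul_le_mul_of_nonneg_right hks (by positivity)
    rw [h2]
    refine (norm_add_le _ _).trans ?_
    have := norm_nonneg p
    linarith
  obtain ⟨hx1, -, hz1, hp1⟩ := hb ξ hYmem.1 ζ hYmem.2.1 π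
  set Q := D * (‖π‖ ^ 2 + 1) with hQ
  set q := 1 + ‖p‖ ^ 2 + z ^ 2 with hq
  have hQ0 : 0 ≤ Q := by positivity
  have hp0 := norm_nonneg p
  have hpz : (‖p‖ + z) ^ 2 ≤ 2 * q := by rw [hq]; nlinarith [sq_nonneg (‖p‖ - z)]
  have hQq : Q ≤ 8 * D * q := by
    have h1 : ‖π‖ ^ 2 ≤ 8 * (‖p‖ ^ 2 + z ^ 2) := by
      have := pow_le_pow_left₀ (norm_nonneg _) hπ2 2
      nlinarith [sq_nonneg (‖p‖ - z)]
    rw [hQ, hq]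
    nlinarith [sq_nonneg ‖p‖, sq_nonneg z]
  have t1 : |Fx Ω F (ξ, ζ, π) (x' - x)| ≤ Q * (k * s) :=
    ((Fx Ω F (ξ, ζ, π)).le_opNorm _).trans (mul_le_mul hx1 hxx (norm_nonneg _) hQ0)
  have t2 : |(z' - z) * Fz Ω F (ξ, ζ, π)| ≤ k * s * (2 * Q) := by
    rw [abs_mul]
    calc |z' - z| * |Fz Ω F (ξ, ζ, π)| ≤ k * s * z * |Fz Ω F (ξ, ζ, π)| :=
          mul_le_mul_of_nonneg_right hzz (abs_nonneg _)
      _ ≤ k * s * (2 * ζ) * |Fz Ω F (ξ, ζ, π)| := by gcongr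
      _ = k * s * (2 * (ζ * |Fz Ω F (ξ, ζ, π)|)) := by ring
      _ ≤ k * s * (2 * Q) := by gcongr
  have t3 : |Fp Ω F (ξ, ζ, π) (p' - p)| ≤ k * s * (Q + 2 * q) := by
    calc |Fp Ω F (ξ, ζ, π) (p' - p)| ≤ ‖Fp Ω F (ξ, ζ, π)‖ * (k * s * (‖p‖ + z)) :=
          ((Fp Ω F (ξ, ζ, π)).le_opNorm _).trans (mul_le_mul_of_nonneg_left hpp (norm_nonneg _))
      _ = k * s * (‖Fp Ω F (ξ, ζ, π)‖ * (‖p‖ + z)) := by ring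
      _ ≤ k * s * (Q + 2 * q) := by
          refine mul_le_mul_of_nonneg_left ?_ hks0
          nlinarith [sq_nonneg (‖Fp Ω F (ξ, ζ, π)‖ - (‖p‖ + z)), sq_nonneg ‖Fp Ω F (ξ, ζ, π)‖,
            sq_nonneg (‖p‖ + z)]
  have hsub : ((x', z', p') : Rd d × ℝ × Rd d) - (x, z, p) = (x' - x, z' - z, p' - p) := rfl
  rw [hmvt, hsub, DF_apply]
  have h := (abs_add_le (Fx Ω F (ξ, ζ, π) (x' - x) + (z' - z) * Fz Ω F (ξ, ζ, π))
    (Fp Ω F (ξ, ζ, π) (p' - p))).trans (add_le_add (abs_add_le _ _) le_rfl)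
  refine h.trans ?_
  have : k * s * (4 * Q + 2 * q) ≤ k * s * (4 * (8 * D * q) + 2 * q) := by gcongr
  calc _ ≤ k * s * (4 * Q + 2 * q) := by linarith
    _ ≤ k * s * (4 * (8 * D * q) + 2 * q) := this
    _ = _ := by ring

/-- The Lagrangian is arbitrary outside `phaseSet Ω`. The law of `f` is concentrated on that set,
where continuity gives measurability. -/
lemma aestronglyMeasurable_comp_of_continuousOn_phaseSet {G : Type*} [TopologicalSpace G]
    [TopologicalSpace.PseudoMetrizableSpace G] [SecondCountableTopology G]
    {H : Rd d × ℝ × Rd d → G} (hH : ContinuousOn H (phaseSet Ω))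
    {α : Type*} [MeasurableSpace α] {μ : Measure α} {f : α → Rd d × ℝ × Rd d}
    (hf : AEMeasurable f μ) (hmem : ∀ᵐ a ∂μ, f a ∈ phaseSet Ω) :
    AEStronglyMeasurable (fun a => H (f a)) μ := by
  have h1 : AEStronglyMeasurable H ((μ.map f).restrict (phaseSet Ω)) :=
    hH.aestronglyMeasurable measurableSet_phaseSet
  have h2 : (μ.map f).restrict (phaseSet Ω) = μ.map f :=
    Measure.restrict_eq_self_of_ae_mem ((ae_map_iff hf measurableSet_phaseSet).2 hmem)
  rw [h2] at h1
  exact h1.comp_aemeasurable hf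

/-- The Lagrangian along a density in `H¹` is integrable. -/
lemma LagrangianAssumption.integrableOn {F : Rd d × ℝ × Rd d → ℝ} (hΩ : IsSmoothConvexDomain Ω)
    (hF : LagrangianAssumption Ω F) {u : Rd d → ℝ} {g : Rd d → Rd d}
    (hu : AEMeasurable u (volume.restrict Ω)) (hu0 : ∀ᵐ x ∂(volume.restrict Ω), 0 ≤ u x)
    (hg : MemLp g 2 (volume.restrict Ω)) :
    IntegrableOn (fun x => F (x, u x, g x)) Ω ∧
      ∀ᵐ x ∂(volume.restrict Ω), 0 ≤ F (x, u x, g x) := by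
  obtain ⟨c, C, hc, hcC, hb⟩ := hF.bounds
  have hmem : ∀ᵐ x ∂(volume.restrict Ω), x ∈ Ω := ae_restrict_mem hΩ.isOpen.measurableSet
  have : IsFiniteMeasure (volume.restrict Ω) := ⟨by simpa using hΩ.volume_lt_top⟩
  have hnn : ∀ᵐ x ∂(volume.restrict Ω), 0 ≤ F (x, u x, g x) := by
    filter_upwards [hmem, hu0] with x hx h0
    exact le_trans (by positivity) (hb x (subset_closure hx) _ h0 (g x)).1
  refine ⟨?_, hnn⟩
  have hbd : Integrable (fun x => C * (‖g x‖ ^ 2 + 1)) (volume.restrict Ω) :=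
    ((hg.integrable_norm_pow (by norm_num)).add (integrable_const 1)).const_mul C
  refine Integrable.mono' hbd ?_ ?_
  · refine aestronglyMeasurable_comp_of_continuousOn_phaseSet hF.contDiff.continuousOn
      (aemeasurable_id.prodMk (hu.prodMk hg.aestronglyMeasurable.aemeasurable)) ?_
    filter_upwards [hmem, hu0] with x hx h0
    exact ⟨subset_closure hx, h0, trivial⟩
  · filter_upwards [hmem, hu0, hnn] with x hx h0 h1
    rw [Real.norm_of_nonneg h1]
    exact (hb x (subset_closure hx) _ h0 (g x)).2

lemma energy_eq_ofReal_integral {F : Rd d × ℝ × Rd d → ℝ} (hΩ : IsSmoothConvexDomain Ω)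
    (hF : LagrangianAssumption Ω F) {u : Rd d → ℝ} (hu : IsProbDensity Ω u) (hH : MemH1 Ω u) :
    energy Ω F (densityMeasure Ω u) =
      ENNReal.ofReal (∫ x in Ω, F (x, u x, weakGrad Ω u x)) := by
  obtain ⟨h1, h2⟩ := hF.integrableOn hΩ hu.aemeasurable hu.nonneg (hH.memLp_weakGrad hΩ.isOpen)
  rw [energy_densityMeasure hΩ.isOpen F hu hH, ofReal_integral_eq_lintegral_ofReal h1 h2]

end JKO

namespace JKO

open Filter Topology

variable {d : ℕ} {Ω : Set (Rd d)} {S : Rd d → Rd d}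

/-! ### Competitors -/

/-- The multiple by `l` of the density that `S` maps to `u`. -/
noncomputable def pullDensity (S : Rd d → Rd d) (u : Rd d → ℝ) (l : ℝ) (y : Rd d) : ℝ :=
  l * (u (S y) * (fderiv ℝ S y).det)

/-- The weak gradient of `pullDensity S u l`, if `g` is the weak gradient of `u`. -/
noncomputable def pullGrad (S : Rd d → Rd d) (u : Rd d → ℝ) (g : Rd d → Rd d) (l : ℝ) (y : Rd d) :
    Rd d :=
  l • ((fderiv ℝ S y).det • (fderiv ℝ S y).adjoint (g (S y)) +
    u (S y) • ∇ (fun y => (fderiv ℝ S y).det) y)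

namespace IsSmoothEmbedding

variable (hS : IsSmoothEmbedding Ω S)
include hS

/-- Since `f` is only almost everywhere measurable, composition needs an argument: the change of
variables makes `det DS · (f ∘ S)` measurable, and the continuous positive determinant is divided
out. -/
lemma aestronglyMeasurable_comp {G : Type*} [NormedAddCommGroup G] [NormedSpace ℝ G]
    {f : Rd d → G} (hf : IntegrableOn f Ω) :
    AEStronglyMeasurable (fun y => f (S y)) (volume.restrict Ω) := by
  have h1 := ((hS.integrableOn_image_iff f).1
    (hf.mono_set hS.mapsTo.image_subset)).aestronglyMeasurable
  have h2 : AEStronglyMeasurable (fun y => ((fderiv ℝ S y).det)⁻¹) (volume.restrict Ω) :=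
    (hS.contDiff_det_fderiv.continuousOn.inv₀ fun y hy => (hS.det_pos y hy).ne').aestronglyMeasurable
      hS.isOpen.measurableSet
  refine (h2.smul h1).congr ?_
  filter_upwards [ae_restrict_mem hS.isOpen.measurableSet] with y hy
  simp only [Pi.smul_apply', smul_smul]
  rw [inv_mul_cancel₀ (hS.det_pos y hy).ne', one_smul]

/-- Composition with an embedding preserves `L²`. -/
lemma memLp_comp {G : Type*} [NormedAddCommGroup G] [NormedSpace ℝ G] (hvol : volume Ω < ⊤)
    {a : ℝ} (ha : 0 < a) (hdet : ∀ y ∈ Ω, a ≤ (fderiv ℝ S y).det)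
    {f : Rd d → G} (hf : MemLp f 2 (volume.restrict Ω)) :
    MemLp (fun y => f (S y)) 2 (volume.restrict Ω) := by
  have : IsFiniteMeasure (volume.restrict Ω) := ⟨by simpa using hvol⟩
  have hm := hS.aestronglyMeasurable_comp (hf.integrable (by norm_num))
  rw [memLp_two_iff_integrable_sq_norm hm]
  have h1 : IntegrableOn (fun x => ‖f x‖ ^ 2) Ω := hf.integrable_norm_pow (by norm_num)
  have h2 := (hS.integrableOn_image_iff _).1 (h1.mono_set hS.mapsTo.image_subset)
  refine Integrable.mono' (h2.const_mul a⁻¹) (hm.norm.pow 2) ?_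
  filter_upwards [ae_restrict_mem hS.isOpen.measurableSet] with y hy
  rw [Real.norm_of_nonneg (by positivity), smul_eq_mul, ← mul_assoc]
  refine le_mul_of_one_le_left (by positivity) ?_
  rw [inv_mul_eq_div, one_le_div ha]
  exact hdet y hy

lemma continuousOn_fderiv : ContinuousOn (fderiv ℝ S) Ω :=
  hS.smooth.continuousOn_fderiv_of_isOpen hS.isOpen (by simp)

lemma continuousOn_gradient_det : ContinuousOn (∇ fun y => (fderiv ℝ S y).det) Ω :=
  dualIso.continuous.comp_continuousOn
    (hS.contDiff_det_fderiv.continuousOn_fderiv_of_isOpen hS.isOpen (by simp))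

lemma memLp_pull (hvol : volume Ω < ⊤) {a J : ℝ} (ha : 0 < a)
    (hdet : ∀ y ∈ Ω, a ≤ (fderiv ℝ S y).det) (hdet' : ∀ y ∈ Ω, (fderiv ℝ S y).det ≤ J)
    (hDS : ∀ y ∈ Ω, ‖fderiv ℝ S y‖ ≤ J)
    (hgrad : ∀ y ∈ Ω, ‖∇ (fun y => (fderiv ℝ S y).det) y‖ ≤ J) {u : Rd d → ℝ} {g : Rd d → Rd d}
    (hu : MemLp u 2 (volume.restrict Ω)) (hg : MemLp g 2 (volume.restrict Ω)) (l : ℝ) :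
    MemLp (pullDensity S u l) 2 (volume.restrict Ω) ∧
      MemLp (pullGrad S u g l) 2 (volume.restrict Ω) := by
  have hΩm := hS.isOpen.measurableSet
  have huS := hS.memLp_comp hvol ha hdet hu
  have hgS := hS.memLp_comp hvol ha hdet hg
  have hjm : AEStronglyMeasurable (fun y => (fderiv ℝ S y).det) (volume.restrict Ω) :=
    hS.contDiff_det_fderiv.continuousOn.aestronglyMeasurable hΩm
  have hkm : AEStronglyMeasurable (∇ fun y => (fderiv ℝ S y).det) (volume.restrict Ω) :=
    hS.continuousOn_gradient_det.aestronglyMeasurable hΩm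
  have hAm : AEStronglyMeasurable (fun y => (fderiv ℝ S y).adjoint) (volume.restrict Ω) :=
    ((ContinuousLinearMap.adjoint (𝕜 := ℝ) (E := Rd d) (F := Rd d)).continuous.comp_continuousOn
      hS.continuousOn_fderiv).aestronglyMeasurable hΩm
  have hmem := ae_restrict_mem (μ := volume) hΩm
  have hjabs : ∀ y ∈ Ω, ‖(fderiv ℝ S y).det‖ ≤ J := fun y hy => by
    rw [Real.norm_of_nonneg (hS.det_pos y hy).le]; exact hdet' y hy
  constructor
  · have h1 : MemLp (fun y => u (S y) * (fderiv ℝ S y).det) 2 (volume.restrict Ω) := by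
      refine MemLp.of_le_mul (c := J) huS (huS.aestronglyMeasurable.mul hjm) ?_
      filter_upwards [hmem] with y hy
      rw [norm_mul, mul_comm]
      exact mul_le_mul_of_nonneg_right (hjabs y hy) (norm_nonneg _)
    exact h1.const_mul l
  · have h1 : MemLp (fun y => (fderiv ℝ S y).det • (fderiv ℝ S y).adjoint (g (S y))) 2
        (volume.restrict Ω) := by
      refine MemLp.of_le_mul (c := J * J) hgS (hjm.smul ?_) ?_
      · exact ContinuousLinearMap.aestronglyMeasurable_comp₂
          (ContinuousLinearMap.id ℝ (Rd d →L[ℝ] Rd d)) hAm hgS.aestronglyMeasurable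
      · filter_upwards [hmem] with y hy
        rw [norm_smul, mul_assoc]
        have hJ : 0 ≤ J := (norm_nonneg _).trans (hDS y hy)
        refine mul_le_mul (hjabs y hy) ?_ (norm_nonneg _) hJ
        refine ((ContinuousLinearMap.adjoint (fderiv ℝ S y)).le_opNorm _).trans ?_
        rw [LinearIsometryEquiv.norm_map]
        exact mul_le_mul_of_nonneg_right (hDS y hy) (norm_nonneg _)
    have h2 : MemLp (fun y => u (S y) • ∇ (fun y => (fderiv ℝ S y).det) y) 2
        (volume.restrict Ω) := by
      refine MemLp.of_le_mul (c := J) huS (huS.aestronglyMeasurable.smul hkm) ?_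
      filter_upwards [hmem] with y hy
      rw [norm_smul, mul_comm]
      exact mul_le_mul_of_nonneg_right (hgrad y hy) (norm_nonneg _)
    exact (h1.add h2).const_smul l

lemma isWeakGrad_pull (hvol : volume Ω < ⊤) {u : Rd d → ℝ} {g : Rd d → Rd d}
    (hu : MemLp u 2 (volume.restrict Ω)) (hg : MemLp g 2 (volume.restrict Ω))
    (h : IsWeakGrad Ω u g) {l : ℝ} (hpull : MemLp (pullGrad S u g l) 2 (volume.restrict Ω)) :
    IsWeakGrad Ω (pullDensity S u l) (pullGrad S u g l) := by
  have : IsFiniteMeasure (volume.restrict Ω) := ⟨by simpa using hvol⟩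
  refine ⟨IntegrableOn.locallyIntegrableOn (hpull.integrable (by norm_num)), ?_⟩
  intro ψ hψ hψc hψΩ v
  have key := IsWeakGrad.pullback hS h (hu.integrable (by norm_num)) (hg.integrable (by norm_num))
    hψ hψc hψΩ v
  simp only [pullDensity, pullGrad, mul_assoc l, real_inner_smul_left _ _ l]
  rw [integral_const_mul, integral_const_mul, key, mul_neg]

/-- The change of variables `x = S y`. What `X` does outside the image of `S` is irrelevant because
the measure is restricted first. -/
lemma map_invFunOn_densityMeasure {X : Rd d → Rd d} (hX : Measurable X)
    (hXS : ∀ y ∈ Ω, X (S y) = y) (u : Rd d → ℝ) :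
    ((densityMeasure Ω u).restrict (S '' Ω)).map X = densityMeasure Ω (pullDensity S u 1) := by
  have hΩm := hS.isOpen.measurableSet
  have hBm := hS.measurableSet_image
  ext A hA
  have hXA := hX hA
  rw [Measure.map_apply hX hA, Measure.restrict_apply hXA, densityMeasure, densityMeasure,
    withDensity_apply _ (hXA.inter hBm), withDensity_apply _ hA,
    Measure.restrict_restrict (hXA.inter hBm), Measure.restrict_restrict hA, inter_assoc,
    inter_eq_left.2 hS.mapsTo.image_subset,
    ← setLIntegral_indicator hXA, ← setLIntegral_indicator hA, hS.lintegral_image]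
  refine setLIntegral_congr_fun hΩm fun y hy => ?_
  by_cases hyA : y ∈ A
  · have : S y ∈ X ⁻¹' A := by rw [mem_preimage, hXS y hy]; exact hyA
    simp only [indicator_of_mem hyA, indicator_of_mem this, pullDensity, one_mul]
    rw [mul_comm, ENNReal.ofReal_mul' (hS.det_pos y hy).le]
  · have : S y ∉ X ⁻¹' A := by rw [mem_preimage, hXS y hy]; exact hyA
    simp only [indicator_of_notMem hyA, indicator_of_notMem this, mul_zero]

end IsSmoothEmbedding

lemma densityMeasure_compl_image (hS : IsSmoothEmbedding Ω S) {u : Rd d → ℝ}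
    (hu : IsProbDensity Ω u) :
    (densityMeasure Ω u) (S '' Ω)ᶜ = ENNReal.ofReal (∫ x in Ω \ S '' Ω, u x) := by
  have hm := hS.measurableSet_image
  have hsub : Ω \ S '' Ω ⊆ Ω := sdiff_subset
  rw [densityMeasure, withDensity_apply _ hm.compl, Measure.restrict_restrict hm.compl,
    ofReal_integral_eq_lintegral_ofReal (hu.integrableOn.mono_set hsub)
      (ae_mono (Measure.restrict_mono hsub le_rfl) hu.nonneg), sdiff_eq, inter_comm]

/-- The competitor is a probability density, and its distribution redistributes the mass outside
the image of `S`. -/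
lemma isProbDensity_pull (hS : IsSmoothEmbedding Ω S) {u : Rd d → ℝ}
    (hu : IsProbDensity Ω u) {m : ℝ} (hm : m = ∫ x in Ω \ S '' Ω, u x) (hm1 : m < 1)
    {X : Rd d → Rd d} (hX : Measurable X) (hXS : ∀ y ∈ Ω, X (S y) = y) :
    IsProbDensity Ω (pullDensity S u (1 - m)⁻¹) ∧
      ((densityMeasure Ω u).restrict (S '' Ω)).map X + (densityMeasure Ω u) (S '' Ω)ᶜ •
        densityMeasure Ω (pullDensity S u (1 - m)⁻¹) =
        densityMeasure Ω (pullDensity S u (1 - m)⁻¹) := by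
  have hΩm := hS.isOpen.measurableSet
  have hBm := hS.measurableSet_image
  have hsub : Ω \ S '' Ω ⊆ Ω := sdiff_subset
  have hprob := (hu.isProbOn hΩm).prob
  have hm0 : 0 ≤ m := by
    rw [hm]
    exact integral_nonneg_of_ae (ae_mono (Measure.restrict_mono hsub le_rfl) hu.nonneg)
  have hmass := densityMeasure_compl_image hS hu
  rw [← hm] at hmass
  have hmap := hS.map_invFunOn_densityMeasure hX hXS u
  have hl : 0 < (1 - m)⁻¹ := inv_pos.2 (by linarith)
  have hscale : densityMeasure Ω (pullDensity S u (1 - m)⁻¹) =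
      ENNReal.ofReal (1 - m)⁻¹ • densityMeasure Ω (pullDensity S u 1) := by
    rw [densityMeasure, densityMeasure, ← withDensity_smul' _ _ ENNReal.ofReal_ne_top]
    congr 1
    funext y
    simp only [pullDensity, one_mul, Pi.smul_apply, smul_eq_mul]
    rw [ENNReal.ofReal_mul hl.le]
  have hone : (densityMeasure Ω (pullDensity S u 1)) univ = ENNReal.ofReal (1 - m) := by
    rw [← hmap, Measure.map_apply hX .univ, preimage_univ, Measure.restrict_apply_univ]
    have h1 := prob_compl_eq_one_sub (μ := densityMeasure Ω u) hBm.compl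
    rw [compl_compl, hmass] at h1
    rw [h1, ENNReal.ofReal_sub _ hm0, ENNReal.ofReal_one]
  -- The null set where `u < 0` has to be pulled back by `S`: the negative part has zero integral
  -- over the image, hence so does its pullback weighted with the positive determinant.
  have hnn : ∀ᵐ y ∂(volume.restrict Ω), 0 ≤ pullDensity S u (1 - m)⁻¹ y := by
    have h1 : ∀ᵐ x ∂(volume.restrict (S '' Ω)), 0 ≤ u x :=
      ae_mono (Measure.restrict_mono hS.mapsTo.image_subset le_rfl) hu.nonneg
    have h2 : ∫⁻ x in S '' Ω, ENNReal.ofReal (-(u x)) = 0 := by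
      rw [lintegral_congr_ae (g := fun _ => 0)]
      · simp
      · filter_upwards [h1] with x hx
        exact ENNReal.ofReal_of_nonpos (by linarith)
    rw [hS.lintegral_image] at h2
    have hmS := hS.aestronglyMeasurable_comp hu.integrableOn
    have hjm : AEMeasurable (fun y => (fderiv ℝ S y).det) (volume.restrict Ω) :=
      (hS.contDiff_det_fderiv.continuousOn.aestronglyMeasurable hΩm).aemeasurable
    have hmm : AEMeasurable (fun y => ENNReal.ofReal (fderiv ℝ S y).det * ENNReal.ofReal (-u (S y)))
        (volume.restrict Ω) := hjm.ennreal_ofReal.mul hmS.aemeasurable.neg.ennreal_ofReal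
    rw [lintegral_eq_zero_iff' hmm] at h2
    filter_upwards [h2, ae_restrict_mem hΩm] with y hy hyΩ
    have hj := hS.det_pos y hyΩ
    have h3 : 0 ≤ u (S y) := by
      simp only [Pi.zero_apply, mul_eq_zero, ENNReal.ofReal_eq_zero] at hy
      rcases hy with hy | hy <;> linarith
    unfold pullDensity
    positivity
  have haem : AEMeasurable (pullDensity S u (1 - m)⁻¹) (volume.restrict Ω) :=
    ((hS.aestronglyMeasurable_comp hu.integrableOn).aemeasurable.mul
      (hS.contDiff_det_fderiv.continuousOn.aestronglyMeasurable hΩm).aemeasurable).const_mul _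
  refine ⟨⟨haem, hnn, ?_⟩, ?_⟩
  · have h1 : (densityMeasure Ω (pullDensity S u (1 - m)⁻¹)) univ = 1 := by
      rw [hscale, Measure.smul_apply, hone, smul_eq_mul, ← ENNReal.ofReal_mul hl.le,
        inv_mul_cancel₀ (by linarith), ENNReal.ofReal_one]
    rwa [densityMeasure, withDensity_apply _ .univ, Measure.restrict_univ] at h1
  -- The remaining identity for the scalar factors is `1 + m / (1 - m) = 1 / (1 - m)`.
  · rw [hmap, hmass, hscale, smul_smul]
    conv_lhs => rw [← one_smul ℝ≥0∞ (densityMeasure Ω (pullDensity S u 1))]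
    rw [smul_smul, ← add_smul, mul_one, ← ENNReal.ofReal_mul hm0, ← ENNReal.ofReal_one,
      ← ENNReal.ofReal_add zero_le_one (by positivity)]
    congr 2
    have : 1 - m ≠ 0 := by linarith
    field_simp
    ring

end JKO

namespace JKO

open Filter Topology

variable {d : ℕ} {Ω : Set (Rd d)} {V : Rd d → Rd d} {M : ℝ} {S : ℝ → Rd d → Rd d} {s₀ C : ℝ}

/-! ### The first variation of the energy -/

lemma tendsto_nhdsGT_const_mul (c : ℝ) : Tendsto (fun s : ℝ => c * s) (𝓝[>] 0) (𝓝 0) := by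
  have : Tendsto (fun s : ℝ => c * s) (𝓝 0) (𝓝 (c * 0)) :=
    (continuous_const.mul continuous_id).tendsto 0
  rw [mul_zero] at this
  exact this.mono_left nhdsWithin_le_nhds

section

variable {G : Type*} [NormedAddCommGroup G] [NormedSpace ℝ G]

/-- This converts the quadratic error bounds of `IsVariation` into derivatives at `s = 0`. The
velocity `w s` may depend on `s`, since it is evaluated at the moving point `invFunOn (S s) Ω x`. -/
lemma tendsto_inv_smul_of_norm_le {f w : ℝ → G} {w₀ : G} {c : ℝ}
    (h : ∀ᶠ s in 𝓝[>] (0 : ℝ), ‖f s + s • w s‖ ≤ c * s ^ 2)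
    (hw : Tendsto w (𝓝[>] 0) (𝓝 w₀)) :
    Tendsto (fun s => s⁻¹ • f s) (𝓝[>] 0) (𝓝 (-w₀)) := by
  have h1 : Tendsto (fun s => s⁻¹ • (f s + s • w s)) (𝓝[>] 0) (𝓝 0) := by
    refine squeeze_zero_norm' ?_ (tendsto_nhdsGT_const_mul c)
    filter_upwards [h, self_mem_nhdsWithin] with s hs hs0
    have hs0' : (0 : ℝ) < s := hs0
    rw [norm_smul, Real.norm_of_nonneg (by positivity)]
    calc s⁻¹ * _ ≤ s⁻¹ * (c * s ^ 2) := mul_le_mul_of_nonneg_left hs (by positivity)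
      _ = c * s := by field_simp
  have h2 := h1.sub hw
  rw [zero_sub] at h2
  refine h2.congr' ?_
  filter_upwards [self_mem_nhdsWithin] with s hs0
  have hs0' : (s : ℝ) ≠ 0 := ne_of_gt hs0
  rw [smul_add, smul_smul, inv_mul_cancel₀ hs0', one_smul, add_sub_cancel_right]

lemma _root_.Filter.Tendsto.clm_comp_left {E H α : Type*} [NormedAddCommGroup E] [NormedSpace ℝ E]
    [NormedAddCommGroup H] [NormedSpace ℝ H] (t : G →L[ℝ] H) {f : α → E →L[ℝ] G}
    {a : E →L[ℝ] G} {l : Filter α} (h : Tendsto f l (𝓝 a)) :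
    Tendsto (fun s => t.comp (f s)) l (𝓝 (t.comp a)) :=
  ((ContinuousLinearMap.compL ℝ E G H t).continuous.tendsto a).comp h

lemma tendsto_zero_of_tendsto_inv_smul {f : ℝ → G} {w₀ : G}
    (h : Tendsto (fun s => s⁻¹ • f s) (𝓝[>] 0) (𝓝 w₀)) : Tendsto f (𝓝[>] 0) (𝓝 0) := by
  have h1 : Tendsto (fun s : ℝ => s) (𝓝[>] 0) (𝓝 0) := by
    simpa using tendsto_nhdsGT_const_mul 1
  have h2 := h1.smul h
  rw [zero_smul] at h2
  refine h2.congr' ?_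
  filter_upwards [self_mem_nhdsWithin] with s hs0
  have hs0' : (s : ℝ) ≠ 0 := ne_of_gt hs0
  rw [smul_smul, mul_inv_cancel₀ hs0', one_smul]

end

/-- The velocity of the gradient argument of the Lagrangian. -/
noncomputable def gradVelocity (V : Rd d → Rd d) (x : Rd d) (z : ℝ) (p : Rd d) : Rd d :=
  -((fderiv ℝ V x).adjoint p + traceL (fderiv ℝ V x) • p
    + z • dualIso (traceL.comp (fderiv ℝ (fderiv ℝ V) x)))

/-- The integrand of the first variation of the energy in direction `V`. -/
noncomputable def firstVariation (Ω : Set (Rd d)) (F : Rd d × ℝ × Rd d → ℝ) (V : Rd d → Rd d)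
    (u : Rd d → ℝ) (g : Rd d → Rd d) (x : Rd d) : ℝ :=
  DF Ω F (x, u x, g x) (V x, -(u x * traceL (fderiv ℝ V x)), gradVelocity V x (u x) (g x))
    + F (x, u x, g x) * traceL (fderiv ℝ V x)

/-- The energy density of the competitor, transported to the original configuration. -/
noncomputable def pulledEnergy (Ω : Set (Rd d)) (F : Rd d × ℝ × Rd d → ℝ) (S : Rd d → Rd d)
    (u : Rd d → ℝ) (g : Rd d → Rd d) (l : ℝ) (x : Rd d) : ℝ :=
  F (Function.invFunOn S Ω x, pullDensity S u l (Function.invFunOn S Ω x),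
    pullGrad S u g l (Function.invFunOn S Ω x)) / (fderiv ℝ S (Function.invFunOn S Ω x)).det

section

variable (hΩ : IsSmoothConvexDomain Ω) (hV : IsTestField Ω V M) (hS : IsVariation Ω V S s₀ C)
include hΩ hV hS

lemma IsVariation.eventually_invFunOn (hs₀ : 0 < s₀) (hC : 0 ≤ C) {x : Rd d} (hx : x ∈ Ω) :
    ∀ᶠ s in 𝓝[>] (0 : ℝ), 0 < s ∧ |s| ≤ s₀ ∧ Function.invFunOn (S s) Ω x ∈ Ω ∧
      S s (Function.invFunOn (S s) Ω x) = x := by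
  filter_upwards [Ioc_mem_nhdsGT hs₀, hS.eventually_mem_image hΩ hV hs₀ hC hx] with s hs hmem
  refine ⟨hs.1, by rw [abs_of_pos hs.1]; exact hs.2, ?_⟩
  exact ⟨Function.invFunOn_mem hmem, Function.invFunOn_eq hmem⟩

lemma IsVariation.tendsto_invFunOn (hs₀ : 0 < s₀) (hC : 0 ≤ C) {x : Rd d} (hx : x ∈ Ω) :
    Tendsto (fun s => s⁻¹ • (Function.invFunOn (S s) Ω x - x)) (𝓝[>] 0) (𝓝 (V x)) ∧
      Tendsto (fun s => Function.invFunOn (S s) Ω x) (𝓝[>] 0) (𝓝 x) := by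
  have h1 : Tendsto (fun s => s⁻¹ • (Function.invFunOn (S s) Ω x - x)) (𝓝[>] 0) (𝓝 (V x)) := by
    have := tendsto_inv_smul_of_norm_le (f := fun s => Function.invFunOn (S s) Ω x - x)
      (w := fun _ => -V x) (w₀ := -V x) (c := C + M * (C + M)) ?_ tendsto_const_nhds
    · rwa [neg_neg] at this
    · filter_upwards [hS.eventually_invFunOn hΩ hV hs₀ hC hx] with s ⟨hs0, hs, hy, hyx⟩
      have := (hS.norm_invFunOn_sub_le hΩ hV hC hs0.ne' hs hy).2
      rwa [hyx, sub_eq_add_neg, ← smul_neg] at this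
  refine ⟨h1, ?_⟩
  have := (tendsto_zero_of_tendsto_inv_smul h1).add_const x
  simpa using this

lemma IsVariation.tendsto_derivatives (hs₀ : 0 < s₀) (hC : 0 ≤ C) {x : Rd d} (hx : x ∈ Ω) :
    Tendsto (fun s => s⁻¹ • ((fderiv ℝ (S s) (Function.invFunOn (S s) Ω x)).det - 1)) (𝓝[>] 0)
      (𝓝 (-traceL (fderiv ℝ V x))) ∧
    Tendsto (fun s => s⁻¹ • (fderiv ℝ (S s) (Function.invFunOn (S s) Ω x) - 1)) (𝓝[>] 0)
      (𝓝 (-fderiv ℝ V x)) ∧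
    Tendsto (fun s => s⁻¹ • ∇ (fun y => (fderiv ℝ (S s) y).det) (Function.invFunOn (S s) Ω x))
      (𝓝[>] 0) (𝓝 (-dualIso (traceL.comp (fderiv ℝ (fderiv ℝ V) x)))) := by
  have hev := hS.eventually_invFunOn hΩ hV hs₀ hC hx
  have hy := (hS.tendsto_invFunOn hΩ hV hs₀ hC hx).2
  have hV1 : ContDiffOn ℝ ∞ (fderiv ℝ V) Ω := hV.smooth.fderiv_of_isOpen hΩ.isOpen (by simp)
  have hc1 : Tendsto (fun s => fderiv ℝ V (Function.invFunOn (S s) Ω x)) (𝓝[>] 0)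
      (𝓝 (fderiv ℝ V x)) :=
    ((hV1.continuousOn.continuousAt (hΩ.isOpen.mem_nhds hx)).tendsto).comp hy
  have hc2 : Tendsto (fun s => fderiv ℝ (fderiv ℝ V) (Function.invFunOn (S s) Ω x)) (𝓝[>] 0)
      (𝓝 (fderiv ℝ (fderiv ℝ V) x)) :=
    (((hV1.continuousOn_fderiv_of_isOpen hΩ.isOpen (by simp)).continuousAt
      (hΩ.isOpen.mem_nhds hx)).tendsto).comp hy
  refine ⟨?_, ?_, ?_⟩
  · refine tendsto_inv_smul_of_norm_le (c := C) ?_ ((traceL.continuous.tendsto _).comp hc1)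
    filter_upwards [hev] with s ⟨hs0, hs, hy, hyx⟩
    exact hS.disp_det s hs0.ne' hs _ hy
  · refine tendsto_inv_smul_of_norm_le (G := Rd d →L[ℝ] Rd d) (c := C)
      (f := fun s => fderiv ℝ (S s) (Function.invFunOn (S s) Ω x) - 1)
      (w := fun s => fderiv ℝ V (Function.invFunOn (S s) Ω x)) ?_ hc1
    filter_upwards [hev] with s ⟨hs0, hs, hy, hyx⟩
    exact hS.disp_fderiv s hs0.ne' hs _ hy
  · have hc3 : Tendsto (fun s => traceL.comp (fderiv ℝ (fderiv ℝ V)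
        (Function.invFunOn (S s) Ω x))) (𝓝[>] 0)
        (𝓝 (traceL.comp (fderiv ℝ (fderiv ℝ V) x))) :=
      hc2.clm_comp_left traceL
    have h1 := tendsto_inv_smul_of_norm_le (c := C)
      (f := fun s => fderiv ℝ (fun y => (fderiv ℝ (S s) y).det) (Function.invFunOn (S s) Ω x))
      (by
        filter_upwards [hev] with s ⟨hs0, hs, hy, hyx⟩
        exact hS.disp_fderiv_det s hs0.ne' hs _ hy) hc3
    have h2 := (dualIso.continuous.tendsto _).comp h1
    rw [map_neg] at h2
    refine h2.congr fun s => ?_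
    simp only [Function.comp, map_smul, gradient_eq_dualIso]

/-- At the preimage of `x` the density is `l · det DS · u x` with `u x` fixed. The normalization is
`1 + o(s)`, so only the determinant contributes to the velocity. -/
lemma IsVariation.tendsto_pullDensity (hs₀ : 0 < s₀) (hC : 0 ≤ C) {l : ℝ → ℝ}
    (hl : Tendsto (fun s => s⁻¹ • (l s - 1)) (𝓝[>] 0) (𝓝 0)) (u : Rd d → ℝ)
    {x : Rd d} (hx : x ∈ Ω) :
    Tendsto (fun s => s⁻¹ • (pullDensity (S s) u (l s) (Function.invFunOn (S s) Ω x) - u x))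
      (𝓝[>] 0) (𝓝 (-(u x * traceL (fderiv ℝ V x)))) := by
  obtain ⟨hj, -, -⟩ := hS.tendsto_derivatives hΩ hV hs₀ hC hx
  have hj1 := (tendsto_zero_of_tendsto_inv_smul hj).add_const 1
  simp only [sub_add_cancel, zero_add] at hj1
  have h := ((hl.mul hj1).add hj).const_mul (u x)
  simp only [zero_mul, zero_add, mul_neg] at h
  refine h.congr' ?_
  filter_upwards [hS.eventually_invFunOn hΩ hV hs₀ hC hx] with s ⟨hs0, hs, hy, hyx⟩
  rw [pullDensity, hyx]
  simp only [smul_eq_mul]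
  ring

lemma IsVariation.tendsto_pullGrad (hs₀ : 0 < s₀) (hC : 0 ≤ C) {l : ℝ → ℝ}
    (hl : Tendsto (fun s => s⁻¹ • (l s - 1)) (𝓝[>] 0) (𝓝 0)) (u : Rd d → ℝ) (g : Rd d → Rd d)
    {x : Rd d} (hx : x ∈ Ω) :
    Tendsto (fun s => s⁻¹ • (pullGrad (S s) u g (l s) (Function.invFunOn (S s) Ω x) - g x))
      (𝓝[>] 0) (𝓝 (gradVelocity V x (u x) (g x))) := by
  obtain ⟨hj, hA, hk⟩ := hS.tendsto_derivatives hΩ hV hs₀ hC hx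
  have hj1 := (tendsto_zero_of_tendsto_inv_smul hj).add_const 1
  simp only [sub_add_cancel, zero_add] at hj1
  have hl1 := (tendsto_zero_of_tendsto_inv_smul hl).add_const 1
  simp only [sub_add_cancel, zero_add] at hl1
  have hadj : Tendsto (fun s => (s⁻¹ • (fderiv ℝ (S s) (Function.invFunOn (S s) Ω x)
      - 1)).adjoint (g x)) (𝓝[>] 0) (𝓝 ((-fderiv ℝ V x).adjoint (g x))) :=
    ((((ContinuousLinearMap.adjoint (𝕜 := ℝ) (E := Rd d) (F := Rd d)).continuous.clm_apply
      continuous_const).tendsto _).comp hA)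
  -- With `j = det DS`, the increment splits as `l j (DS - 1)^* g + ((l - 1) j + (j - 1)) g + l u
  -- ∇j`, so that each summand is a product of convergent factors.
  have h := (((hl1.mul hj1).smul hadj).add (((hl.mul hj1).add hj).smul_const (g x))).add
    ((hl1.mul_const (u x)).smul hk)
  have hlim : ((1 : ℝ) * 1) • (-fderiv ℝ V x).adjoint (g x)
      + ((0 : ℝ) * 1 + -traceL (fderiv ℝ V x)) • g x
      + ((1 : ℝ) * u x) • -dualIso (traceL.comp (fderiv ℝ (fderiv ℝ V) x)) =
      gradVelocity V x (u x) (g x) := by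
    rw [gradVelocity, map_neg, neg_apply]
    module
  rw [hlim] at h
  refine h.congr' ?_
  filter_upwards [hS.eventually_invFunOn hΩ hV hs₀ hC hx] with s ⟨hs0, hs, hy, hyx⟩
  rw [pullGrad, hyx]
  have e1 : (s⁻¹ • (fderiv ℝ (S s) (Function.invFunOn (S s) Ω x) - 1)).adjoint (g x) =
      s⁻¹ • ((fderiv ℝ (S s) (Function.invFunOn (S s) Ω x)).adjoint (g x) - g x) := by
    refine ext_inner_right ℝ fun v => ?_
    rw [ContinuousLinearMap.adjoint_inner_left, real_inner_smul_left, inner_sub_left,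
      ContinuousLinearMap.adjoint_inner_left]
    simp [inner_smul_right, inner_sub_right]
  rw [e1]
  simp only [smul_eq_mul]
  module

/-- The pointwise first variation of the energy density. -/
lemma IsVariation.tendsto_pulledEnergy (hs₀ : 0 < s₀) (hC : 0 ≤ C) {F : Rd d × ℝ × Rd d → ℝ}
    (hF : LagrangianAssumption Ω F) {l : ℝ → ℝ}
    (hl : Tendsto (fun s => s⁻¹ • (l s - 1)) (𝓝[>] 0) (𝓝 0)) (u : Rd d → ℝ) (g : Rd d → Rd d)
    {x : Rd d} (hx : x ∈ Ω) (hux : 0 ≤ u x) :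
    Tendsto (fun s => s⁻¹ * (pulledEnergy Ω F (S s) u g (l s) x - F (x, u x, g x)))
      (𝓝[>] 0) (𝓝 (firstVariation Ω F V u g x)) := by
  have hev := hS.eventually_invFunOn hΩ hV hs₀ hC hx
  obtain ⟨hj, -, -⟩ := hS.tendsto_derivatives hΩ hV hs₀ hC hx
  have hj1 := (tendsto_zero_of_tendsto_inv_smul hj).add_const 1
  simp only [sub_add_cancel, zero_add] at hj1
  have hl1 := (tendsto_zero_of_tendsto_inv_smul hl).add_const 1
  simp only [sub_add_cancel, zero_add] at hl1
  have t1 := (hS.tendsto_invFunOn hΩ hV hs₀ hC hx).1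
  have t2 := hS.tendsto_pullDensity hΩ hV hs₀ hC hl u hx
  have t3 := hS.tendsto_pullGrad hΩ hV hs₀ hC hl u g hx
  set Y : ℝ → Rd d × ℝ × Rd d := fun s => (Function.invFunOn (S s) Ω x - x,
    pullDensity (S s) u (l s) (Function.invFunOn (S s) Ω x) - u x,
    pullGrad (S s) u g (l s) (Function.invFunOn (S s) Ω x) - g x) with hY
  have tY : Tendsto (fun s => s⁻¹ • Y s) (𝓝[>] 0) (𝓝 (V x, -(u x * traceL (fderiv ℝ V x)),
      gradVelocity V x (u x) (g x))) := t1.prodMk_nhds (t2.prodMk_nhds t3)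
  have hmem : ((x, u x, g x) : Rd d × ℝ × Rd d) ∈ phaseSet Ω := ⟨subset_closure hx, hux, trivial⟩
  have hYe : ∀ s, (x, u x, g x) + Y s = (Function.invFunOn (S s) Ω x,
      pullDensity (S s) u (l s) (Function.invFunOn (S s) Ω x),
      pullGrad (S s) u g (l s) (Function.invFunOn (S s) Ω x)) := by
    intro s
    simp [hY]
  have hlpos : ∀ᶠ s in 𝓝[>] (0 : ℝ), 0 < l s := hl1.eventually (lt_mem_nhds zero_lt_one)
  have hin : ∀ᶠ s in 𝓝[>] (0 : ℝ), (x, u x, g x) + Y s ∈ phaseSet Ω := by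
    filter_upwards [hev, hlpos] with s ⟨hs0, hs, hy, hyx⟩ hls
    rw [hYe]
    refine ⟨subset_closure hy, ?_, trivial⟩
    have hdet := (hS.emb s hs0.ne' hs).det_pos _ hy
    simp only [pullDensity, hyx, mem_Ici]
    positivity
  -- The differential is one-sided where `u x = 0`; it applies because the perturbed arguments stay
  -- in `phaseSet Ω`.
  have tF := (hF.hasFDerivWithinAt hmem).lim (c := fun s : ℝ => s⁻¹)
    (tendsto_zero_of_tendsto_inv_smul tY) hin tY
  have tinv : Tendsto (fun s => ((fderiv ℝ (S s) (Function.invFunOn (S s) Ω x)).det)⁻¹)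
      (𝓝[>] 0) (𝓝 1) := by simpa using hj1.inv₀ one_ne_zero
  have h := (tinv.mul tF).sub ((tinv.mul hj).const_mul (F (x, u x, g x)))
  have hlim : 1 * DF Ω F (x, u x, g x) (V x, -(u x * traceL (fderiv ℝ V x)),
      gradVelocity V x (u x) (g x)) - F (x, u x, g x) * (1 * -traceL (fderiv ℝ V x)) =
      firstVariation Ω F V u g x := by
    rw [firstVariation]; ring
  rw [hlim] at h
  refine h.congr' ?_
  filter_upwards [hev] with s ⟨hs0, hs, hy, hyx⟩
  have hdet := ((hS.emb s hs0.ne' hs).det_pos _ hy).ne'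
  rw [hYe, pulledEnergy]
  simp only [smul_eq_mul]
  field_simp
  ring

end

end JKO

/-! ### Dominated convergence for the difference quotients of the energy -/

namespace JKO

open Filter Topology

variable {d : ℕ} {Ω : Set (Rd d)} {V : Rd d → Rd d} {M : ℝ} {S : ℝ → Rd d → Rd d} {s₀ C : ℝ}

lemma norm_le_of_norm_add_smul_le {G : Type*} [NormedAddCommGroup G] [NormedSpace ℝ G] {f w : G}
    {s c W : ℝ} (hc : 0 ≤ c) (hs : |s| ≤ 1) (h : ‖f + s • w‖ ≤ c * s ^ 2) (hw : ‖w‖ ≤ W) :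
    ‖f‖ ≤ (c + W) * |s| := by
  have e : f = (f + s • w) - s • w := by abel
  have hsa := abs_nonneg s
  have h1 : c * s ^ 2 ≤ c * |s| := by
    rw [← sq_abs, sq]
    exact mul_le_mul_of_nonneg_left (mul_le_of_le_one_left hsa hs) hc
  have h2 : |s| * ‖w‖ ≤ |s| * W := mul_le_mul_of_nonneg_left hw hsa
  rw [e]
  refine (norm_sub_le _ _).trans ?_
  rw [norm_smul, Real.norm_eq_abs]
  linarith

lemma abs_mul_sub_one_le {s k j l : ℝ} (hs : 0 ≤ s) (hj0 : 0 < j) (hjle : j ≤ 1 + k)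
    (hj : |j - 1| ≤ k * s) (hl : |l - 1| ≤ s) : |l * j - 1| ≤ (1 + 2 * k) * s := by
  have e : l * j - 1 = (l - 1) * j + (j - 1) := by ring
  rw [e]
  refine (abs_add_le _ _).trans ?_
  rw [abs_mul, abs_of_pos hj0]
  have : |l - 1| * j ≤ s * (1 + k) := mul_le_mul hl hjle hj0.le hs
  linarith

/-- The change of the gradient argument, with `A = DS`, `j = det DS` and `w = ∇ det DS`. It is small
relative to `‖p‖ + z`, which is the form required by `LagrangianAssumption.exists_abs_sub_le`. -/
lemma norm_smul_adjoint_add_sub_le {A : Rd d →L[ℝ] Rd d} {p w : Rd d} {s k j l z : ℝ}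
    (hs : 0 ≤ s) (hk : 0 ≤ k) (hj0 : 0 < j) (hjle : j ≤ 1 + k) (hj : |j - 1| ≤ k * s)
    (hl0 : 0 ≤ l) (hl2 : l ≤ 2) (hl : |l - 1| ≤ s) (hz : 0 ≤ z) (hA : ‖A - 1‖ ≤ k * s)
    (hw : ‖w‖ ≤ k * s) :
    ‖l • (j • A.adjoint p + z • w) - p‖ ≤
      ((1 + 2 * k) + (2 + 2 * k) * k + 2 * k) * s * (‖p‖ + z) := by
  have hlj := abs_mul_sub_one_le hs hj0 hjle hj hl
  have e : l • (j • A.adjoint p + z • w) - p =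
      (l * j) • (A - 1).adjoint p + (l * j - 1) • p + (l * z) • w := by
    have e1 : (A - 1).adjoint p = A.adjoint p - p := by
      refine ext_inner_right ℝ fun v => ?_
      rw [ContinuousLinearMap.adjoint_inner_left, inner_sub_left,
        ContinuousLinearMap.adjoint_inner_left]
      simp [inner_sub_right]
    rw [e1]
    module
  have hljle : l * j ≤ 2 + 2 * k := by
    calc l * j ≤ 2 * (1 + k) := mul_le_mul hl2 hjle hj0.le (by norm_num)
      _ = _ := by ring
  have n1 : ‖(l * j) • (A - 1).adjoint p‖ ≤ (2 + 2 * k) * (k * s * ‖p‖) := by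
    rw [norm_smul, Real.norm_of_nonneg (by positivity)]
    refine mul_le_mul hljle ?_ (norm_nonneg _) (by positivity)
    refine ((ContinuousLinearMap.adjoint (A - 1)).le_opNorm _).trans ?_
    rw [LinearIsometryEquiv.norm_map]
    exact mul_le_mul_of_nonneg_right hA (norm_nonneg _)
  have n2 : ‖(l * j - 1) • p‖ ≤ (1 + 2 * k) * s * ‖p‖ := by
    rw [norm_smul]
    exact mul_le_mul_of_nonneg_right hlj (norm_nonneg _)
  have n3 : ‖(l * z) • w‖ ≤ 2 * z * (k * s) := by
    rw [norm_smul, Real.norm_of_nonneg (by positivity)]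
    exact mul_le_mul (mul_le_mul_of_nonneg_right hl2 hz) hw (norm_nonneg _) (by positivity)
  rw [e]
  refine ((norm_add_le _ _).trans (add_le_add (norm_add_le _ _) le_rfl)).trans ?_
  have r1 : 0 ≤ 2 * k * s * ‖p‖ := by positivity
  have r2 : 0 ≤ ((1 + 2 * k) + (2 + 2 * k) * k) * s * z := by positivity
  linear_combination n1 + n2 + n3 + r1 + r2

lemma abs_inv_mul_div_sub_le {s j F₀ F₁ c k b q : ℝ} (hs : 0 < s) (hj : 1 / 2 ≤ j)
    (hj1 : |j - 1| ≤ k * s) (hk : 0 ≤ k) (hF₀ : 0 ≤ F₀) (hb : F₀ ≤ b * q)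
    (hF : |F₁ - F₀| ≤ c * s * q) :
    |s⁻¹ * (F₁ / j - F₀)| ≤ (2 * c + 2 * k * b) * q := by
  have hj0 : 0 < j := by linarith
  have hjinv : j⁻¹ ≤ 2 := by
    rw [inv_le_comm₀ hj0 (by norm_num)]; linarith
  have hjinv0 : 0 < j⁻¹ := inv_pos.2 hj0
  have e : s⁻¹ * (F₁ / j - F₀) = s⁻¹ * (j⁻¹ * (F₁ - F₀)) - s⁻¹ * (j⁻¹ * ((j - 1) * F₀)) := by
    field_simp; ring
  rw [e]
  refine (abs_sub _ _).trans ?_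
  have hsinv : 0 < s⁻¹ := inv_pos.2 hs
  have a1 : |s⁻¹ * (j⁻¹ * (F₁ - F₀))| ≤ s⁻¹ * (2 * (c * s * q)) := by
    rw [abs_mul, abs_mul, abs_of_pos hsinv, abs_of_pos hjinv0]
    exact mul_le_mul_of_nonneg_left (mul_le_mul hjinv hF (abs_nonneg _) (by norm_num)) hsinv.le
  have a2 : |s⁻¹ * (j⁻¹ * ((j - 1) * F₀))| ≤ s⁻¹ * (2 * (k * s * (b * q))) := by
    rw [abs_mul, abs_mul, abs_mul, abs_of_pos hsinv, abs_of_pos hjinv0, abs_of_nonneg hF₀]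
    refine mul_le_mul_of_nonneg_left (mul_le_mul hjinv ?_ (by positivity) (by norm_num)) hsinv.le
    exact mul_le_mul hj1 hb hF₀ (by positivity)
  calc _ ≤ s⁻¹ * (2 * (c * s * q)) + s⁻¹ * (2 * (k * s * (b * q))) := add_le_add a1 a2
    _ = _ := by field_simp

section

variable (hΩ : IsSmoothConvexDomain Ω) (hV : IsTestField Ω V M) (hS : IsVariation Ω V S s₀ C)
include hΩ hV hS

/-- First order bounds on a variation. -/
lemma IsVariation.exists_first_order_bound (hC : 0 ≤ C) : ∃ k : ℝ, 0 ≤ k ∧ ∀ s, s ≠ 0 → |s| ≤ s₀ →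
    ∀ y ∈ Ω, ‖y - S s y‖ ≤ k * |s| ∧ |(fderiv ℝ (S s) y).det - 1| ≤ k * |s| ∧
      ‖fderiv ℝ (S s) y - 1‖ ≤ k * |s| ∧ ‖∇ (fun y => (fderiv ℝ (S s) y).det) y‖ ≤ k * |s| := by
  have hM := hV.nonneg hΩ
  obtain ⟨T, hT0, hT⟩ : ∃ T : ℝ, 0 ≤ T ∧ ‖(traceL : (Rd d →L[ℝ] Rd d) →L[ℝ] ℝ)‖ ≤ T :=
    ⟨_, by positivity, le_rfl⟩
  have hTM : 0 ≤ T * M := by positivity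
  refine ⟨C + M + T * M, by positivity, fun s hs0 hs y hy => ?_⟩
  have hs1 := hs.trans hS.le_one
  have hsa := abs_nonneg s
  have m1 : (C + M) * |s| ≤ (C + M + T * M) * |s| := mul_le_mul_of_nonneg_right (by linarith) hsa
  have m2 : (C + T * M) * |s| ≤ (C + M + T * M) * |s| :=
    mul_le_mul_of_nonneg_right (by linarith) hsa
  refine ⟨(hS.norm_invFunOn_sub_le hΩ hV hC hs0 hs hy).1.trans m1, ?_, ?_, ?_⟩
  · have h1 : ‖traceL (fderiv ℝ V y)‖ ≤ T * M := (traceL.le_opNorm _).trans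
      (mul_le_mul hT (hV.bound_fderiv y hy) (norm_nonneg _) hT0)
    exact (norm_le_of_norm_add_smul_le hC hs1 (hS.disp_det s hs0 hs y hy) h1).trans m2
  · exact (norm_le_of_norm_add_smul_le hC hs1 (hS.disp_fderiv s hs0 hs y hy)
      (hV.bound_fderiv y hy)).trans m1
  · have h1 : ‖traceL.comp (fderiv ℝ (fderiv ℝ V) y)‖ ≤ T * M :=
      (ContinuousLinearMap.opNorm_comp_le _ _).trans
        (mul_le_mul hT (hV.bound_fderiv_fderiv y hy) (norm_nonneg _) hT0)
    rw [gradient_eq_dualIso, norm_dualIso]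
    exact (norm_le_of_norm_add_smul_le hC hs1 (hS.disp_fderiv_det s hs0 hs y hy) h1).trans m2

/-- The difference quotients of the energy density are dominated. -/
lemma IsVariation.exists_bound_pulledEnergy (hs₀ : 0 < s₀) (hC : 0 ≤ C)
    {F : Rd d × ℝ × Rd d → ℝ} (hF : LagrangianAssumption Ω F) : ∃ B s₁ : ℝ, 0 < s₁ ∧ s₁ ≤ s₀ ∧
    ∀ s, 0 < s → s ≤ s₁ → ∀ l : ℝ, |l - 1| ≤ s → ∀ (u : Rd d → ℝ) (g : Rd d → Rd d),
      ∀ x ∈ S s '' Ω, 0 ≤ u x →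
      |s⁻¹ * (pulledEnergy Ω F (S s) u g l x - F (x, u x, g x))| ≤
        B * (1 + ‖g x‖ ^ 2 + u x ^ 2) := by
  obtain ⟨k, hk0, hk⟩ := hS.exists_first_order_bound hΩ hV hC
  -- `K` dominates all three relative changes: `k` for the position, `1 + 2 * k` for the density and
  -- the constant of `norm_smul_adjoint_add_sub_le` for the gradient.
  obtain ⟨K, hK⟩ : ∃ K, K = (1 + 2 * k) + (2 + 2 * k) * k + 2 * k := ⟨_, rfl⟩
  have hK0 : 0 ≤ K := by rw [hK]; positivity
  obtain ⟨c, hc0, hc⟩ := hF.exists_abs_sub_le hΩ.convex hK0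
  obtain ⟨c', CF, hc', hcC, hb⟩ := hF.bounds
  have hCF : 0 ≤ CF := by linarith
  refine ⟨2 * c + 2 * k * CF, min s₀ (1 / (2 * (K + 1))), lt_min hs₀ (by positivity),
    min_le_left _ _, ?_⟩
  rintro s hs hs1 l hl u g _ ⟨y, hy, rfl⟩ hu
  have habs : |s| = s := abs_of_pos hs
  have hss₀ : |s| ≤ s₀ := by rw [habs]; exact hs1.trans (min_le_left _ _)
  have hs1' : s ≤ 1 := (hs1.trans (min_le_left _ _)).trans hS.le_one
  have hKs : K * s ≤ 1 / 2 := by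
    have h1 := hs1.trans (min_le_right _ _)
    rw [le_div_iff₀ (by positivity)] at h1
    linarith
  have hemb := hS.emb s hs.ne' hss₀
  obtain ⟨k1, k2, k3, k4⟩ := hk s hs.ne' hss₀ y hy
  rw [habs] at k1 k2 k3 k4
  have hdet := hS.half_le_det s hs.ne' hss₀ y hy
  rw [pulledEnergy, hemb.invFunOn_apply hy]
  set j := (fderiv ℝ (S s) y).det with hj
  set x := S s y with hx
  set p := g x with hp
  set z := u x with hz
  have hxΩ : x ∈ Ω := hemb.mapsTo hy
  have hj0 : 0 < j := by linarith
  have hjle : j ≤ 1 + k := by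
    have := (abs_le.1 k2).2
    nlinarith
  have hl1 := abs_le.1 hl
  have hl0 : 0 ≤ l := by linarith
  have hl2 : l ≤ 2 := by linarith
  have hlj := abs_mul_sub_one_le hs.le hj0 hjle k2 hl
  have hz' : 0 ≤ pullDensity (S s) u l y := by
    unfold pullDensity; positivity
  have hzz : |pullDensity (S s) u l y - z| ≤ K * s * z := by
    have e : pullDensity (S s) u l y - z = (l * j - 1) * z := by
      rw [pullDensity, ← hj, ← hx, ← hz]; ring
    rw [e, abs_mul, abs_of_nonneg hu]
    refine mul_le_mul_of_nonneg_right (hlj.trans (mul_le_mul_of_nonneg_right ?_ hs.le)) hu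
    rw [hK]
    nlinarith
  have hpp : ‖pullGrad (S s) u g l y - p‖ ≤ K * s * (‖p‖ + z) := by
    rw [hK]
    exact norm_smul_adjoint_add_sub_le hs.le hk0 hj0 hjle k2 hl0 hl2 hl hu k3 k4
  have hmain := hc s hs.le hKs x (subset_closure hxΩ) y (subset_closure hy) z
    (pullDensity (S s) u l y) hu hz' p (pullGrad (S s) u g l y)
    (k1.trans (mul_le_mul_of_nonneg_right (by rw [hK]; nlinarith) hs.le)) hzz hpp
  have hb1 := hb x (subset_closure hxΩ) z hu p
  have hF0 : 0 ≤ F (x, z, p) := le_trans (by positivity) hb1.1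
  have hFq : F (x, z, p) ≤ CF * (1 + ‖p‖ ^ 2 + z ^ 2) :=
    hb1.2.trans (mul_le_mul_of_nonneg_left (by linarith [sq_nonneg z]) hCF)
  exact abs_inv_mul_div_sub_le hs hdet k2 hk0 hF0 hFq hmain

/-- The first variation of the energy. -/
lemma IsVariation.tendsto_integral_pulledEnergy (hs₀ : 0 < s₀) (hC : 0 ≤ C)
    {F : Rd d × ℝ × Rd d → ℝ} (hF : LagrangianAssumption Ω F) {l : ℝ → ℝ}
    (hl : Tendsto (fun s => s⁻¹ • (l s - 1)) (𝓝[>] 0) (𝓝 0)) {u : Rd d → ℝ} {g : Rd d → Rd d}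
    (hu0 : ∀ᵐ x ∂(volume.restrict Ω), 0 ≤ u x) (hu : MemLp u 2 (volume.restrict Ω))
    (hg : MemLp g 2 (volume.restrict Ω))
    (h_int : ∀ᶠ s in 𝓝[>] (0 : ℝ), IntegrableOn (pulledEnergy Ω F (S s) u g (l s)) (S s '' Ω)) :
    IntegrableOn (firstVariation Ω F V u g) Ω ∧
      Tendsto (fun s => ∫ x in Ω, (S s '' Ω).indicator
        (fun x => s⁻¹ * (pulledEnergy Ω F (S s) u g (l s) x - F (x, u x, g x))) x)
        (𝓝[>] 0) (𝓝 (∫ x in Ω, firstVariation Ω F V u g x)) := by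
  have : IsFiniteMeasure (volume.restrict Ω) := ⟨by simpa using hΩ.volume_lt_top⟩
  have hΩm := hΩ.isOpen.measurableSet
  obtain ⟨B, s₁, hs₁, hs₁₀, hB⟩ := hS.exists_bound_pulledEnergy hΩ hV hs₀ hC hF
  have hFi := (hF.integrableOn hΩ hu.aestronglyMeasurable.aemeasurable hu0 hg).1
  have hlle : ∀ᶠ s in 𝓝[>] (0 : ℝ), |l s - 1| ≤ s := by
    have h1 := hl.norm.eventually (gt_mem_nhds (by simp : ‖(0 : ℝ)‖ < 1))
    filter_upwards [h1, self_mem_nhdsWithin] with s hs hs0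
    have hs0' : (0 : ℝ) < s := hs0
    rw [norm_smul, Real.norm_of_nonneg (by positivity), Real.norm_eq_abs, inv_mul_lt_iff₀ hs0',
      mul_one] at hs
    exact hs.le
  set bound : Rd d → ℝ := fun x => |B| * (1 + ‖g x‖ ^ 2 + u x ^ 2) with hbound
  have hbi : Integrable bound (volume.restrict Ω) := by
    refine Integrable.const_mul ?_ _
    exact ((integrable_const 1).add (hg.integrable_norm_pow (by norm_num))).add hu.integrable_sq
  set R : ℝ → Rd d → ℝ := fun s => (S s '' Ω).indicator
    (fun x => s⁻¹ * (pulledEnergy Ω F (S s) u g (l s) x - F (x, u x, g x))) with hR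
  have hmeas : ∀ᶠ s in 𝓝[>] (0 : ℝ), AEStronglyMeasurable (R s) (volume.restrict Ω) := by
    filter_upwards [h_int, Ioc_mem_nhdsGT hs₀] with s hs hs'
    have hemb := hS.emb s hs'.1.ne' (by rw [abs_of_pos hs'.1]; exact hs'.2)
    have h1 : IntegrableOn (fun x => s⁻¹ * (pulledEnergy Ω F (S s) u g (l s) x - F (x, u x, g x)))
        (S s '' Ω) := (hs.sub (hFi.mono_set hemb.mapsTo.image_subset)).const_mul _
    have h2 := (integrable_indicator_iff hemb.measurableSet_image).2 h1
    exact h2.aestronglyMeasurable.restrict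
  have hdom : ∀ᶠ s in 𝓝[>] (0 : ℝ), ∀ᵐ x ∂(volume.restrict Ω), ‖R s x‖ ≤ bound x := by
    filter_upwards [hlle, Ioc_mem_nhdsGT hs₁] with s hls hs
    filter_upwards [hu0] with x hx0
    have hq : 0 ≤ 1 + ‖g x‖ ^ 2 + u x ^ 2 := by positivity
    by_cases hx : x ∈ S s '' Ω
    · simp only [hR, indicator_of_mem hx, hbound]
      exact (hB s hs.1 hs.2 (l s) hls u g x hx hx0).trans
        (mul_le_mul_of_nonneg_right (le_abs_self B) hq)
    · simp only [hR, indicator_of_notMem hx, norm_zero, hbound]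
      positivity
  have hlim : ∀ᵐ x ∂(volume.restrict Ω),
      Tendsto (fun s => R s x) (𝓝[>] 0) (𝓝 (firstVariation Ω F V u g x)) := by
    filter_upwards [ae_restrict_mem hΩm, hu0] with x hx hx0
    refine (hS.tendsto_pulledEnergy hΩ hV hs₀ hC hF hl u g hx hx0).congr' ?_
    filter_upwards [hS.eventually_mem_image hΩ hV hs₀ hC hx] with s hs
    simp only [hR, indicator_of_mem hs]
  refine ⟨?_, tendsto_integral_filter_of_dominated_convergence bound hmeas hdom hbi hlim⟩
  -- Measurability and the bound pass to the pointwise limit along a sequence `σ n → 0`, which gives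
  -- integrability of the limit.
  obtain ⟨σ, hσ, hσp⟩ := exists_seq_forall_of_frequently (hmeas.and hdom).frequently
  have hmN : AEStronglyMeasurable (firstVariation Ω F V u g) (volume.restrict Ω) := by
    refine aestronglyMeasurable_of_tendsto_ae atTop (fun n => (hσp n).1) ?_
    filter_upwards [hlim] with x hx using hx.comp hσ
  refine Integrable.mono' hbi hmN ?_
  have hall : ∀ᵐ x ∂(volume.restrict Ω), ∀ n, ‖R (σ n) x‖ ≤ bound x :=
    ae_all_iff.2 fun n => (hσp n).2
  filter_upwards [hlim, hall] with x hx hxn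
  exact le_of_tendsto (hx.comp hσ).norm (Eventually.of_forall hxn)

end

end JKO

/-! ### The first variation along a gradient, and the squared distance -/

namespace JKO

open Filter Topology

variable {d : ℕ} {Ω : Set (Rd d)} {φ : Rd d → ℝ}

lemma fderiv_gradient (φ : Rd d → ℝ) (x v : Rd d) :
    fderiv ℝ (∇ φ) x v = dualIso (fderiv ℝ (fderiv ℝ φ) x v) := by
  have h : fderiv ℝ (fun y => dualIso (fderiv ℝ φ y)) x =
      (dualIso (d := d) : (Rd d →L[ℝ] ℝ) →L[ℝ] Rd d).comp (fderiv ℝ (fderiv ℝ φ) x) :=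
    dualIso.comp_fderiv
  exact congrArg (fun L => L v) h

lemma laplacian_eq_traceL (φ : Rd d → ℝ) (x : Rd d) :
    Laplacian.laplacian φ x = traceL (fderiv ℝ (∇ φ) x) := by
  rw [InnerProductSpace.laplacian_eq_iteratedFDeriv_orthonormalBasis φ
    (EuclideanSpace.basisFun (Fin d) ℝ), traceL_eq_sum]
  refine Finset.sum_congr rfl fun i _ => ?_
  rw [iteratedFDeriv_two_apply, fderiv_gradient, real_inner_comm, inner_dualIso]
  rfl

lemma adjoint_fderiv_gradient {x : Rd d} (h : ContDiffAt ℝ 2 φ x) :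
    (fderiv ℝ (∇ φ) x).adjoint = fderiv ℝ (∇ φ) x := by
  have hs := h.isSymmSndFDerivAt (by simp)
  ext1 v
  refine ext_inner_right ℝ fun w => ?_
  rw [ContinuousLinearMap.adjoint_inner_left, fderiv_gradient, fderiv_gradient, inner_dualIso,
    real_inner_comm, inner_dualIso]
  exact hs w v

lemma gradient_laplacian {x : Rd d} (h : DifferentiableAt ℝ (fderiv ℝ (∇ φ)) x) :
    ∇ (Laplacian.laplacian φ) x = dualIso (traceL.comp (fderiv ℝ (fderiv ℝ (∇ φ)) x)) := by
  rw [gradient_eq_dualIso, show Laplacian.laplacian φ = fun x => traceL (fderiv ℝ (∇ φ) x) from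
    funext (laplacian_eq_traceL φ)]
  congr 1
  exact (traceL.hasFDerivAt.comp x h.hasFDerivAt).fderiv

lemma ContDiffOn.gradient (hΩ : IsOpen Ω) (h : ContDiffOn ℝ ∞ φ Ω) : ContDiffOn ℝ ∞ (∇ φ) Ω :=
  dualIso.contDiff.comp_contDiffOn (h.fderiv_of_isOpen hΩ (by simp))

/-- For `V = ∇ φ` the matrix `DV` is the symmetric Hessian, so the adjoint disappears; its trace is
the Laplacian, and the derivative of that trace gives `∇Δφ`. -/
lemma firstVariation_gradient_eq_weakN (hΩ : IsOpen Ω) (h : ContDiffOn ℝ ∞ φ Ω)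
    (F : Rd d × ℝ × Rd d → ℝ) (u : Rd d → ℝ) {x : Rd d} (hx : x ∈ Ω) :
    firstVariation Ω F (∇ φ) u (weakGrad Ω u) x = weakN Ω F u φ x := by
  have h2 : ContDiffAt ℝ 2 φ x := (h.contDiffAt (hΩ.mem_nhds hx)).of_le
    (WithTop.coe_le_coe.2 (le_top : (2 : ℕ∞) ≤ ⊤))
  have h3 : DifferentiableAt ℝ (fderiv ℝ (∇ φ)) x :=
    (((ContDiffOn.gradient hΩ h).fderiv_of_isOpen hΩ (m := ∞) (by simp)).contDiffAt
      (hΩ.mem_nhds hx)).differentiableAt (by simp)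
  rw [firstVariation, weakN, DF_apply, gradVelocity, adjoint_fderiv_gradient h2,
    gradient_laplacian h3, laplacian_eq_traceL, map_neg]
  simp only [map_add]
  ring

/-! ### Bounds by the `C²` norm -/

lemma iteratedFDeriv_le_supDeriv (hΩ : IsSmoothConvexDomain Ω) (hφ : ContDiffOn ℝ ∞ φ (closure Ω))
    (k : ℕ) {x : Rd d} (hx : x ∈ Ω) : ‖iteratedFDeriv ℝ k φ x‖ ≤ supDeriv Ω φ k := by
  have hk : (k : WithTop ℕ∞) ≤ ((⊤ : ℕ∞) : WithTop ℕ∞) := WithTop.coe_le_coe.2 (le_top : (k : ℕ∞) ≤ ⊤)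
  obtain ⟨B, hB⟩ := hΩ.isCompact_closure.exists_bound_of_continuousOn
    (hφ.continuousOn_iteratedFDerivWithin hk hΩ.uniqueDiffOn_closure)
  refine le_ciSup (f := fun x : Ω => ‖iteratedFDeriv ℝ k φ x‖) ⟨B, ?_⟩ ⟨x, hx⟩
  rintro _ ⟨⟨y, hy⟩, rfl⟩
  have hc : ContDiffAt ℝ k φ y := (hφ.contDiffAt
    (Filter.mem_of_superset (hΩ.isOpen.mem_nhds hy) subset_closure)).of_le hk
  have := hB y (subset_closure hy)
  rwa [iteratedFDerivWithin_eq_iteratedFDeriv hΩ.uniqueDiffOn_closure hc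
    (subset_closure hy)] at this

lemma abs_le_normC2 (hΩ : IsSmoothConvexDomain Ω) (hφ : ContDiffOn ℝ ∞ φ (closure Ω)) {x : Rd d}
    (hx : x ∈ Ω) : |φ x| ≤ normC2 Ω φ := by
  have := iteratedFDeriv_le_supDeriv hΩ hφ 0 hx
  rw [norm_iteratedFDeriv_zero] at this
  exact this.trans (le_max_left _ _)

lemma normC2_nonneg (hΩ : IsSmoothConvexDomain Ω) (hφ : ContDiffOn ℝ ∞ φ (closure Ω)) :
    0 ≤ normC2 Ω φ := by
  obtain ⟨x, hx⟩ := hΩ.nonempty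
  exact (abs_nonneg _).trans (abs_le_normC2 hΩ hφ hx)

lemma norm_fderiv_fderiv_le_normC2 (hΩ : IsSmoothConvexDomain Ω)
    (hφ : ContDiffOn ℝ ∞ φ (closure Ω)) {x : Rd d} (hx : x ∈ Ω) :
    ‖fderiv ℝ (fderiv ℝ φ) x‖ ≤ normC2 Ω φ := by
  have := iteratedFDeriv_le_supDeriv hΩ hφ 2 hx
  rw [← norm_iteratedFDeriv_fderiv, norm_iteratedFDeriv_one] at this
  exact this.trans ((le_max_right _ _).trans (le_max_right _ _))

lemma normC2_neg (Ω : Set (Rd d)) (φ : Rd d → ℝ) : normC2 Ω (-φ) = normC2 Ω φ := by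
  have h : ∀ k, supDeriv Ω (-φ) k = supDeriv Ω φ k := fun k => by
    simp only [supDeriv, iteratedFDeriv_neg, Pi.neg_apply, norm_neg]
  simp only [normC2, h]

lemma IsNeumannTest.neg (hΩ : IsSmoothConvexDomain Ω) (h : IsNeumannTest Ω φ) : IsNeumannTest Ω (-φ) where
  smooth := h.smooth.neg
  neumann x hx n hn := by
    rw [fderivWithin_neg (hΩ.uniqueDiffOn_closure x (frontier_subset_closure hx)),
      neg_apply, h.neumann x hx n hn, neg_zero]

/-- Taylor's formula with the sharp factor `1 / 2`, on which the constant of the theorem depends. It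
comes from comparing derivatives along the segment rather than from the mean value inequality, which
would lose the factor. -/
lemma abs_sub_sub_fderiv_le {E : Type*} [NormedAddCommGroup E] [NormedSpace ℝ E] {Ω : Set E}
    (hΩ : IsOpen Ω) (hc : Convex ℝ Ω) {φ : E → ℝ} (hφ : ContDiffOn ℝ 2 φ Ω) {H : ℝ}
    (hH : ∀ x ∈ Ω, ‖fderiv ℝ (fderiv ℝ φ) x‖ ≤ H) {x y : E} (hx : x ∈ Ω) (hy : y ∈ Ω) :
    |φ y - φ x - fderiv ℝ φ x (y - x)| ≤ H / 2 * ‖y - x‖ ^ 2 := by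
  set f : ℝ → ℝ := fun t => φ (x + t • (y - x)) - φ x - t * fderiv ℝ φ x (y - x) with hf
  set f' : ℝ → ℝ := fun t => (fderiv ℝ φ (x + t • (y - x)) - fderiv ℝ φ x) (y - x) with hf'
  have hmem : ∀ t ∈ Icc (0 : ℝ) 1, x + t • (y - x) ∈ Ω := fun t ht =>
    hc.add_smul_sub_mem hx hy ht
  have hd : ∀ t ∈ Icc (0 : ℝ) 1, HasDerivAt f (f' t) t := by
    intro t ht
    have h1 : HasFDerivAt φ (fderiv ℝ φ (x + t • (y - x))) (x + t • (y - x)) :=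
      ((hφ.contDiffAt (hΩ.mem_nhds (hmem t ht))).differentiableAt (by simp)).hasFDerivAt
    have h2 : HasDerivAt (fun t : ℝ => x + t • (y - x)) (y - x) t := by
      simpa using ((hasDerivAt_id t).smul_const (y - x)).const_add x
    have h3 := ((h1.comp_hasDerivAt t h2).sub_const (φ x)).sub
      ((hasDerivAt_id t).mul_const (fderiv ℝ φ x (y - x)))
    convert! h3 using 1
    simp [hf']
  have hb : ∀ t ∈ Icc (0 : ℝ) 1, ‖f' t‖ ≤ H * ‖y - x‖ ^ 2 * t := by
    intro t ht
    have h1 : ‖fderiv ℝ φ (x + t • (y - x)) - fderiv ℝ φ x‖ ≤ H * ‖x + t • (y - x) - x‖ :=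
      hc.norm_image_sub_le_of_norm_fderiv_le (fun z hz =>
        ((hφ.fderiv_of_isOpen hΩ (m := 1) (by norm_num)).contDiffAt
          (hΩ.mem_nhds hz)).differentiableAt (by simp)) hH hx (hmem t ht)
    rw [add_sub_cancel_left, norm_smul, Real.norm_of_nonneg ht.1] at h1
    refine (ContinuousLinearMap.le_opNorm _ _).trans
      ((mul_le_mul_of_nonneg_right h1 (norm_nonneg _)).trans (le_of_eq (by ring)))
  have := image_norm_le_of_norm_deriv_right_le_deriv_boundary (f := f) (f' := f') (a := 0) (b := 1)
    (B := fun t => H / 2 * ‖y - x‖ ^ 2 * t ^ 2) (B' := fun t => H * ‖y - x‖ ^ 2 * t)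
    (fun t ht => (hd t ht).continuousAt.continuousWithinAt)
    (fun t ht => (hd t (Ico_subset_Icc_self ht)).hasDerivWithinAt) (by simp [hf])
    (fun t => by
      convert! (hasDerivAt_pow 2 t).const_mul (H / 2 * ‖y - x‖ ^ 2) using 1
      simp; ring)
    (fun t ht => hb t (Ico_subset_Icc_self ht)) (right_mem_Icc.2 zero_le_one)
  simpa [hf] using this

/-- The squared distance along the inverse of a gradient variation. -/
lemma IsVariation.norm_invFunOn_sub_sq_le {M s₀ C : ℝ} {S : ℝ → Rd d → Rd d}
    (hΩ : IsSmoothConvexDomain Ω) (hφ : ContDiffOn ℝ ∞ φ (closure Ω))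
    (hV : IsTestField Ω (∇ φ) M) (hS : IsVariation Ω (∇ φ) S s₀ C) (hC : 0 ≤ C) {R : ℝ}
    (hR : ∀ x ∈ Ω, ∀ y ∈ Ω, ‖x - y‖ ≤ R) : ∃ A : ℝ, ∀ s, 0 < s → s ≤ s₀ → ∀ x ∈ S s '' Ω,
      ∀ y ∈ Ω, ‖Function.invFunOn (S s) Ω x - y‖ ^ 2 ≤
        (1 + s * normC2 Ω φ) * ‖x - y‖ ^ 2 + 2 * s * (φ x - φ y) + A * s ^ 2 := by
  refine ⟨2 * R * (C + M * (C + M)) + (C + M) ^ 2, ?_⟩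
  rintro s hs hs1 _ ⟨w, hw, rfl⟩ y hy
  have hss₀ : |s| ≤ s₀ := by rwa [abs_of_pos hs]
  have hemb := hS.emb s hs.ne' hss₀
  rw [hemb.invFunOn_apply hw]
  obtain ⟨h1, h2⟩ := hS.norm_invFunOn_sub_le hΩ hV hC hs.ne' hss₀ hw
  rw [abs_of_pos hs] at h1
  set x := S s w with hx
  have hxΩ : x ∈ Ω := hemb.mapsTo hw
  have ht := abs_le.1 (abs_sub_sub_fderiv_le hΩ.isOpen hΩ.convex
    ((hφ.mono subset_closure).of_le (WithTop.coe_le_coe.2 (le_top : (2 : ℕ∞) ≤ ⊤)))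
    (fun z hz => norm_fderiv_fderiv_le_normC2 hΩ hφ hz) hxΩ hy)
  -- Up to `O(s²)`, `w - x` is `s ∇φ(x)`, and Taylor's formula bounds `⟨x - y, ∇φ(x)⟩` by `φ x - φ y
  -- + normC2/2 · ‖x - y‖²`.
  have e : ‖w - y‖ ^ 2 = ‖x - y‖ ^ 2 + 2 * inner ℝ (x - y) (w - x - s • ∇ φ x)
      - 2 * s * fderiv ℝ φ x (y - x) + ‖w - x‖ ^ 2 := by
    have e1 : w - y = (x - y) + (w - x) := by abel
    have e2 : fderiv ℝ φ x (y - x) = -inner ℝ (x - y) (∇ φ x) := by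
      rw [real_inner_comm, gradient_eq_dualIso, inner_dualIso, ← map_neg, neg_sub]
    rw [e1, norm_add_sq_real, inner_sub_right (x - y) (w - x), real_inner_smul_right, e2]
    ring
  have hR0 : 0 ≤ R := (norm_nonneg _).trans (hR x hxΩ y hy)
  have i1 : inner ℝ (x - y) (w - x - s • ∇ φ x) ≤ R * ((C + M * (C + M)) * s ^ 2) :=
    (real_inner_le_norm _ _).trans (mul_le_mul (hR x hxΩ y hy) h2 (norm_nonneg _) hR0)
  have i2 : ‖w - x‖ ^ 2 ≤ ((C + M) * s) ^ 2 := pow_le_pow_left₀ (norm_nonneg _) h1 2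
  have i3 : s * (φ y - φ x - fderiv ℝ φ x (y - x)) ≤ s * (normC2 Ω φ / 2 * ‖y - x‖ ^ 2) :=
    mul_le_mul_of_nonneg_left ht.2 hs.le
  rw [norm_sub_rev y x] at i3
  rw [e]
  linear_combination 2 * i1 + i2 + 2 * i3

end JKO

/-! ### The competitor tested in the minimality condition: estimates for one step -/

namespace JKO

open Filter Topology

variable {d : ℕ} {Ω : Set (Rd d)}

lemma IsSmoothEmbedding.exists_measurable_inverse {S : Rd d → Rd d}
    (hS : IsSmoothEmbedding Ω S) : ∃ X : Rd d → Rd d, Measurable X ∧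
      EqOn X (Function.invFunOn S Ω) (S '' Ω) := by
  classical
  refine ⟨(S '' Ω).piecewise (Function.invFunOn S Ω) id, ?_, piecewise_eqOn _ _ _⟩
  refine ContinuousOn.measurable_piecewise ?_ continuousOn_id hS.measurableSet_image
  rintro _ ⟨y, hy, rfl⟩
  exact (hS.contDiffAt_invFunOn hy).continuousAt.continuousWithinAt

lemma IsSmoothEmbedding.det_mul_pulledEnergy {S : Rd d → Rd d} (hS : IsSmoothEmbedding Ω S)
    (F : Rd d × ℝ × Rd d → ℝ) (u : Rd d → ℝ) (g : Rd d → Rd d) (l : ℝ) {y : Rd d} (hy : y ∈ Ω) :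
    (fderiv ℝ S y).det * pulledEnergy Ω F S u g l (S y) =
      F (y, pullDensity S u l y, pullGrad S u g l y) := by
  rw [pulledEnergy, hS.invFunOn_apply hy, mul_div_cancel₀ _ (hS.det_pos y hy).ne']

/-- The energy of the competitor. -/
lemma IsVariation.energy_pull {V : Rd d → Rd d} {M s₀ C : ℝ} {S : ℝ → Rd d → Rd d}
    (hΩ : IsSmoothConvexDomain Ω) (hV : IsTestField Ω V M) (hS : IsVariation Ω V S s₀ C)
    (hC : 0 ≤ C) {F : Rd d × ℝ × Rd d → ℝ} (hF : LagrangianAssumption Ω F) {u : Rd d → ℝ}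
    (hH : MemH1 Ω u) {s : ℝ} (hs0 : s ≠ 0) (hs : |s| ≤ s₀) {l : ℝ}
    (hv : IsProbDensity Ω (pullDensity (S s) u l)) :
    IntegrableOn (pulledEnergy Ω F (S s) u (weakGrad Ω u) l) (S s '' Ω) ∧
      0 ≤ ∫ x in S s '' Ω, pulledEnergy Ω F (S s) u (weakGrad Ω u) l x ∧
      energy Ω F (densityMeasure Ω (pullDensity (S s) u l)) =
        ENNReal.ofReal (∫ x in S s '' Ω, pulledEnergy Ω F (S s) u (weakGrad Ω u) l x) := by
  have hemb := hS.emb s hs0 hs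
  have hΩm := hΩ.isOpen.measurableSet
  obtain ⟨k, hk0, hk⟩ := hS.exists_first_order_bound hΩ hV hC
  have hks : 0 ≤ k * |s| := by positivity
  have hg := hH.memLp_weakGrad hΩ.isOpen
  obtain ⟨hvL, hgL⟩ := hemb.memLp_pull hΩ.volume_lt_top (a := 1 / 2) (J := 1 + k * |s|)
    (by norm_num) (hS.half_le_det s hs0 hs)
    (fun y hy => by have := (abs_le.1 (hk s hs0 hs y hy).2.1).2; linarith)
    (fun y hy => by
      have h1 := norm_add_le (fderiv ℝ (S s) y - 1) 1
      rw [sub_add_cancel] at h1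
      have h2 : ‖(1 : Rd d →L[ℝ] Rd d)‖ ≤ 1 := ContinuousLinearMap.norm_id_le
      linarith [(hk s hs0 hs y hy).2.2.1])
    (fun y hy => by linarith [(hk s hs0 hs y hy).2.2.2]) hH.1 hg l
  have hwg := hemb.isWeakGrad_pull hΩ.volume_lt_top hH.1 hg hH.isWeakGrad hgL
  have hvH : MemH1 Ω (pullDensity (S s) u l) := ⟨hvL, _, hwg, hgL⟩
  have hae := hvH.isWeakGrad.ae_eq hΩ.isOpen hwg
  obtain ⟨hi, hnn⟩ := hF.integrableOn hΩ hv.aemeasurable hv.nonneg hgL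
  have hcongr : (fun y => F (y, pullDensity (S s) u l y, pullGrad (S s) u (weakGrad Ω u) l y))
      =ᵐ[volume.restrict Ω] fun y => (fderiv ℝ (S s) y).det *
        pulledEnergy Ω F (S s) u (weakGrad Ω u) l (S s y) := by
    filter_upwards [ae_restrict_mem hΩm] with y hy
    rw [hemb.det_mul_pulledEnergy F u _ l hy]
  have h_int : ∫ x in S s '' Ω, pulledEnergy Ω F (S s) u (weakGrad Ω u) l x =
      ∫ y in Ω, F (y, pullDensity (S s) u l y, pullGrad (S s) u (weakGrad Ω u) l y) := by
    rw [hemb.integral_image, integral_congr_ae hcongr]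
  refine ⟨(hemb.integrableOn_image_iff _).2 (Integrable.congr hi hcongr), ?_, ?_⟩
  · rw [h_int]
    exact integral_nonneg_of_ae hnn
  · rw [energy_eq_ofReal_integral hΩ hF hv hvH, h_int]
    congr 1
    refine integral_congr_ae ?_
    filter_upwards [hae] with y hy
    rw [hy]

/-- Only the right-hand side has to be known finite; the inequality transfers this to the left. -/
lemma add_toReal_le_of_ofReal_mul_add_le {c a b : ℝ} {W W' : ℝ≥0∞} (hc : 0 ≤ c)
    (ha : 0 ≤ a) (hb : 0 ≤ b) (hW' : W' ≠ ⊤)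
    (h : ENNReal.ofReal c * W + ENNReal.ofReal a ≤ ENNReal.ofReal c * W' + ENNReal.ofReal b) :
    c * W.toReal + a ≤ c * W'.toReal + b := by
  have hr : ENNReal.ofReal c * W' + ENNReal.ofReal b ≠ ⊤ := by
    finiteness
  have h1 := ENNReal.toReal_mono hr h
  have hl := ne_top_of_le_ne_top hr h
  rw [ENNReal.toReal_add (ne_top_of_le_ne_top hl le_self_add)
      (ne_top_of_le_ne_top hl le_add_self), ENNReal.toReal_add (by finiteness) (by finiteness),
    ENNReal.toReal_mul, ENNReal.toReal_mul, ENNReal.toReal_ofReal hc, ENNReal.toReal_ofReal ha,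
    ENNReal.toReal_ofReal hb] at h1
  exact h1

lemma IsProbDensity.integrable_densityMeasure (hΩ : MeasurableSet Ω) {u : Rd d → ℝ}
    (hu : IsProbDensity Ω u)
    {φ : Rd d → ℝ} (hφ : ContinuousOn φ Ω) {B : ℝ} (hB : ∀ x ∈ Ω, |φ x| ≤ B) :
    Integrable φ (densityMeasure Ω u) := by
  have := (hu.isProbOn hΩ).prob
  have hac : densityMeasure Ω u ≪ volume.restrict Ω := withDensity_absolutelyContinuous _ _
  refine Integrable.mono' (integrable_const B) ((hφ.aestronglyMeasurable hΩ).mono_ac hac) ?_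
  exact hac.ae_le ((ae_restrict_mem hΩ).mono fun x hx => hB x hx)

/-- The factor is `1 / (1 - m)`, so its excess over `1` is `m / (1 - m)`, which is `o(s)` together
with `m`. -/
lemma IsVariation.tendsto_normalization {V : Rd d → Rd d} {M s₀ C : ℝ} {S : ℝ → Rd d → Rd d}
    (hΩ : IsSmoothConvexDomain Ω) (hV : IsTestField Ω V M) (hS : IsVariation Ω V S s₀ C)
    (hs₀ : 0 < s₀) (hC : 0 ≤ C) {u : Rd d → ℝ} (hu : IsProbDensity Ω u)
    (hu2 : MemLp u 2 (volume.restrict Ω)) :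
    (∀ᶠ s in 𝓝[>] (0 : ℝ), ∫ x in Ω \ S s '' Ω, u x < 1) ∧
    Tendsto (fun s => s⁻¹ • ((1 - ∫ x in Ω \ S s '' Ω, u x)⁻¹ - 1)) (𝓝[>] 0) (𝓝 0) := by
  have h := hS.tendsto_missing_mass hΩ hV hs₀ hC hu.integrableOn hu2.integrable_sq hu.nonneg
  have hid : Tendsto (fun s : ℝ => s) (𝓝[>] 0) (𝓝 0) := tendsto_id.mono_left nhdsWithin_le_nhds
  have hm : Tendsto (fun s => ∫ x in Ω \ S s '' Ω, u x) (𝓝[>] 0) (𝓝 0) := by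
    have h1 := h.mul hid
    rw [zero_mul] at h1
    refine h1.congr' ?_
    filter_upwards [self_mem_nhdsWithin] with s hs
    exact div_mul_cancel₀ _ (ne_of_gt hs)
  have hlt := hm.eventually (gt_mem_nhds zero_lt_one)
  refine ⟨hlt, ?_⟩
  have h2 : Tendsto (fun s => (∫ x in Ω \ S s '' Ω, u x) / s *
      (1 - ∫ x in Ω \ S s '' Ω, u x)⁻¹) (𝓝[>] 0) (𝓝 0) := by
    simpa using h.mul ((hm.const_sub 1).inv₀ (by norm_num))
  refine h2.congr' ?_
  filter_upwards [hlt] with s hs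
  have : (1 - ∫ x in Ω \ S s '' Ω, u x) ≠ 0 := by linarith
  rw [smul_eq_mul]
  field_simp
  ring

/-- The energy of the competitor in terms of the difference quotient of the energy density. -/
lemma integral_image_sub_le {S : Rd d → Rd d} (hS : IsSmoothEmbedding Ω S) {s : ℝ} (hs : 0 < s)
    {f p : Rd d → ℝ} (hf : IntegrableOn f Ω) (hf0 : ∀ᵐ x ∂(volume.restrict Ω), 0 ≤ f x)
    (hp : IntegrableOn p (S '' Ω)) : (∫ x in S '' Ω, p x) - ∫ x in Ω, f x ≤
      s * ∫ x in Ω, (S '' Ω).indicator (fun x => s⁻¹ * (p x - f x)) x := by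
  have hsub := hS.mapsTo.image_subset
  have hfS : IntegrableOn f (S '' Ω) := hf.mono_set hsub
  rw [setIntegral_indicator hS.measurableSet_image, inter_eq_self_of_subset_right hsub,
    integral_const_mul, ← mul_assoc, mul_inv_cancel₀ hs.ne', one_mul, integral_sub hp hfS]
  -- The original energy on the part missed by `S` is dropped; being nonnegative, it only helps.
  have := setIntegral_mono_set hf hf0 hsub.eventuallyLE
  linarith

end JKO

namespace JKO

open Filter Topology

variable {d : ℕ} {Ω : Set (Rd d)}

lemma IsSmoothConvexDomain.exists_norm_sub_le (hΩ : IsSmoothConvexDomain Ω) :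
    ∃ R, ∀ x ∈ Ω, ∀ y ∈ Ω, ‖x - y‖ ≤ R := by
  obtain ⟨R, hR⟩ := Metric.isBounded_iff.1 hΩ.bounded
  exact ⟨R, fun x hx y hy => by rw [← dist_eq_norm]; exact hR hx hy⟩

/-- Comparison of a minimizer of the Yosida penalization with its perturbation along a gradient. -/
lemma IsVariation.minimality {φ : Rd d → ℝ} {M s₀ C : ℝ} {S : ℝ → Rd d → Rd d}
    (hΩ : IsSmoothConvexDomain Ω) (hφ : ContDiffOn ℝ ∞ φ (closure Ω))
    (hV : IsTestField Ω (∇ φ) M) (hS : IsVariation Ω (∇ φ) S s₀ C) (hC : 0 ≤ C)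
    {F : Rd d × ℝ × Rd d → ℝ} (hF : LagrangianAssumption Ω F) {τ : ℝ} (hτ : 0 < τ)
    {u w : Rd d → ℝ} (hu : IsProbDensity Ω u) (hH : MemH1 Ω u) (hw : IsProbDensity Ω w)
    (hmin : ∀ ν, IsProbOn Ω ν → yosida Ω F τ (densityMeasure Ω u) (densityMeasure Ω w) ≤
      yosida Ω F τ ν (densityMeasure Ω w)) {R : ℝ} (hR : ∀ x ∈ Ω, ∀ y ∈ Ω, ‖x - y‖ ≤ R)
    {A : ℝ} (hA0 : 0 ≤ A) {s : ℝ} (hs0 : 0 < s) (hs : s ≤ s₀)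
    (hA : ∀ x ∈ S s '' Ω, ∀ y ∈ Ω, ‖Function.invFunOn (S s) Ω x - y‖ ^ 2 ≤
        (1 + s * normC2 Ω φ) * ‖x - y‖ ^ 2 + 2 * s * (φ x - φ y) + A * s ^ 2)
    {m : ℝ} (hm : m = ∫ x in Ω \ S s '' Ω, u x) (hm1 : m < 1) :
    IntegrableOn (pulledEnergy Ω F (S s) u (weakGrad Ω u) (1 - m)⁻¹) (S s '' Ω) ∧
    0 ≤ 1 / (2 * τ) * (normC2 Ω φ * (W2 (densityMeasure Ω u) (densityMeasure Ω w) ^ 2).toReal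
        + 2 * ((∫ x in Ω, u x * φ x) - ∫ x in Ω, w x * φ x) + A * s
        + (R ^ 2 + 4 * s * normC2 Ω φ) * (m / s))
      + ∫ x in Ω, (S s '' Ω).indicator (fun x => s⁻¹ *
          (pulledEnergy Ω F (S s) u (weakGrad Ω u) (1 - m)⁻¹ x - F (x, u x, weakGrad Ω u x))) x := by
  have hΩm := hΩ.isOpen.measurableSet
  have hss : |s| ≤ s₀ := by rwa [abs_of_pos hs0]
  have hemb := hS.emb s hs0.ne' hss
  have hφc : ContinuousOn φ Ω := hφ.continuousOn.mono subset_closure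
  have hφb : ∀ x ∈ Ω, |φ x| ≤ normC2 Ω φ := fun x hx => abs_le_normC2 hΩ hφ hx
  have hm0 : 0 ≤ m := by
    rw [hm]
    exact integral_nonneg_of_ae (ae_mono (Measure.restrict_mono sdiff_subset le_rfl) hu.nonneg)
  obtain ⟨X, hX, hXe⟩ := hemb.exists_measurable_inverse
  obtain ⟨hv, hred⟩ := isProbDensity_pull hemb hu hm hm1 hX fun y hy => by
    rw [hXe (mem_image_of_mem _ hy), hemb.invFunOn_apply hy]
  obtain ⟨hpi, hp0, hpe⟩ := hS.energy_pull hΩ hV hC hF hH hs0.ne' hss hv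
  refine ⟨hpi, ?_⟩
  obtain ⟨hFi, hF0⟩ := hF.integrableOn hΩ hu.aemeasurable hu.nonneg (hH.memLp_weakGrad hΩ.isOpen)
  have hy := hmin _ (hv.isProbOn hΩm)
  rw [yosida, yosida, hpe, energy_eq_ofReal_integral hΩ hF hu hH] at hy
  have hcmp := add_toReal_le_of_ofReal_mul_add_le (by positivity) (integral_nonneg_of_ae hF0) hp0
    (W2_sq_ne_top hΩm hR (hv.isProbOn hΩm) (hw.isProbOn hΩm)) hy
  have hW := W2_sq_redistribute_le hΩm hR (hu.isProbOn hΩm) (hw.isProbOn hΩm) (hv.isProbOn hΩm)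
    hemb.measurableSet_image hX hred hφb (hu.integrable_densityMeasure hΩm hφc hφb)
    (hw.integrable_densityMeasure hΩm hφc hφb) hs0.le (normC2_nonneg hΩ hφ)
    (a := A * s ^ 2) (by positivity) fun x hx _ y hy => by rw [hXe hx]; exact hA x hx y hy
  rw [densityMeasure_compl_image hemb hu, ← hm, ENNReal.toReal_ofReal hm0,
    hu.integral_densityMeasure, hw.integral_densityMeasure] at hW
  have hE := integral_image_sub_le hemb hs0 hFi hF0 hpi
  set W := (W2 (densityMeasure Ω u) (densityMeasure Ω w) ^ 2).toReal
  set I := ∫ x in Ω, (S s '' Ω).indicator (fun x => s⁻¹ *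
    (pulledEnergy Ω F (S s) u (weakGrad Ω u) (1 - m)⁻¹ x - F (x, u x, weakGrad Ω u x))) x
  have hW2 := mul_le_mul_of_nonneg_left hW (by positivity : 0 ≤ 1 / (2 * τ))
  -- The claim is the comparison of the two Yosida values divided by `s`, so `s` is multiplied back.
  refine nonneg_of_mul_nonneg_right (a := s) ?_ hs0
  have e : s * (m / s) = m := mul_div_cancel₀ m hs0.ne'
  have e2 : s * (1 / (2 * τ) * (normC2 Ω φ * W
        + 2 * ((∫ x in Ω, u x * φ x) - ∫ x in Ω, w x * φ x) + A * s
        + (R ^ 2 + 4 * s * normC2 Ω φ) * (m / s)) + I) =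
      1 / (2 * τ) * (s * normC2 Ω φ * W
        + 2 * s * ((∫ x in Ω, u x * φ x) - ∫ x in Ω, w x * φ x) + A * s ^ 2
        + (R ^ 2 + 4 * s * normC2 Ω φ) * (s * (m / s))) + s * I := by ring
  rw [e2, e]
  linear_combination hcmp + hW2 + hE

/-- The one-sided discrete weak formulation for one step of the scheme. -/
lemma weak_formulation_step_le (hΩ : IsSmoothConvexDomain Ω)
    {F : Rd d × ℝ × Rd d → ℝ} (hF : LagrangianAssumption Ω F) {τ : ℝ} (hτ : 0 < τ)
    {u w : Rd d → ℝ} (hu : IsProbDensity Ω u) (hH : MemH1 Ω u) (hw : IsProbDensity Ω w)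
    (hmin : ∀ ν, IsProbOn Ω ν → yosida Ω F τ (densityMeasure Ω u) (densityMeasure Ω w) ≤
      yosida Ω F τ ν (densityMeasure Ω w)) {φ : Rd d → ℝ} (hφ : IsNeumannTest Ω φ) :
    IntegrableOn (weakN Ω F u φ) Ω ∧
    0 ≤ 1 / (2 * τ) * (normC2 Ω φ * (W2 (densityMeasure Ω u) (densityMeasure Ω w) ^ 2).toReal
        + 2 * ((∫ x in Ω, u x * φ x) - ∫ x in Ω, w x * φ x)) + ∫ x in Ω, weakN Ω F u φ x := by
  have hΩm := hΩ.isOpen.measurableSet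
  obtain ⟨R, hR⟩ := hΩ.exists_norm_sub_le
  obtain ⟨M, hV⟩ := hφ.exists_isTestField hΩ
  obtain ⟨S, s₀, C, hs₀, hC, hS⟩ := hV.exists_isVariation hΩ
  obtain ⟨A', hA'⟩ := hS.norm_invFunOn_sub_sq_le hΩ hφ.smooth hV hC hR
  obtain ⟨A, hA0, hA⟩ : ∃ A : ℝ, 0 ≤ A ∧ ∀ s, 0 < s → s ≤ s₀ → ∀ x ∈ S s '' Ω,
      ∀ y ∈ Ω, ‖Function.invFunOn (S s) Ω x - y‖ ^ 2 ≤
        (1 + s * normC2 Ω φ) * ‖x - y‖ ^ 2 + 2 * s * (φ x - φ y) + A * s ^ 2 := by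
    refine ⟨|A'|, abs_nonneg _, fun s hs0 hs x hx y hy => (hA' s hs0 hs x hx y hy).trans ?_⟩
    gcongr
    exact le_abs_self A'
  obtain ⟨hlt, hl⟩ := hS.tendsto_normalization hΩ hV hs₀ hC hu hH.1
  have hmm := hS.tendsto_missing_mass hΩ hV hs₀ hC hu.integrableOn hH.1.integrable_sq hu.nonneg
  have hev := (hlt.and (Ioc_mem_nhdsGT hs₀)).mono fun s hs =>
    hS.minimality hΩ hφ.smooth hV hC hF hτ hu hH hw hmin hR hA0 hs.2.1 hs.2.2
      (hA s hs.2.1 hs.2.2) rfl hs.1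
  obtain ⟨hi, ht⟩ := hS.tendsto_integral_pulledEnergy hΩ hV hs₀ hC hF hl hu.nonneg hH.1
    (hH.memLp_weakGrad hΩ.isOpen) (hev.mono fun s hs => hs.1)
  have hN : EqOn (firstVariation Ω F (∇ φ) u (weakGrad Ω u)) (weakN Ω F u φ) Ω := fun x hx =>
    firstVariation_gradient_eq_weakN hΩ.isOpen (hφ.smooth.mono subset_closure) F u hx
  refine ⟨hi.congr_fun hN hΩm, ?_⟩
  rw [← setIntegral_congr_fun hΩm hN]
  have hid : Tendsto (fun s : ℝ => s) (𝓝[>] 0) (𝓝 0) := tendsto_id.mono_left nhdsWithin_le_nhds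
  -- The error `A * s` and the redistribution cost, proportional to `m / s`, vanish in the limit.
  have hlim := ((((hid.const_mul A).const_add (normC2 Ω φ *
    (W2 (densityMeasure Ω u) (densityMeasure Ω w) ^ 2).toReal
        + 2 * ((∫ x in Ω, u x * φ x) - ∫ x in Ω, w x * φ x))).add
      ((((hid.const_mul 4).mul_const (normC2 Ω φ)).const_add (R ^ 2)).mul hmm)).const_mul
        (1 / (2 * τ))).add ht
  rw [mul_zero, mul_zero, add_zero, add_zero] at hlim
  exact ge_of_tendsto hlim (hev.mono fun s hs => hs.2)

lemma weakN_neg (F : Rd d × ℝ × Rd d → ℝ) (u φ : Rd d → ℝ) (x : Rd d) :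
    weakN Ω F u (-φ) x = -weakN Ω F u φ x := by
  have h1 : ∇ (-φ) = -∇ φ := by
    funext y
    rw [Pi.neg_apply, gradient_eq_dualIso, gradient_eq_dualIso, fderiv_neg, map_neg]
  have h2 : Laplacian.laplacian (-φ) = -Laplacian.laplacian φ := by
    funext y
    rw [Pi.neg_apply, laplacian_eq_traceL, laplacian_eq_traceL, h1, fderiv_neg, map_neg]
  have h3 : ∇ (-Laplacian.laplacian φ) x = -∇ (Laplacian.laplacian φ) x := by
    rw [gradient_eq_dualIso, gradient_eq_dualIso, fderiv_neg, map_neg]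
  have h4 : fderiv ℝ (∇ (-φ)) x = -fderiv ℝ (∇ φ) x := by rw [h1, fderiv_neg]
  rw [weakN, weakN, h4, h2, h1, h3]
  simp only [Pi.neg_apply, map_neg, map_add, map_smul, smul_eq_mul, neg_apply]
  ring

/-- The discrete weak formulation for one step of the scheme. -/
lemma weak_formulation_step (hΩ : IsSmoothConvexDomain Ω)
    {F : Rd d × ℝ × Rd d → ℝ} (hF : LagrangianAssumption Ω F) {τ : ℝ} (hτ : 0 < τ)
    {u w : Rd d → ℝ} (hu : IsProbDensity Ω u) (hH : MemH1 Ω u) (hw : IsProbDensity Ω w)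
    (hmin : ∀ ν, IsProbOn Ω ν → yosida Ω F τ (densityMeasure Ω u) (densityMeasure Ω w) ≤
      yosida Ω F τ ν (densityMeasure Ω w)) {φ : Rd d → ℝ} (hφ : IsNeumannTest Ω φ) :
    |(∫ x in Ω, u x * φ x) - (∫ x in Ω, w x * φ x) + τ * ∫ x in Ω, weakN Ω F u φ x| ≤
      normC2 Ω φ / 2 * (W2 (densityMeasure Ω u) (densityMeasure Ω w) ^ 2).toReal := by
  have h1 := mul_le_mul_of_nonneg_left
    (weak_formulation_step_le hΩ hF hτ hu hH hw hmin hφ).2 hτ.le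
  -- Replacing `φ` by `-φ` reverses the linear terms and leaves the norm and the distance unchanged,
  -- which gives the other side of the absolute value.
  have h2 := mul_le_mul_of_nonneg_left
    (weak_formulation_step_le hΩ hF hτ hu hH hw hmin (hφ.neg hΩ)).2 hτ.le
  simp only [weakN_neg, normC2_neg, Pi.neg_apply, mul_neg, integral_neg] at h2
  have e : τ * (1 / (2 * τ)) = 1 / 2 := by field_simp
  rw [mul_add, ← mul_assoc, e] at h1 h2
  rw [abs_le]
  constructor
  · linear_combination h1
  · linear_combination h2

/-- The dissipation estimate for one step of the scheme. -/
lemma W2_sq_step_le (hΩ : IsSmoothConvexDomain Ω)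
    {F : Rd d × ℝ × Rd d → ℝ} (hF : LagrangianAssumption Ω F) {τ : ℝ} (hτ : 0 < τ)
    {u w : Rd d → ℝ} (hu : IsProbDensity Ω u) (hw : IsProbDensity Ω w) (hwH : MemH1 Ω w)
    (hmin : ∀ ν, IsProbOn Ω ν → yosida Ω F τ (densityMeasure Ω u) (densityMeasure Ω w) ≤
      yosida Ω F τ ν (densityMeasure Ω w)) :
    MemH1 Ω u ∧ (W2 (densityMeasure Ω u) (densityMeasure Ω w) ^ 2).toReal ≤
      2 * τ * ((energy Ω F (densityMeasure Ω w)).toReal -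
        (energy Ω F (densityMeasure Ω u)).toReal) := by
  have hΩm := hΩ.isOpen.measurableSet
  -- The previous density is its own competitor, at distance zero.
  have h := hmin _ (hw.isProbOn hΩm)
  have hE := energy_eq_ofReal_integral hΩ hF hw hwH
  rw [yosida, yosida, W2_self, mul_zero, zero_add] at h
  have hfin : energy Ω F (densityMeasure Ω w) ≠ ⊤ := by rw [hE]; exact ENNReal.ofReal_ne_top
  have hufin : energy Ω F (densityMeasure Ω u) ≠ ⊤ :=
    ne_top_of_le_ne_top hfin (le_add_self.trans h)
  refine ⟨memH1_of_energy_ne_top hu hufin, ?_⟩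
  have h1 := ENNReal.toReal_mono hfin h
  rw [ENNReal.toReal_add (ne_top_of_le_ne_top hfin (le_self_add.trans h)) hufin,
    ENNReal.toReal_mul, ENNReal.toReal_ofReal (by positivity)] at h1
  have h2 := mul_le_mul_of_nonneg_left h1 (by positivity : 0 ≤ 2 * τ)
  have e : 2 * τ * (1 / (2 * τ)) = 1 := by field_simp
  rw [mul_add, ← mul_assoc, e, one_mul] at h2
  linarith

end JKO

/-! ### Summation over the time steps -/

namespace JKO

open Filter Topology

lemma natCeil_div_eq_succ_iff {τ : ℝ} (hτ : 0 < τ) (t : ℝ) (n : ℕ) :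
    ⌈t / τ⌉₊ = n + 1 ↔ t ∈ Ioc (n * τ) ((n + 1) * τ) := by
  rw [Nat.ceil_eq_iff n.succ_ne_zero, lt_div_iff₀ hτ, div_le_iff₀ hτ]
  simp

/-- The space-time integral of a function that is constant in time on the intervals of length
`τ`. -/
lemma integrable_step {α : Type*} [MeasurableSpace α] {μ : Measure α} [SFinite μ] {τ : ℝ}
    (hτ : 0 < τ) {f : ℕ → α → ℝ} {g : ℝ → α → ℝ} (hg : ∀ t, 0 < t → g t = f ⌈t / τ⌉₊) {N : ℕ}
    (hf : ∀ n < N, Integrable (f (n + 1)) μ) (hN : ∀ n, N ≤ n → f (n + 1) = 0) :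
    Integrable (fun q : ℝ × α => g q.1 q.2) ((volume.restrict (Ioi 0)).prod μ) ∧
      ∫ t in Ioi (0 : ℝ), ∫ x, g t x ∂μ = τ * ∑ n ∈ Finset.range N, ∫ x, f (n + 1) x ∂μ := by
  set I : ℕ → ℝ → ℝ := fun n => (Ioc (n * τ) ((n + 1) * τ)).indicator 1 with hI
  have hsub : ∀ n : ℕ, Ioc (n * τ) ((n + 1) * τ) ⊆ Ioi (0 : ℝ) := fun n t ht =>
    lt_of_le_of_lt (by positivity) ht.1
  have hIi : ∀ n, IntegrableOn (I n) (Ioi 0) := fun n =>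
    (integrable_indicator_iff measurableSet_Ioc).2
      (integrableOn_const (by simp) (by simp)) |>.integrableOn
  have hIv : ∀ n, ∫ t in Ioi (0 : ℝ), I n t = τ := fun n => by
    rw [hI, setIntegral_indicator measurableSet_Ioc, inter_eq_self_of_subset_right (hsub n)]
    simp only [Pi.one_apply, setIntegral_const, smul_eq_mul, mul_one, Real.volume_real_Ioc]
    rw [max_eq_left (by linarith)]
    ring
  have hpt : ∀ t, 0 < t → ∀ x, g t x = ∑ n ∈ Finset.range N, I n t * f (n + 1) x := by
    intro t ht x
    have hpos : 0 < ⌈t / τ⌉₊ := Nat.ceil_pos.2 (by positivity)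
    obtain ⟨k, hk⟩ := Nat.exists_eq_succ_of_ne_zero hpos.ne'
    have hIk : ∀ n, I n t = if n = k then 1 else 0 := fun n => by
      have : t ∈ Ioc (n * τ) ((n + 1) * τ) ↔ n = k := by
        rw [← natCeil_div_eq_succ_iff hτ, hk]
        omega
      simp only [hI, indicator_apply, this, Pi.one_apply]
    simp only [hIk, ite_mul, one_mul, zero_mul, Finset.sum_ite_eq', Finset.mem_range]
    rw [hg t ht, hk]
    split_ifs with h
    · rfl
    · exact congrFun (hN k (not_lt.1 h)) x
  have hae : (fun q : ℝ × α => ∑ n ∈ Finset.range N, I n q.1 * f (n + 1) q.2)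
      =ᵐ[(volume.restrict (Ioi 0)).prod μ] fun q => g q.1 q.2 := by
    -- For `t > 0` the index `⌈t / τ⌉₊` is at least `1`; hence the functions enter as `f (n + 1)`,
    -- and `f 0` plays no role.
    have h1 : ∀ᵐ t ∂(volume.restrict (Ioi (0 : ℝ))), 0 < t := ae_restrict_mem measurableSet_Ioi
    filter_upwards [Measure.quasiMeasurePreserving_fst.ae h1] with q hq
    exact (hpt q.1 hq q.2).symm
  have h_int : ∀ n ∈ Finset.range N, Integrable (fun q : ℝ × α => I n q.1 * f (n + 1) q.2)
      ((volume.restrict (Ioi 0)).prod μ) := fun n hn =>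
    (hIi n).mul_prod (hf n (Finset.mem_range.1 hn))
  have hG := (integrable_finsetSum _ h_int).congr hae
  refine ⟨hG, ?_⟩
  rw [integral_integral hG, ← integral_congr_ae hae, integral_finsetSum _ h_int, Finset.mul_sum]
  refine Finset.sum_congr rfl fun n _ => ?_
  rw [integral_prod_mul, hIv]

lemma stepTest_add {τ : ℝ} (hτ : 0 < τ) (η : ℝ → ℝ) {t : ℝ} (ht : 0 < t) :
    stepTest τ η (t + τ) = η ((⌈t / τ⌉₊ + 1 : ℕ) * τ) := by
  rw [stepTest, add_div, div_self hτ.ne', Nat.ceil_add_one (by positivity)]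

lemma IsTimeTest.abs_le_normC0 {η : ℝ → ℝ} (hη : IsTimeTest η) (t : ℝ) : |η t| ≤ normC0 η := by
  obtain ⟨B, hB⟩ := hη.compact.exists_bound_of_continuous hη.smooth.continuous
  exact le_ciSup (f := fun t => |η t|) ⟨B, by rintro _ ⟨t, rfl⟩; exact hB t⟩ t

lemma IsTimeTest.exists_eq_zero {η : ℝ → ℝ} (hη : IsTimeTest η) {τ : ℝ} (hτ : 0 < τ) :
    ∃ N : ℕ, ∀ n, N ≤ n → η (n * τ) = 0 := by
  obtain ⟨B, hB⟩ := hη.compact.isCompact.bddAbove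
  refine ⟨⌈B / τ⌉₊ + 1, fun n hn => image_eq_zero_of_notMem_tsupport fun h => ?_⟩
  have h1 := hB h
  have h2 : B / τ < n := (Nat.le_ceil _).trans_lt (by exact_mod_cast hn)
  rw [div_lt_iff₀ hτ] at h2
  linarith

/-- Summation by parts. The initial boundary term becomes the one with `η τ`; the final one vanishes
as soon as `N` lies beyond the support of `η`. -/
lemma sum_range_mul_sub_eq (a e : ℕ → ℝ) (N : ℕ) :
    ∑ n ∈ Finset.range N, a (n + 1) * (e (n + 2) - e (n + 1)) + e 1 * a 0 =
      a N * e (N + 1) - ∑ n ∈ Finset.range N, e (n + 1) * (a (n + 1) - a n) := by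
  induction N with
  | zero => simp; ring
  | succ N ih =>
    rw [Finset.sum_range_succ, Finset.sum_range_succ]
    linear_combination ih

/-- The squared distances are bounded by energy drops, which telescope; the factor `2 * τ` cancels
the `1 / 2` of the one-step estimate. -/
lemma abs_sum_mul_le {e b w E : ℕ → ℝ} {B H τ : ℝ} (hB : 0 ≤ B) (hH : 0 ≤ H) (hτ : 0 ≤ τ)
    (he : ∀ n, |e n| ≤ B) (hb : ∀ n, |b n| ≤ H / 2 * w n) (hE : ∀ n, 0 ≤ E n)
    (hw : ∀ n, w n ≤ 2 * τ * (E n - E (n + 1))) (N : ℕ) :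
    |∑ n ∈ Finset.range N, e (n + 1) * b n| ≤ τ * H * B * E 0 := by
  calc |∑ n ∈ Finset.range N, e (n + 1) * b n|
      ≤ ∑ n ∈ Finset.range N, |e (n + 1) * b n| := Finset.abs_sum_le_sum_abs _ _
    _ ≤ ∑ n ∈ Finset.range N, τ * H * B * (E n - E (n + 1)) := by
        refine Finset.sum_le_sum fun n _ => ?_
        rw [abs_mul]
        have h1 : |b n| ≤ H / 2 * (2 * τ * (E n - E (n + 1))) :=
          (hb n).trans (mul_le_mul_of_nonneg_left (hw n) (by positivity))
        exact (mul_le_mul (he _) h1 (abs_nonneg _) hB).trans (le_of_eq (by ring))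
    _ = τ * H * B * (E 0 - E N) := by rw [← Finset.mul_sum, Finset.sum_range_sub']
    _ ≤ τ * H * B * E 0 := mul_le_mul_of_nonneg_left (by linarith [hE N]) (by positivity)

variable {d : ℕ} {Ω : Set (Rd d)}

/-- Membership in `H¹` propagates from step to step: the previous density has finite energy and is a
competitor. -/
lemma IsMinimizingMovement.memH1 (hΩ : IsSmoothConvexDomain Ω) {F : Rd d × ℝ × Rd d → ℝ}
    (hF : LagrangianAssumption Ω F) {u₀ : Rd d → ℝ} (hu₀ : MemH1 Ω u₀) {τ : ℝ} (hτ : 0 < τ)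
    {u : ℕ → Rd d → ℝ} (hu : IsMinimizingMovement Ω F τ u₀ u) (n : ℕ) : MemH1 Ω (u n) := by
  induction n with
  | zero => rwa [hu.zero]
  | succ n ih =>
    exact (W2_sq_step_le hΩ hF hτ (hu.prob (n + 1)) (hu.prob n) ih (hu.minimal n)).1

lemma IsProbDensity.integrableOn_mul (hΩ : MeasurableSet Ω) {u : Rd d → ℝ}
    (hu : IsProbDensity Ω u) {φ : Rd d → ℝ} (hφ : ContinuousOn φ Ω) {B : ℝ}
    (hB : ∀ x ∈ Ω, |φ x| ≤ B) : IntegrableOn (fun x => u x * φ x) Ω := by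
  refine Integrable.mono' (hu.integrableOn.norm.mul_const B)
    (hu.aemeasurable.aestronglyMeasurable.mul (hφ.aestronglyMeasurable hΩ)) ?_
  filter_upwards [ae_restrict_mem hΩ] with x hx
  rw [norm_mul]
  exact mul_le_mul_of_nonneg_left (hB x hx) (norm_nonneg _)

end JKO

theorem mainTheorem5 {d : ℕ} (hd : 1 ≤ d) (Ω : Set (JKO.Rd d)) (hΩ : JKO.IsSmoothConvexDomain Ω)
    (F : JKO.Rd d × ℝ × JKO.Rd d → ℝ) (hF : JKO.LagrangianAssumption Ω F)
    (u₀ : JKO.Rd d → ℝ) (hu₀ : JKO.IsProbDensity Ω u₀) (hu₀H : JKO.MemH1 Ω u₀)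
    (τ : ℝ) (hτ : 0 < τ) (u : ℕ → JKO.Rd d → ℝ) (hu : JKO.IsMinimizingMovement Ω F τ u₀ u)
    (φ : JKO.Rd d → ℝ) (hφ : JKO.IsNeumannTest Ω φ) (η : ℝ → ℝ) (hη : JKO.IsTimeTest η) :
    Integrable (fun q : ℝ × JKO.Rd d => JKO.discreteSolution τ u q.1 q.2 * φ q.2 *
        ((JKO.stepTest τ η (q.1 + τ) - JKO.stepTest τ η q.1) / τ))
      ((volume.restrict (Ioi 0)).prod (volume.restrict Ω)) ∧
    Integrable (fun q : ℝ × JKO.Rd d => JKO.weakN Ω F (JKO.discreteSolution τ u q.1) φ q.2 *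
        JKO.stepTest τ η q.1)
      ((volume.restrict (Ioi 0)).prod (volume.restrict Ω)) ∧
    |(∫ t in Ioi (0 : ℝ), ∫ x in Ω, JKO.discreteSolution τ u t x * φ x *
          ((JKO.stepTest τ η (t + τ) - JKO.stepTest τ η t) / τ))
        + η τ * (∫ x in Ω, u₀ x * φ x)
        - ∫ t in Ioi (0 : ℝ), ∫ x in Ω, JKO.weakN Ω F (JKO.discreteSolution τ u t) φ x *
            JKO.stepTest τ η t|
      ≤ τ * JKO.normC2 Ω φ * JKO.normC0 η * (JKO.energy Ω F (JKO.densityMeasure Ω u₀)).toReal := by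
  have hΩm := hΩ.isOpen.measurableSet
  have hφc : ContinuousOn φ Ω := hφ.smooth.continuousOn.mono subset_closure
  have hH := hu.memH1 hΩ hF hu₀H hτ
  obtain ⟨N, hN⟩ := hη.exists_eq_zero hτ
  obtain ⟨hA, hAv⟩ := JKO.integrable_step (μ := volume.restrict Ω) hτ
    -- On the interval where the solution equals `u n`, the forward shift by `τ` evaluates `η` at
    -- the next node, `(n + 1) τ`.
    (f := fun n x => u n x * φ x * ((η ((n + 1 : ℕ) * τ) - η (n * τ)) / τ))
    (g := fun t x => JKO.discreteSolution τ u t x * φ x *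
      ((JKO.stepTest τ η (t + τ) - JKO.stepTest τ η t) / τ)) (N := N)
    (fun t ht => by
      funext x
      rw [JKO.stepTest_add hτ η ht]
      rfl)
    (fun n _ => ((hu.prob (n + 1)).integrableOn_mul hΩm hφc
      fun x hx => JKO.abs_le_normC2 hΩ hφ.smooth hx).mul_const _)
    (fun n hn => by
      funext x
      simp only [hN (n + 1) (by omega), hN (n + 1 + 1) (by omega), sub_zero, zero_div, mul_zero,
        Pi.zero_apply])
  obtain ⟨hB, hBv⟩ := JKO.integrable_step (μ := volume.restrict Ω) hτ
    (f := fun n x => JKO.weakN Ω F (u n) φ x * η (n * τ))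
    (g := fun t x => JKO.weakN Ω F (JKO.discreteSolution τ u t) φ x * JKO.stepTest τ η t) (N := N)
    (fun t _ => rfl)
    (fun n _ => ((JKO.weak_formulation_step_le hΩ hF hτ (hu.prob (n + 1)) (hH (n + 1)) (hu.prob n)
      (hu.minimal n) hφ).1).mul_const _)
    (fun n hn => by
      funext x
      simp only [hN (n + 1) (by omega), mul_zero, Pi.zero_apply])
  refine ⟨hA, hB, ?_⟩
  rw [hAv, hBv]
  simp only [integral_mul_const]
  set a : ℕ → ℝ := fun n => ∫ x in Ω, u n x * φ x with ha
  set e : ℕ → ℝ := fun n => η (n * τ) with he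
  set b : ℕ → ℝ := fun n => ∫ x in Ω, JKO.weakN Ω F (u n) φ x with hb
  have h1 : τ * ∑ n ∈ Finset.range N, a (n + 1) * ((e (n + 1 + 1) - e (n + 1)) / τ) =
      ∑ n ∈ Finset.range N, a (n + 1) * (e (n + 2) - e (n + 1)) := by
    rw [Finset.mul_sum]
    refine Finset.sum_congr rfl fun n _ => ?_
    field_simp
  have h2 : τ * ∑ n ∈ Finset.range N, b (n + 1) * e (n + 1) =
      ∑ n ∈ Finset.range N, e (n + 1) * (τ * b (n + 1)) := by
    rw [Finset.mul_sum]
    exact Finset.sum_congr rfl fun n _ => by ring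
  have h3 : η τ * ∫ x in Ω, u₀ x * φ x = e 1 * a 0 := by
    simp only [he, ha, hu.zero, Nat.cast_one, one_mul]
  have h4 : e (N + 1) = 0 := hN (N + 1) (by omega)
  -- After summation by parts the whole expression is a sum of one-step residuals weighted by `η`,
  -- each controlled by `weak_formulation_step`.
  have h5 : τ * ∑ n ∈ Finset.range N, a (n + 1) * ((e (n + 1 + 1) - e (n + 1)) / τ) +
      η τ * (∫ x in Ω, u₀ x * φ x) - τ * ∑ n ∈ Finset.range N, b (n + 1) * e (n + 1) =
      -∑ n ∈ Finset.range N, e (n + 1) * (a (n + 1) - a n + τ * b (n + 1)) := by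
    rw [h1, h2, h3, JKO.sum_range_mul_sub_eq, h4]
    simp only [mul_add, Finset.sum_add_distrib]
    ring
  refine (congrArg abs h5).trans_le ?_
  rw [abs_neg, ← hu.zero]
  exact JKO.abs_sum_mul_le (e := e) (b := fun n => a (n + 1) - a n + τ * b (n + 1))
    (E := fun n => (JKO.energy Ω F (JKO.densityMeasure Ω (u n))).toReal)
    ((abs_nonneg _).trans (hη.abs_le_normC0 0)) (JKO.normC2_nonneg hΩ hφ.smooth) hτ.le
    (fun n => hη.abs_le_normC0 _)
    (fun n => JKO.weak_formulation_step hΩ hF hτ (hu.prob (n + 1)) (hH (n + 1)) (hu.prob n)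
      (hu.minimal n) hφ)
    (fun n => ENNReal.toReal_nonneg)
    (fun n => (JKO.W2_sq_step_le hΩ hF hτ (hu.prob (n + 1)) (hu.prob n) (hH n)
      (hu.minimal n)).2) N
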